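/- **Setting.** Consider the KdV–KS equation $u_t+uu_x+u_{xxx}+\delta(u_{xx}+u_{xxxx})=0$. Let $(U_\delta,c_\delta)_{0\le\delta<\delta_0}$ be a family, smooth in $(\delta,x)$ up to $\delta=0$, of real $X$-periodic profiles and speeds ($X>0$ independent of $\delta$) with $$(U_\delta-c_\delta)U_\delta'+U_\delta'''+\delta(U_\delta''+U_\delta'''')=0,$$ such that the limiting KdV wave $U_0$ is nonconstant. For $\delta>0$ let $L v=-((U_\delta-c_\delta)v)'-v'''-\delta(v''+v'''')$, let $L_\xi w=e^{-i\xi x}L[e^{i\xi x}w]$ on $X$-periodic functions be its Bloch operators, and let $E(\lambda,\xi,\delta)=\det\big(R(X,\lambda,\delta)-e^{i\xi X}\mathrm{Id}_{\mathbb C^4}\big)$ be the Evans function, where $R(\cdot,\lambda,\delta)$, $R(0)=\mathrm{Id}$, is the fundamental matrix of $Lv=\lambda v$ written as a first order system for $(v,v',v'',v''')$. Let $E_{kdv}(\lambda,\xi)=\det\big(R_{kdv}(X,\lambda)-e^{i\xi X}\mathrm{Id}_{\mathbb C^3}\big)$ be the analogous function for the KdV linearization $-((U_0-c_0)v)'-v'''=\lambda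 v$, and let $$E_1(\lambda,\xi)=\lim_{\delta\to0^+}\delta^{-1}\big(-e^{-i\xi X}E(\lambda,\xi,\delta)-E_{kdv}(\lambda,\xi)\big)$$ be the coefficient of $\delta$ in the expansion of the renormalized Evans function. Assume that there are three distinct real numbers $\alpha_1^0<\alpha_2^0<\alpha_3^0$ such that $E_{kdv}(\cdot,\xi)$ has, for small $\xi\neq0$, roots $\lambda=i\alpha_j(\xi)\xi$ with $\alpha_j(\xi)\to\alpha_j^0$ as $\xi\to0$. Let $\Gamma_0=\tfrac16\partial_\lambda^3E_{kdv}(0,0)$, let $Q(\lambda,\xi)$ be the second order part of the Taylor expansion of $E_1$ at $(0,0)$, let $\gamma\in\mathbb R$ be the coefficient of $\lambda^2$ in $Q/\Gamma_0$, and, if $\gamma\ne0$, let $\beta_1^0,\beta_2^0$ be the numbers with $Q(\lambda,\xi)=\Gamma_0\,\gamma\,(\lambda-i\beta_1^0\xi)(\lambda-i\beta_2^0\xi)$. Consider the conditions - (S1) $\beta_1^0,\beta_2^0$ are real and distinct; - (S2) $\alpha_1^0<\beta_1^0<\alpha_2^0<\beta_2^0<\alpha_3^0$; - (S3) $\gamma>0$.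 **Statement.** There are constants $\epsilon_0,\eta_0,M_0>0$ (with $\eta_0<\delta_0$) such that for all $0<\delta\le\eta_0$ and $|\xi|\le\epsilon_0\delta$ the following holds. 1. $E(\cdot,\xi,\delta)$ has exactly three roots $\lambda_j(\xi,\delta)$, $j=1,2,3$, counted with multiplicity, in $|\lambda|\le M_0$. 2. If (S1) holds and $\gamma\neq0$, the roots can be labelled so that each $\lambda_j$ is a smooth function of $(\delta,\xi/\delta)\in[0,\eta_0]\times[-\epsilon_0,\epsilon_0]$, that $$\Re\lambda_3(\xi,\delta)=-\gamma\delta+o(\delta)\quad\text{as }(\delta,\xi/\delta)\to(0,0),$$ and that, for $\{i,i'\}=\{1,2\}$, uniformly in $0<\delta\le\eta_0$, $|\xi|\le\epsilon_0\delta$, $$\Re\lambda_i(\xi,\delta)=\frac{\xi^2}{\gamma\delta}\,\frac{\prod_{j=1}^3(\beta_i^0-\alpha_j^0)}{\beta_i^0-\beta_{i'}^0}+O\Big(\xi^2+\frac{\xi^4}{\delta^3}\Big)$$ (so that the remainder is $O(\xi^2)$ for $|\xi|\le\delta^{3/2}$). 3. If (S1), (S2) and (S3) hold, there is $\theta>0$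 such that, for all such $\delta,\xi$, $\Re\lambda_i(\xi,\delta)\le-\frac{\theta}{\delta}\xi^2$ for $i=1,2$; moreover every eigenvalue $\lambda$ of $L_\xi$ with $|\lambda|\le M_0$ satisfies $\Re\lambda\le-\frac{\theta}{\delta}\xi^2$, which is the dissipativity condition (D2) in this neighbourhood of the origin. -/

import Mathlib

open scoped ContDiff

namespace KdVKS

noncomputable section

/-- A family `U δ`, `0 ≤ δ < δ₀`, of `X`-periodic travelling wave profiles with speeds `c δ` of
`u_t + u u_x + u_xxx + δ (u_xx + u_xxxx) = 0`, depending smoothly on `δ` up to `δ = 0`, where the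
limit `U 0` is a nonconstant (that is, cnoidal) travelling wave of the KdV equation. -/
structure IsWaveFamily (X δ₀ : ℝ) (U : ℝ → ℝ → ℝ) (c : ℝ → ℝ) : Prop where
  period_pos : 0 < X
  delta_pos : 0 < δ₀
  smooth_profile : ContDiffOn ℝ ∞ (fun p : ℝ × ℝ => U p.1 p.2) (Set.Ico 0 δ₀ ×ˢ Set.univ)
  smooth_speed : ContDiffOn ℝ ∞ c (Set.Ico 0 δ₀)
  periodic : ∀ δ ∈ Set.Ico 0 δ₀, Function.Periodic (U δ) X
  profile_eq : ∀ δ ∈ Set.Ico 0 δ₀, ∀ x : ℝ,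
    (U δ x - c δ) * deriv (U δ) x + iteratedDeriv 3 (U δ) x
      + δ * (iteratedDeriv 2 (U δ) x + iteratedDeriv 4 (U δ) x) = 0
  nonconstant : ∃ x y : ℝ, U 0 x ≠ U 0 y

/-- `R` solves `R' = A R` on the line, with `R 0 = 1`. -/
def IsPrincipalSolution {n : ℕ} (A R : ℝ → Matrix (Fin n) (Fin n) ℂ) : Prop :=
  R 0 = 1 ∧ ∀ (x : ℝ) (i j : Fin n), HasDerivAt (fun y => R y i j) ((A x * R x) i j) x

/-- The solution of `R' = A R`, `R 0 = 1`; for continuous `A` it exists and is unique. -/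
def principalSolution {n : ℕ} (A : ℝ → Matrix (Fin n) (Fin n) ℂ) :
    ℝ → Matrix (Fin n) (Fin n) ℂ :=
  Classical.epsilon (IsPrincipalSolution A)

/-- The linearized operator `L v = -((u - c) v)' - v''' - δ (v'' + v'''')`. -/
def linOp (δ : ℝ) (u : ℝ → ℝ) (c : ℝ) (v : ℝ → ℂ) (x : ℝ) : ℂ :=
  -(deriv (fun y => ((u y - c : ℝ) : ℂ) * v y) x) - iteratedDeriv 3 v x
    - (δ : ℂ) * (iteratedDeriv 2 v x + iteratedDeriv 4 v x)

/-- `lam` is an eigenvalue of the Bloch operator `L_ξ w = e^{-iξx} L [e^{iξx} w]` on `X`-periodic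
functions. -/
def IsBlochEigenvalue (X δ : ℝ) (u : ℝ → ℝ) (c ξ : ℝ) (lam : ℂ) : Prop :=
  ∃ w : ℝ → ℂ, ContDiff ℝ 4 w ∧ Function.Periodic w X ∧ w ≠ 0 ∧
    ∀ x : ℝ, Complex.exp (-(Complex.I * ξ * x)) *
      linOp δ u c (fun y : ℝ => Complex.exp (Complex.I * ξ * y) * w y) x = lam * w x

/-- Coefficient matrix of `L v = lam v`, written for the vector `(v, v', v'', v''')`, `δ > 0`. -/
def kdvksMatrix (δ : ℝ) (u : ℝ → ℝ) (c : ℝ) (lam : ℂ) (x : ℝ) : Matrix (Fin 4) (Fin 4) ℂ :=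
  !![0, 1, 0, 0;
     0, 0, 1, 0;
     0, 0, 0, 1;
     -(((deriv u x : ℝ) : ℂ) + lam) / δ, -((u x - c : ℝ) : ℂ) / δ, -1, -1 / δ]

/-- Coefficient matrix of the linearized KdV spectral problem `-((u - c) v)' - v''' = lam v`. -/
def kdvMatrix (u : ℝ → ℝ) (c : ℝ) (lam : ℂ) (x : ℝ) : Matrix (Fin 3) (Fin 3) ℂ :=
  !![0, 1, 0;
     0, 0, 1;
     -(((deriv u x : ℝ) : ℂ) + lam), -((u x - c : ℝ) : ℂ), 0]

/-- The periodic Evans function `det (R(X) - e^{iξX} Id)` of the linearized KdV-KS equation. -/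
def evans (X δ : ℝ) (u : ℝ → ℝ) (c : ℝ) (lam : ℂ) (ξ : ℝ) : ℂ :=
  (principalSolution (kdvksMatrix δ u c lam) X
    - Complex.exp (Complex.I * ξ * X) • (1 : Matrix (Fin 4) (Fin 4) ℂ)).det

/-- The periodic Evans function `det (R_kdv(X) - e^{iξX} Id)` of the linearized KdV equation. -/
def evansKdV (X : ℝ) (u : ℝ → ℝ) (c : ℝ) (lam : ℂ) (ξ : ℝ) : ℂ :=
  (principalSolution (kdvMatrix u c lam) X
    - Complex.exp (Complex.I * ξ * X) • (1 : Matrix (Fin 3) (Fin 3) ℂ)).det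

/-- The coefficient `E₁(lam, ξ)` of `δ` in the expansion of the renormalized Evans function
`-e^{-iξX} E(lam, ξ, δ) = E_kdv(lam, ξ) + δ E₁(lam, ξ) + O(δ²)`, `δ → 0⁺`.
(One of the four Floquet multipliers tends to `0`, and the corresponding factor of `E`
to `-e^{iξX}`.) -/
def evansOne (X : ℝ) (U : ℝ → ℝ → ℝ) (c : ℝ → ℝ) (lam : ℂ) (ξ : ℝ) : ℂ :=
  Filter.limUnder (nhdsWithin (0 : ℝ) (Set.Ioi 0)) fun δ : ℝ =>
    (-(Complex.exp (-(Complex.I * ξ * X))) * evans X δ (U δ) (c δ) lam ξ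
      - evansKdV X (U 0) (c 0) lam ξ) / (δ : ℂ)

/-- The coefficient `Γ(0,0)` of `lam³` in the Taylor expansion of `E_kdv` at the origin. -/
def leadingCoeff (X : ℝ) (u : ℝ → ℝ) (c : ℝ) : ℂ :=
  iteratedDeriv 3 (fun lam : ℂ => evansKdV X u c lam 0) 0 / 6

/-- The coefficient of `lam²` in the Taylor expansion of `E₁` at the origin. -/
def quad20 (X : ℝ) (U : ℝ → ℝ → ℝ) (c : ℝ → ℝ) : ℂ :=
  iteratedDeriv 2 (fun lam : ℂ => evansOne X U c lam 0) 0 / 2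

/-- The coefficient of `lam ξ` in the Taylor expansion of `E₁` at the origin. -/
def quad11 (X : ℝ) (U : ℝ → ℝ → ℝ) (c : ℝ → ℝ) : ℂ :=
  deriv (fun ξ : ℝ => deriv (fun lam : ℂ => evansOne X U c lam ξ) 0) 0

/-- The coefficient of `ξ²` in the Taylor expansion of `E₁` at the origin. -/
def quad02 (X : ℝ) (U : ℝ → ℝ → ℝ) (c : ℝ → ℝ) : ℂ :=
  iteratedDeriv 2 (fun ξ : ℝ => evansOne X U c 0 ξ) 0 / 2

/-- The constant `γ`: after division of the Evans function by `Γ`, the coefficient of `δ lam²`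
(a real number). -/
def gammaCoeff (X : ℝ) (U : ℝ → ℝ → ℝ) (c : ℝ → ℝ) : ℝ :=
  (quad20 X U c / leadingCoeff X (U 0) (c 0)).re

/-- `β₁⁰, β₂⁰`: the numbers for which the quadratic principal part of `E₁` at the origin is
proportional to `(lam - iβ₁⁰ξ)(lam - iβ₂⁰ξ)`. -/
def AreBetas (X : ℝ) (U : ℝ → ℝ → ℝ) (c : ℝ → ℝ) (b : Fin 2 → ℂ) : Prop :=
  ∀ (lam : ℂ) (ξ : ℝ),
    quad20 X U c * lam ^ 2 + quad11 X U c * lam * ξ + quad02 X U c * (ξ : ℂ) ^ 2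
      = quad20 X U c * ∏ k, (lam - Complex.I * b k * ξ)

/-- `a` is one of the `α_j⁰`: there are roots `lam = i α(ξ) ξ` of `E_kdv(·, ξ)` for small `ξ`, with
`α(ξ) → a` as `ξ → 0`. -/
def IsKdVCharacteristic (X : ℝ) (u : ℝ → ℝ) (c : ℝ) (a : ℝ) : Prop :=
  ∃ A : ℝ → ℂ, Filter.Tendsto A (nhdsWithin 0 {0}ᶜ) (nhds (a : ℂ)) ∧
    ∀ᶠ ξ : ℝ in nhdsWithin 0 {0}ᶜ, evansKdV X u c (Complex.I * A ξ * ξ) ξ = 0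

/-- `r 0, r 1, r 2` are the roots of the entire function `f` in the closed disc of radius `M`,
listed with multiplicity. -/
def AreTheRoots (f : ℂ → ℂ) (M : ℝ) (r : Fin 3 → ℂ) : Prop :=
  Differentiable ℂ f ∧ (∀ j, ‖r j‖ ≤ M) ∧
    ∀ z : ℂ, ‖z‖ ≤ M → analyticOrderAt f z = (Set.ncard {j | r j = z} : ℕ∞)

/-- `∏_j (b - α_j) / (b - b')`. -/
def driftCoeff (α : Fin 3 → ℝ) (b b' : ℝ) : ℝ := (∏ j, (b - α j)) / (b - b')

end

end KdVKS

/-! At `δ = 0` the fourth order spectral problem degenerates to the third order KdV one. Once the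
renormalized Evans function is known to extend smoothly to `δ = 0`, what remains is a Newton polygon
analysis of its zeros near the origin.

Smoothness. The equation `δ v'''' = -v''' + g · (v, v', v'')` has formal slow manifolds `v''' = h ·
(v, v', v'')` whose residual is of arbitrarily high order in `δ` (`exists_isSlowManifold`). The
deviation from such a manifold, divided by `δ^m`, obeys a strongly damped equation, and Duhamel's
formula expresses everything through kernels `δ^m e^{-x/δ}`, which are `C^k` across `δ = 0` once `m
≥ 2k + 2` (`contDiff_expKernel`). In these coordinates the monodromy matrix is `C^k` up to `δ = 0`
(`contDiffOn_monodromy`), where it has a zero row and the KdV monodromy as a block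
(`det_monodromy_zero`). For `δ > 0` the change of coordinates is a conjugation, so the determinant
is the Evans function (`contDiffOn_evansExt`).

Structure. Translation invariance gives the right kernel vector `U'`, conservation form gives a left
one, and together they make the Evans function vanish to second order in `(lam, ξ)` at the origin
(`evansExt_double_zero`). At `δ = 0` three distinct `α_j` force the quadratic part to vanish and the
cubic part to be `Γ₀ ∏ (lam - iα_j ξ)`. Hence the Evans function is a cubic plus `δ` times a
quadratic, up to higher order terms (`NormalForm`).

Roots. With `ξ = δσ`, `lam = δz`, the function divided by `δ³` tends to `Γ₀ z² (z + γ)` as `(δ, σ) →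
0`. The simple zero `-γ` continues smoothly. The double zero is resolved by `z = σw`, which leads to
`Γ₀ γ (w - iβ₁)(w - iβ₂)` with simple zeros again. Their first order correction in `σ` at `δ = 0` is
the drift `∏ (β_i - α_j) / (γ (β_i - β_{i'}))`. Complex conjugation makes `Re w` odd in `σ`, and
this parity yields the stated remainder (`exists_bound_of_odd`). Interlacing and `γ > 0` make both
drifts negative. The argument principle shows that these three are all the small roots
(`exists_three_zeros`, `eq_roots`). -/

namespace KdVKS

noncomputable section

set_option linter.unusedSectionVars false

open Set Filter Topology

/-! ### Smooth families of functions as smooth maps into spaces of continuous functions -/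

/-- The pointwise application of a continuous family of operators, as a bounded operator-valued
map. -/
def applySwap (K P E : Type) [TopologicalSpace K] [CompactSpace K]
    [NormedAddCommGroup P] [NormedSpace ℝ P] [NormedAddCommGroup E] [NormedSpace ℝ E] :
    C(K, P →L[ℝ] E) →L[ℝ] (P →L[ℝ] C(K, E)) :=
  LinearMap.mkContinuous₂
    (LinearMap.mk₂ ℝ (fun (F : C(K, P →L[ℝ] E)) (v : P) =>
      (⟨fun t => F t v, by fun_prop⟩ : C(K, E)))
      (fun _ _ _ => by ext; simp) (fun _ _ _ => by ext; simp)
      (fun _ _ _ => by ext; simp) (fun _ _ _ => by ext; simp))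
    1
    (fun F v => by
      rw [one_mul]
      refine (ContinuousMap.norm_le _ (by positivity)).2 fun t => ?_
      exact ((F t).le_opNorm v).trans (by gcongr; exact F.norm_coe_le_norm t))

@[simp] lemma applySwap_apply {K P E : Type} [TopologicalSpace K] [CompactSpace K]
    [NormedAddCommGroup P] [NormedSpace ℝ P] [NormedAddCommGroup E] [NormedSpace ℝ E]
    (F : C(K, P →L[ℝ] E)) (v : P) (t : K) : applySwap K P E F v t = F t v := rfl

section Curry

variable {P : Type} [NormedAddCommGroup P] [NormedSpace ℝ P]

lemma continuousOn_curry {E : Type} [NormedAddCommGroup E] {S : Set P} {a b : ℝ}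
    {f : P × ℝ → E} (hf : ContinuousOn f (S ×ˢ Icc a b)) {F : P → C(Icc a b, E)}
    (hF : ∀ p ∈ S, ∀ t : Icc a b, F p t = f (p, t)) : ContinuousOn F S := by
  rw [continuousOn_iff_continuous_domRestrict]
  have hc : Continuous fun x : S × Icc a b => f (x.1, x.2) :=
    hf.comp_continuous (by fun_prop) fun x => ⟨x.1.2, x.2.2⟩
  have := (ContinuousMap.curry ⟨_, hc⟩).continuous
  convert this using 1
  ext p t
  simp [hF p.1 p.2 t]

/-- The derivative of the curried map is the curried partial derivative, a family with values in `P
→L[ℝ] E`; hence the induction on `n` with `E` generalized. Differentiability in the sup norm needs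
an estimate uniform in `t`, which the mean value inequality on the convex set `S ∩ ball` provides.
-/
theorem contDiffOn_nat_curry {S : Set P} (hS : Convex ℝ S) (hSu : UniqueDiffOn ℝ S) {a b : ℝ}
    (hab : a < b) (n : ℕ) {E : Type} [NormedAddCommGroup E] [NormedSpace ℝ E] {f : P × ℝ → E}
    (hf : ContDiffOn ℝ n f (S ×ˢ Icc a b)) {F : P → C(Icc a b, E)}
    (hF : ∀ p ∈ S, ∀ t : Icc a b, F p t = f (p, t)) : ContDiffOn ℝ n F S := by
  induction n generalizing E with
  | zero =>
    exact contDiffOn_zero.2 (continuousOn_curry (contDiffOn_zero.1 hf) hF)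
  | succ n ih =>
    have hu : UniqueDiffOn ℝ (S ×ˢ Icc a b) := hSu.prod (uniqueDiffOn_Icc hab)
    set f' : P × ℝ → (P →L[ℝ] E) := fun x =>
      (fderivWithin ℝ f (S ×ˢ Icc a b) x).comp (ContinuousLinearMap.inl ℝ P ℝ) with hf'
    have hf's : ContDiffOn ℝ n f' (S ×ˢ Icc a b) :=
      (hf.fderivWithin hu (by norm_cast)).clm_comp contDiffOn_const
    have hcont : ∀ p ∈ S, Continuous fun t : Icc a b => f' (p, t) := fun p hp =>
      hf's.continuousOn.comp_continuous (by fun_prop) fun t => ⟨hp, t.2⟩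
    classical
    set F' : P → C(Icc a b, P →L[ℝ] E) := fun p => if h : p ∈ S then ⟨_, hcont p h⟩ else 0 with hF'
    have hF'v : ∀ p ∈ S, ∀ t : Icc a b, F' p t = f' (p, t) := fun p hp t => by
      simp [hF', hp]
    have hF's := ih hf's hF'v
    have hsw : ContDiff ℝ n fun G : C(Icc a b, P →L[ℝ] E) => applySwap (Icc a b) P E G :=
      ContinuousLinearMap.contDiff (𝕜 := ℝ) (E := C(Icc a b, P →L[ℝ] E))
        (F := P →L[ℝ] C(Icc a b, E))
        (applySwap (Icc a b) P E)
    refine (contDiffOn_succ_iff_hasFDerivWithinAt_of_uniqueDiffOn hSu).2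
      ⟨fun h => absurd h (WithTop.natCast_ne_top n), fun p => applySwap (Icc a b) P E (F' p),
        hsw.comp_contDiffOn hF's, fun p hp => ?_⟩
    have hder : ∀ t : Icc a b, ∀ q ∈ S, HasFDerivWithinAt (fun q => f (q, t)) (f' (q, t)) S q := by
      intro t q hq
      have h1 : HasFDerivWithinAt f (fderivWithin ℝ f (S ×ˢ Icc a b) (q, t))
          (S ×ˢ Icc a b) (q, t) :=
        ((hf.differentiableOn (by simp)) (q, t) ⟨hq, t.2⟩).hasFDerivWithinAt
      have hmaps : MapsTo (fun r => (r, (t : ℝ))) S (S ×ˢ Icc a b) := fun r hr => ⟨hr, t.2⟩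
      exact h1.comp q (hasFDerivAt_prodMk_left q (t : ℝ)).hasFDerivWithinAt hmaps
    rw [hasFDerivWithinAt_iff_isLittleO, Asymptotics.isLittleO_iff]
    intro ε hε
    have hcF' : ContinuousWithinAt F' S p := hF's.continuousOn p hp
    -- Continuity of `F'` in the sup norm gives one radius for all `t`.
    obtain ⟨r, hr, hball⟩ := (Metric.continuousWithinAt_iff (α := P)
      (β := C(Icc a b, P →L[ℝ] E))).1 hcF' ε hε
    have hmem : S ∩ Metric.ball p r ∈ 𝓝[S] p :=
      inter_mem_nhdsWithin _ (Metric.ball_mem_nhds p hr)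
    filter_upwards [hmem] with q hq
    refine (ContinuousMap.norm_le _ (by positivity)).2 fun t => ?_
    have := Convex.norm_image_sub_le_of_norm_hasFDerivWithin_le' (f := fun q => f (q, t))
      (f' := fun q => f' (q, t)) (φ := f' (p, t)) (C := ε) (s := S ∩ Metric.ball p r)
      (fun x hx => (hder t x hx.1).mono inter_subset_left)
      (fun x hx => ?_) (hS.inter (convex_ball p r)) ⟨hp, Metric.mem_ball_self hr⟩ hq
    · simpa [hF p hp, hF q hq.1, hF'v p hp] using this
    · have h1 := hball hx.1 hx.2
      have h2 := (ContinuousMap.dist_apply_le_dist (f := F' x) (g := F' p) t).trans h1.le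
      rw [hF'v x hx.1, hF'v p hp] at h2
      exact (dist_eq_norm _ _).symm.trans_le h2

theorem contDiffOn_curry {S : Set P} (hS : Convex ℝ S) (hSu : UniqueDiffOn ℝ S) {a b : ℝ}
    (hab : a < b) {E : Type} [NormedAddCommGroup E] [NormedSpace ℝ E] {f : P × ℝ → E}
    (hf : ContDiffOn ℝ ∞ f (S ×ˢ Icc a b)) {F : P → C(Icc a b, E)}
    (hF : ∀ p ∈ S, ∀ t : Icc a b, F p t = f (p, t)) : ContDiffOn ℝ ∞ F S :=
  contDiffOn_infty.2 fun n => contDiffOn_nat_curry hS hSu hab n (contDiffOn_infty.1 hf n) hF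

end Curry

/-! ### Convolution operators on an interval -/

section Conv

variable {𝕜 : Type} [RCLike 𝕜] {E : Type} [NormedAddCommGroup E] [NormedSpace ℝ E]
  [NormedSpace 𝕜 E] {X : ℝ}

/-- Both factors are extended constantly beyond `[0, X]` so that the integrand is defined on the
whole line; for `x` in `[0, X]` the integral only sees arguments in `[0, X]`. -/
lemma continuous_convFun (hX : 0 ≤ X) (k : C(Icc 0 X, 𝕜)) (f : C(Icc 0 X, E)) :
    Continuous fun x : ℝ => ∫ s in (0 : ℝ)..x, IccExtend hX k (x - s) • IccExtend hX f s := by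
  have hk : Continuous (IccExtend hX k) := k.continuous.Icc_extend'
  have hf : Continuous (IccExtend hX f) := f.continuous.Icc_extend'
  exact intervalIntegral.continuous_parametric_intervalIntegral_of_continuous
    (f := fun x s => IccExtend hX k (x - s) • IccExtend hX f s)
    ((hk.comp (continuous_fst.sub continuous_snd)).smul (hf.comp continuous_snd)) continuous_id

lemma norm_IccExtend_le (hX : 0 ≤ X) (f : C(Icc 0 X, E)) (s : ℝ) : ‖IccExtend hX f s‖ ≤ ‖f‖ :=
  f.norm_coe_le_norm _

/-- Convolution on `[0, X]`: `(k, f) ↦ ∫₀ˣ k(x - s) f(s) ds`. -/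
def conv (𝕜 E : Type) [RCLike 𝕜] [NormedAddCommGroup E] [NormedSpace ℝ E] [NormedSpace 𝕜 E]
    [SMulCommClass ℝ 𝕜 E] {X : ℝ} (hX : 0 ≤ X) :
    C(Icc 0 X, 𝕜) →L[𝕜] C(Icc 0 X, E) →L[𝕜] C(Icc 0 X, E) :=
  LinearMap.mkContinuous₂
    (LinearMap.mk₂ 𝕜 (fun (k : C(Icc 0 X, 𝕜)) (f : C(Icc 0 X, E)) =>
      (⟨fun x => ∫ s in (0 : ℝ)..x, IccExtend hX k (x - s) • IccExtend hX f s,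
        (continuous_convFun hX k f).comp continuous_subtype_val⟩ : C(Icc 0 X, E)))
      (fun k l f => by
        ext x
        have h : ∀ k : C(Icc 0 X, 𝕜), IntervalIntegrable
            (fun s => IccExtend hX k (x - s) • IccExtend hX f s) MeasureTheory.volume 0 x :=
          fun k => Continuous.intervalIntegrable
            ((k.continuous.Icc_extend'.comp (by fun_prop)).smul f.continuous.Icc_extend') _ _
        simp only [ContinuousMap.coe_mk, ContinuousMap.add_apply]
        rw [← intervalIntegral.integral_add (h k) (h l)]
        simp [IccExtend, add_smul])
      (fun c k f => by
        ext x
        simp only [ContinuousMap.coe_mk, ContinuousMap.smul_apply]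
        rw [← intervalIntegral.integral_smul]
        simp [IccExtend, mul_smul])
      (fun k f g => by
        ext x
        have h : ∀ f : C(Icc 0 X, E), IntervalIntegrable
            (fun s => IccExtend hX k (x - s) • IccExtend hX f s) MeasureTheory.volume 0 x :=
          fun f => Continuous.intervalIntegrable
            ((k.continuous.Icc_extend'.comp (by fun_prop)).smul f.continuous.Icc_extend') _ _
        simp only [ContinuousMap.coe_mk, ContinuousMap.add_apply]
        rw [← intervalIntegral.integral_add (h f) (h g)]
        simp [IccExtend, smul_add])
      (fun c k f => by
        ext x
        simp only [ContinuousMap.coe_mk, ContinuousMap.smul_apply]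
        rw [← intervalIntegral.integral_smul]
        simp [IccExtend, smul_comm c]))
    X
    (fun k f => by
      refine (ContinuousMap.norm_le _ (by positivity)).2 fun x => ?_
      have := intervalIntegral.norm_integral_le_of_norm_le_const (a := 0) (b := (x : ℝ))
        (f := fun s => IccExtend hX k (x - s) • IccExtend hX f s) (C := ‖k‖ * ‖f‖)
        (fun s _ => by
          rw [norm_smul]
          gcongr
          · exact norm_IccExtend_le hX k _
          · exact norm_IccExtend_le hX f _)
      refine this.trans ?_
      rw [sub_zero, abs_of_nonneg x.2.1, mul_comm, ← mul_assoc]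
      gcongr
      exact x.2.2)

variable [SMulCommClass ℝ 𝕜 E]

lemma conv_apply (hX : 0 ≤ X) (k : C(Icc 0 X, 𝕜)) (f : C(Icc 0 X, E)) (x : Icc 0 X) :
    conv 𝕜 E hX k f x = ∫ s in (0 : ℝ)..x, IccExtend hX k (x - s) • IccExtend hX f s := rfl

lemma conv_one_apply (hX : 0 ≤ X) (f : C(Icc 0 X, E)) (x : Icc 0 X) :
    conv 𝕜 E hX 1 f x = ∫ s in (0 : ℝ)..x, IccExtend hX f s := by
  simp [conv_apply, IccExtend]

lemma norm_conv_apply_le (hX : 0 ≤ X) (k : C(Icc 0 X, 𝕜)) (f : C(Icc 0 X, E)) (x : Icc 0 X) :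
    ‖conv 𝕜 E hX k f x‖ ≤ ‖k‖ * ∫ s in (0 : ℝ)..x, ‖IccExtend hX f s‖ := by
  rw [conv_apply, ← intervalIntegral.integral_const_mul]
  have hf : Continuous (IccExtend hX f) := f.continuous.Icc_extend'
  refine intervalIntegral.norm_integral_le_of_norm_le x.2.1 (Eventually.of_forall fun s _ => ?_)
    (Continuous.intervalIntegrable (by fun_prop) _ _)
  rw [norm_smul]
  exact mul_le_mul_of_nonneg_right (norm_IccExtend_le hX k _) (norm_nonneg _)

/-- An operator on `C([0, X], E)` of Volterra type, with constant `C`. -/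
def IsVolterra (hX : 0 ≤ X) (C : ℝ) (T : C(Icc 0 X, E) →L[𝕜] C(Icc 0 X, E)) : Prop :=
  ∀ f x, ‖T f x‖ ≤ C * ∫ s in (0 : ℝ)..x, ‖IccExtend hX f s‖

/-- Each application integrates `s^n` to `x^(n+1)/(n+1)`, which accumulates the factorial. -/
lemma IsVolterra.norm_pow_apply_le {hX : 0 ≤ X} {C : ℝ} (hC : 0 ≤ C)
    {T : C(Icc 0 X, E) →L[𝕜] C(Icc 0 X, E)} (hT : IsVolterra hX C T) (n : ℕ)
    (f : C(Icc 0 X, E)) (x : Icc 0 X) :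
    ‖(T ^ n) f x‖ ≤ (C * x) ^ n / n.factorial * ‖f‖ := by
  induction n generalizing x with
  | zero => simpa using f.norm_coe_le_norm x
  | succ n ih =>
    rw [pow_succ', mul_apply_eq_comp]
    have hc : Continuous (IccExtend hX ((T ^ n) f)) :=
      ((T ^ n) f).continuous.Icc_extend'
    have hmono : ∫ s in (0 : ℝ)..x, ‖IccExtend hX ((T ^ n) f) s‖
        ≤ ∫ s in (0 : ℝ)..x, C ^ n / n.factorial * ‖f‖ * s ^ n := by
      refine intervalIntegral.integral_mono_on x.2.1 (hc.norm.intervalIntegrable _ _)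
        (Continuous.intervalIntegrable (by fun_prop) _ _) fun s hs => ?_
      have hsX : s ∈ Icc 0 X := ⟨hs.1, hs.2.trans x.2.2⟩
      rw [IccExtend_of_mem _ _ hsX]
      refine (ih ⟨s, hsX⟩).trans (le_of_eq ?_)
      simp only [mul_pow]
      ring
    refine (hT _ x).trans ((mul_le_mul_of_nonneg_left hmono hC).trans (le_of_eq ?_))
    rw [intervalIntegral.integral_const_mul, integral_pow, Nat.factorial_succ]
    push_cast
    field_simp
    ring

/-- By the factorial decay some power `T ^ n` has norm less than one, and `1 - T` is a commuting
factor of the invertible `1 - T ^ n`. Neither `C` nor `X` has to be small. -/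
lemma IsVolterra.isUnit_one_sub [CompleteSpace E] {hX : 0 ≤ X} {C : ℝ} (hC : 0 ≤ C)
    {T : C(Icc 0 X, E) →L[𝕜] C(Icc 0 X, E)} (hT : IsVolterra hX C T) : IsUnit (1 - T) := by
  have hlim := FloorSemiring.tendsto_pow_div_factorial_atTop (C * X)
  obtain ⟨n, hn⟩ := ((tendsto_order.1 hlim).2 1 one_pos).exists
  have hnorm : ‖T ^ n‖ < 1 := by
    refine lt_of_le_of_lt (ContinuousLinearMap.opNorm_le_bound _ (by positivity) fun f => ?_) hn
    refine (ContinuousMap.norm_le _ (by positivity)).2 fun x => ?_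
    refine (hT.norm_pow_apply_le hC n f x).trans ?_
    gcongr
    · exact mul_nonneg hC x.2.1
    · exact x.2.2
  have hu : IsUnit (1 - T ^ n) := 
    (Units.oneSub (R := C(Icc 0 X, E) →L[𝕜] C(Icc 0 X, E)) (T ^ n) hnorm).isUnit
  have h1 : (1 - T) * (∑ i ∈ Finset.range n, T ^ i) = 1 - T ^ n := mul_neg_geom_sum T n
  have hcomm : Commute (1 - T) (∑ i ∈ Finset.range n, T ^ i) := by
    refine Commute.sum_right _ _ _ fun i _ => ?_
    exact ((Commute.one_left T).sub_left (Commute.refl T)).pow_right i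
  rw [← h1] at hu
  exact (hcomm.isUnit_mul_iff.1 hu).1

end Conv

end

end KdVKS

namespace KdVKS

noncomputable section

set_option linter.unusedSectionVars false

open Set Filter Topology

/-! ### Parameter integrals and division of smooth functions -/

section ParameterIntegral

variable {P : Type} [NormedAddCommGroup P] [NormedSpace ℝ P]
  {E : Type} [NormedAddCommGroup E] [NormedSpace ℝ E]

/-- Integration over `[0, X]` as a continuous linear form. -/
def intCLM (E : Type) [NormedAddCommGroup E] [NormedSpace ℝ E] {X : ℝ} (hX : 0 ≤ X) :
    C(Icc 0 X, E) →L[ℝ] E :=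
  (ContinuousMap.evalCLM ℝ ⟨X, hX, le_rfl⟩).comp (conv ℝ E hX 1)

lemma intCLM_apply {X : ℝ} (hX : 0 ≤ X) (f : C(Icc 0 X, E)) :
    intCLM E hX f = ∫ s in (0 : ℝ)..X, IccExtend hX f s := by
  simp [intCLM, conv_one_apply]

/-- Integration is a bounded linear form on `C([0, X], E)`, so only the smoothness of the curried
family matters. -/
theorem contDiffOn_integral {S : Set P} (hS : Convex ℝ S) (hSu : UniqueDiffOn ℝ S) {X : ℝ}
    (hX : 0 < X) {f : P × ℝ → E} (hf : ContDiffOn ℝ ∞ f (S ×ˢ Icc 0 X)) :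
    ContDiffOn ℝ ∞ (fun p => ∫ t in (0 : ℝ)..X, f (p, t)) S := by
  classical
  have hcont : ∀ p ∈ S, Continuous fun t : Icc 0 X => f (p, t) := fun p hp =>
    hf.continuousOn.comp_continuous (by fun_prop) fun t => ⟨hp, t.2⟩
  set F : P → C(Icc 0 X, E) := fun p => if h : p ∈ S then ⟨_, hcont p h⟩ else 0 with hF
  have hFv : ∀ p ∈ S, ∀ t : Icc 0 X, F p t = f (p, t) := fun p hp t => by simp [hF, hp]
  have hFs : ContDiffOn ℝ ∞ F S := contDiffOn_curry hS hSu hX hf hFv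
  refine ((intCLM E hX.le).contDiff.comp_contDiffOn hFs).congr fun p hp => ?_
  rw [Function.comp_apply, intCLM_apply]
  refine intervalIntegral.integral_congr fun t ht => ?_
  rw [uIcc_of_le hX.le] at ht
  rw [IccExtend_of_mem _ _ ht, hFv p hp]

/-- Hadamard's lemma, with quotient `∫₀¹ ∂ₛ f(ts, p) dt`. The interval need not be open, which
permits division by `δ` up to the boundary `δ = 0`. -/
theorem exists_contDiffOn_eq_smul [CompleteSpace E] {I : Set ℝ} (hI : Convex ℝ I)
    (hIu : UniqueDiffOn ℝ I) (h0 : (0 : ℝ) ∈ I) {V : Set P} (hV : Convex ℝ V)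
    (hVu : UniqueDiffOn ℝ V) {f : ℝ × P → E} (hf : ContDiffOn ℝ ∞ f (I ×ˢ V))
    (hf0 : ∀ p ∈ V, f (0, p) = 0) :
    ∃ g : ℝ × P → E, ContDiffOn ℝ ∞ g (I ×ˢ V) ∧ ∀ s ∈ I, ∀ p ∈ V, f (s, p) = s • g (s, p) := by
  have hu : UniqueDiffOn ℝ (I ×ˢ V) := hIu.prod hVu
  set f' : ℝ × P → E := fun x => fderivWithin ℝ f (I ×ˢ V) x (1, 0) with hf'
  have hf's : ContDiffOn ℝ ∞ f' (I ×ˢ V) :=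
    (hf.fderivWithin hu (by simp)).clm_apply contDiffOn_const
  have hmul : ∀ s ∈ I, ∀ t ∈ Icc (0 : ℝ) 1, t * s ∈ I := fun s hs t ht => by
    have := hI.smul_mem_of_zero_mem h0 hs ht
    simpa using this
  have hcomp : ContDiffOn ℝ ∞ (fun x : (ℝ × P) × ℝ => f' (x.2 * x.1.1, x.1.2))
      ((I ×ˢ V) ×ˢ Icc 0 1) :=
    hf's.comp (t := I ×ˢ V) (f := fun x : (ℝ × P) × ℝ => (x.2 * x.1.1, x.1.2))
      (by fun_prop) fun x hx => ⟨hmul _ hx.1.1 _ hx.2, hx.1.2⟩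
  refine ⟨fun x => ∫ t in (0 : ℝ)..1, f' (t * x.1, x.2),
    contDiffOn_integral (hI.prod hV) hu one_pos hcomp, fun s hs p hp => ?_⟩
  have hder : ∀ t ∈ Icc (0 : ℝ) 1,
      HasDerivWithinAt (fun t : ℝ => f (t * s, p)) (s • f' (t * s, p)) (Icc 0 1) t := by
    intro t ht
    have h1 : HasFDerivWithinAt f (fderivWithin ℝ f (I ×ˢ V) (t * s, p)) (I ×ˢ V) (t * s, p) :=
      (hf.differentiableOn (by simp) _ ⟨hmul s hs t ht, hp⟩).hasFDerivWithinAt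
    have h2 : HasDerivWithinAt (fun t : ℝ => (t * s, p)) (s, 0) (Icc 0 1) t := by
      have := ((hasDerivAt_id t).mul_const s).prodMk (hasDerivAt_const t p)
      simpa using this.hasDerivWithinAt
    have hmaps : MapsTo (fun t : ℝ => (t * s, p)) (Icc 0 1) (I ×ˢ V) :=
      fun r hr => ⟨hmul s hs r hr, hp⟩
    have h3 := h1.comp_hasDerivWithinAt t h2 hmaps
    have h4 : ((s, 0) : ℝ × P) = s • (1, 0) := by simp
    rw [h4, map_smul] at h3
    exact h3
  have hc' : ContinuousOn (fun t : ℝ => s • f' (t * s, p)) (Icc 0 1) := by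
    refine ContinuousOn.const_smul (hf's.continuousOn.comp (f := fun t : ℝ => (t * s, p))
      (by fun_prop) fun t ht => ⟨hmul s hs t ht, hp⟩) s
  have hftc := intervalIntegral.integral_eq_sub_of_hasDerivAt_of_le zero_le_one
    (fun t ht => (hder t ht).continuousWithinAt)
    (fun t ht => (hder t (Ioo_subset_Icc_self ht)).hasDerivAt (Icc_mem_nhds ht.1 ht.2))
    (hc'.intervalIntegrable_of_Icc zero_le_one)
  simp only [intervalIntegral.integral_smul, one_mul, zero_mul, hf0 p hp, sub_zero] at hftc
  exact hftc.symm

lemma hasDerivWithinAt_of_eq_smul {I : Set ℝ} (h0 : (0 : ℝ) ∈ I) {f g : ℝ → E}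
    (hfg : ∀ s ∈ I, f s = s • g s) (hg : ContinuousWithinAt g I 0) :
    HasDerivWithinAt f (g 0) I 0 := by
  rw [hasDerivWithinAt_iff_tendsto_slope]
  have h1 : Tendsto g (𝓝[I \ {0}] 0) (𝓝 (g 0)) := hg.mono_left (nhdsWithin_mono _ sdiff_subset)
  refine h1.congr' ?_
  filter_upwards [self_mem_nhdsWithin] with s hs
  have hs0 : s ≠ 0 := hs.2
  simp [slope, hfg s hs.1, hfg 0 h0, smul_smul, hs0]

end ParameterIntegral

/-! ### The rescaled boundary layer kernels -/

section Kernel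

variable {X : ℝ}

/-- The kernel `δ^m x^j e^{-x/δ}` on `[0, X]`, extended by zero to `δ ≤ 0`. -/
def expKernel (X : ℝ) (m j : ℕ) (δ : ℝ) : C(Icc 0 X, ℝ) :=
  ⟨fun x => if 0 < δ then δ ^ m * (x : ℝ) ^ j * Real.exp (-(x / δ)) else 0, by
    split_ifs <;> fun_prop⟩

lemma expKernel_of_pos {m j : ℕ} {δ : ℝ} (hδ : 0 < δ) (x : Icc 0 X) :
    expKernel X m j δ x = δ ^ m * (x : ℝ) ^ j * Real.exp (-(x / δ)) := by
  simp [expKernel, hδ]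

lemma expKernel_of_nonpos {m j : ℕ} {δ : ℝ} (hδ : δ ≤ 0) : expKernel X m j δ = 0 := by
  ext x; simp [expKernel, hδ.not_gt]

lemma norm_expKernel_le (hX : 0 ≤ X) (m j : ℕ) (δ : ℝ) :
    ‖expKernel X m j δ‖ ≤ |δ| ^ m * X ^ j := by
  refine (ContinuousMap.norm_le _ (by positivity)).2 fun x => ?_
  rcases le_or_gt δ 0 with h | h
  · rw [expKernel_of_nonpos h]; simp; positivity
  · rw [expKernel_of_pos h, Real.norm_eq_abs, abs_mul, abs_mul, abs_pow, abs_pow]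
    have hx : |(x : ℝ)| ≤ X := by rw [abs_of_nonneg x.2.1]; exact x.2.2
    have he : |Real.exp (-((x : ℝ) / δ))| ≤ 1 := by
      rw [abs_of_pos (Real.exp_pos _), Real.exp_le_one_iff]
      have := div_nonneg x.2.1 h.le
      linarith
    calc |δ| ^ m * |(x : ℝ)| ^ j * |Real.exp (-((x : ℝ) / δ))|
        ≤ |δ| ^ m * X ^ j * 1 := by gcongr
      _ = _ := mul_one _

/-- Differentiating `e^{-x/δ}` in `δ` produces `x/δ²`: a derivative costs at most two powers of `δ`
and the family of kernels is closed under it. At `δ = 0` the bound `|δ|^m X^j` with `m ≥ 2` gives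
the derivative zero. -/
lemma hasDerivAt_expKernel (hX : 0 < X) {m : ℕ} (hm : 2 ≤ m) (j : ℕ) (δ : ℝ) :
    HasDerivAt (expKernel X m j)
      ((m : ℝ) • expKernel X (m - 1) j δ + expKernel X (m - 2) (j + 1) δ) δ := by
  rcases lt_trichotomy δ 0 with h | h | h
  · have h1 : expKernel X m j =ᶠ[𝓝 δ] fun _ => 0 := by
      filter_upwards [Iio_mem_nhds h] with d hd using expKernel_of_nonpos (le_of_lt hd)
    rw [expKernel_of_nonpos h.le, expKernel_of_nonpos h.le, smul_zero, add_zero]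
    exact (hasDerivAt_const δ (0 : C(Icc 0 X, ℝ))).congr_of_eventuallyEq h1
  · subst h
    rw [expKernel_of_nonpos le_rfl, expKernel_of_nonpos le_rfl, smul_zero, add_zero]
    rw [hasDerivAt_iff_isLittleO]
    simp only [expKernel_of_nonpos le_rfl, sub_zero, smul_zero]
    have h1 : (expKernel X m j) =O[𝓝 0] fun d : ℝ => d ^ m := by
      refine Asymptotics.IsBigO.of_bound (X ^ j) (Eventually.of_forall fun d => ?_)
      rw [norm_pow, Real.norm_eq_abs, mul_comm]
      exact norm_expKernel_le hX.le m j d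
    have h2 : (fun d : ℝ => d ^ m) =o[𝓝 0] fun d : ℝ => d ^ 1 :=
      Asymptotics.isLittleO_pow_pow (by omega)
    simpa using h1.trans_isLittleO h2
  -- For `δ > 0` currying supplies differentiability in the sup norm, so the derivative may be
  -- computed at each `x` separately.
  · have hS : ContDiffOn ℝ ∞ (expKernel X m j) (Ioi 0) := by
      refine contDiffOn_curry (convex_Ioi 0) isOpen_Ioi.uniqueDiffOn hX
        (f := fun p : ℝ × ℝ => p.1 ^ m * p.2 ^ j * Real.exp (-(p.2 / p.1))) ?_
        fun p hp t => expKernel_of_pos hp t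
      have : ContDiffOn ℝ ∞ (fun p : ℝ × ℝ => p.2 / p.1) (Ioi 0 ×ˢ Icc 0 X) :=
        contDiffOn_snd.div contDiffOn_fst fun p hp => (ne_of_gt hp.1)
      fun_prop
    have hd : DifferentiableAt ℝ (expKernel X m j) δ :=
      (hS.differentiableOn (by simp)).differentiableAt (Ioi_mem_nhds h)
    suffices heq : (m : ℝ) • expKernel X (m - 1) j δ + expKernel X (m - 2) (j + 1) δ
        = deriv (expKernel X m j) δ by
      rw [heq]; exact hd.hasDerivAt
    ext x
    have h1 : HasDerivAt (fun d => expKernel X m j d x) (deriv (expKernel X m j) δ x) δ :=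
      HasFDerivAt.comp_hasDerivAt (l := fun F : C(Icc 0 X, ℝ) => F x) δ
        (ContinuousMap.evalCLM (M := ℝ) ℝ x).hasFDerivAt hd.hasDerivAt
    have h2 : HasDerivAt (fun d : ℝ => d ^ m * (x : ℝ) ^ j * Real.exp (-(x / d)))
        ((m * δ ^ (m - 1)) * (x : ℝ) ^ j * Real.exp (-(x / δ))
          + δ ^ m * (x : ℝ) ^ j * (Real.exp (-(x / δ)) * (x / δ ^ 2))) δ := by
      have h3 : HasDerivAt (fun d : ℝ => -((x : ℝ) / d)) (x / δ ^ 2) δ := by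
        have := ((hasDerivAt_const δ (x : ℝ)).div (hasDerivAt_id δ) h.ne').neg
        refine HasDerivAt.congr_deriv (f := fun d : ℝ => -((x : ℝ) / d)) this ?_
        simp only [id]
        ring
      exact ((hasDerivAt_pow m δ).mul_const _).mul h3.exp
    have h3 : (fun d => expKernel X m j d x) =ᶠ[𝓝 δ]
        fun d : ℝ => d ^ m * (x : ℝ) ^ j * Real.exp (-(x / d)) := by
      filter_upwards [Ioi_mem_nhds h] with d hd' using expKernel_of_pos hd' x
    rw [h1.unique (h2.congr_of_eventuallyEq h3)]
    simp only [ContinuousMap.add_apply, ContinuousMap.smul_apply, expKernel_of_pos h, smul_eq_mul]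
    obtain ⟨l, rfl⟩ := Nat.exists_eq_add_of_le hm
    have : 2 + l - 2 = l := by omega
    rw [this]
    field_simp
    ring

/-- Two powers of `δ` are spent on each derivative, and two more must remain to cross `δ = 0`. -/
theorem contDiff_expKernel (hX : 0 < X) (k : ℕ) {m : ℕ} (hm : 2 * k + 2 ≤ m) (j : ℕ) :
    ContDiff ℝ k (expKernel X m j) := by
  induction k generalizing m j with
  | zero =>
    rw [Nat.cast_zero, contDiff_zero]
    exact continuous_iff_continuousAt.2 fun δ =>
      (hasDerivAt_expKernel hX (by omega) j δ).continuousAt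
  | succ k ih =>
    rw [Nat.cast_add, Nat.cast_one, contDiff_succ_iff_deriv]
    refine ⟨fun δ => (hasDerivAt_expKernel hX (by omega) j δ).differentiableAt, by simp, ?_⟩
    have : deriv (expKernel X m j) = fun δ =>
        (m : ℝ) • expKernel X (m - 1) j δ + expKernel X (m - 2) (j + 1) δ :=
      funext fun δ => (hasDerivAt_expKernel hX (by omega) j δ).deriv
    rw [this]
    exact ((ih (by omega) j).const_smul _).add (ih (by omega) (j + 1))

end Kernel

/-! ### Multiplication by matrices of continuous functions -/

section Multiplication

variable {𝕜 : Type} [RCLike 𝕜] [NormedAlgebra 𝕜 ℂ] {K : Type} [TopologicalSpace K] [CompactSpace K]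

/-- The operator of multiplication by a matrix of continuous functions. -/
def mulOp (𝕜 K : Type) [RCLike 𝕜] [NormedAlgebra 𝕜 ℂ] [TopologicalSpace K] [CompactSpace K]
    (n m : ℕ) : (Fin n → Fin m → C(K, ℂ)) →L[𝕜] C(K, Fin m → ℂ) →L[𝕜] C(K, Fin n → ℂ) :=
  LinearMap.mkContinuous₂
    (LinearMap.mk₂ 𝕜 (fun (A : Fin n → Fin m → C(K, ℂ)) (f : C(K, Fin m → ℂ)) =>
      (⟨fun x i => ∑ j, A i j x * f x j, by fun_prop⟩ : C(K, Fin n → ℂ)))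
      (fun _ _ _ => by ext; simp [add_mul, Finset.sum_add_distrib])
      (fun _ _ _ => by ext; simp [Finset.smul_sum])
      (fun _ _ _ => by ext; simp [mul_add, Finset.sum_add_distrib])
      (fun _ _ _ => by ext; simp [Finset.smul_sum]))
    m
    (fun A f => by
      refine (ContinuousMap.norm_le _ (by positivity)).2 fun x => ?_
      refine (pi_norm_le_iff_of_nonneg (by positivity)).2 fun i => ?_
      calc ‖∑ j, A i j x * f x j‖ ≤ ∑ _j : Fin m, ‖A‖ * ‖f‖ := by
            refine (norm_sum_le _ _).trans (Finset.sum_le_sum fun j _ => ?_)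
            rw [norm_mul]
            gcongr
            · exact ((A i j).norm_coe_le_norm x).trans
                ((norm_le_pi_norm (A i) j).trans (norm_le_pi_norm A i))
            · exact (norm_le_pi_norm (f x) j).trans (f.norm_coe_le_norm x)
        _ = m * ‖A‖ * ‖f‖ := by simp [mul_assoc])

lemma mulOp_apply {n m : ℕ} (A : Fin n → Fin m → C(K, ℂ)) (f : C(K, Fin m → ℂ)) (x : K)
    (i : Fin n) : mulOp 𝕜 K n m A f x i = ∑ j, A i j x * f x j := rfl

lemma norm_mulOp_apply_le {n m : ℕ} (A : Fin n → Fin m → C(K, ℂ)) (f : C(K, Fin m → ℂ)) (x : K) :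
    ‖mulOp 𝕜 K n m A f x‖ ≤ m * ‖A‖ * ‖f x‖ := by
  refine (pi_norm_le_iff_of_nonneg (by positivity)).2 fun i => ?_
  calc ‖∑ j, A i j x * f x j‖ ≤ ∑ _j : Fin m, ‖A‖ * ‖f x‖ := by
        refine (norm_sum_le _ _).trans (Finset.sum_le_sum fun j _ => ?_)
        rw [norm_mul]
        gcongr
        · exact ((A i j).norm_coe_le_norm x).trans
            ((norm_le_pi_norm (A i) j).trans (norm_le_pi_norm A i))
        · exact norm_le_pi_norm (f x) j
    _ = m * ‖A‖ * ‖f x‖ := by simp [mul_assoc]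

end Multiplication

end

end KdVKS

namespace KdVKS

noncomputable section

set_option linter.unusedSectionVars false

open Set Filter Topology

/-! ### Linear differential equations -/

section LinearODE

variable {E : Type} [NormedAddCommGroup E] [NormedSpace ℝ E]

/-- The iterated integrals whose sum solves `y' = a y`, `y(0) = y₀`. -/
def dyson (a : ℝ → E →L[ℝ] E) (y₀ : E) : ℕ → ℝ → E
  | 0 => fun _ => y₀
  | k + 1 => fun x => ∫ s in (0 : ℝ)..x, a s (dyson a y₀ k s)

lemma continuous_dyson {a : ℝ → E →L[ℝ] E} (ha : Continuous a) (y₀ : E) (k : ℕ) :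
    Continuous (dyson a y₀ k) := by
  induction k with
  | zero => exact continuous_const
  | succ k ih =>
    exact intervalIntegral.continuous_primitive
      (fun b c => (ha.clm_apply ih).intervalIntegrable b c) 0

lemma norm_dyson_le {a : ℝ → E →L[ℝ] E} (ha : Continuous a) (y₀ : E) {C T : ℝ}
    (hC : ∀ x, |x| ≤ T → ‖a x‖ ≤ C) (k : ℕ) {x : ℝ} (hx : |x| ≤ T) :
    ‖dyson a y₀ k x‖ ≤ C ^ k / k.factorial * ‖y₀‖ * |x| ^ k := by
  have hC0 : 0 ≤ C := (norm_nonneg _).trans (hC x hx)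
  induction k generalizing x with
  | zero => simp [dyson]
  | succ k ih =>
    have hbd : ∀ s ∈ uIoc 0 x, ‖a s (dyson a y₀ k s)‖
        ≤ C ^ (k + 1) / k.factorial * ‖y₀‖ * |s - 0| ^ k := by
      intro s hs
      have hsT : |s| ≤ T := by
        rcases le_total 0 x with h | h
        · rw [uIoc_of_le h] at hs
          rw [abs_of_pos hs.1]; rw [abs_of_nonneg h] at hx; linarith [hs.2]
        · rw [uIoc_of_ge h] at hs
          rw [abs_of_nonpos hs.2]; rw [abs_of_nonpos h] at hx; linarith [hs.1]
      calc ‖a s (dyson a y₀ k s)‖ ≤ ‖a s‖ * ‖dyson a y₀ k s‖ := (a s).le_opNorm _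
        _ ≤ C * (C ^ k / k.factorial * ‖y₀‖ * |s| ^ k) :=
          mul_le_mul (hC s hsT) (ih hsT) (norm_nonneg _) hC0
        _ = _ := by rw [sub_zero]; ring
    have hibound : MeasureTheory.IntegrableOn
        (fun s => C ^ (k + 1) / k.factorial * ‖y₀‖ * |s - 0| ^ k) (uIoc 0 x) :=
      (Continuous.intervalIntegrable (by fun_prop) 0 x).def'
    have hinorm : MeasureTheory.IntegrableOn (fun s => ‖a s (dyson a y₀ k s)‖) (uIoc 0 x) :=
      ((ha.clm_apply (continuous_dyson ha y₀ k)).norm.intervalIntegrable 0 x).def'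
    refine (intervalIntegral.norm_integral_le_integral_norm_uIoc).trans
      ((MeasureTheory.setIntegral_mono_on hinorm hibound measurableSet_uIoc hbd).trans
        (le_of_eq ?_))
    rw [MeasureTheory.integral_const_mul, integral_pow_abs_sub_uIoc, sub_zero,
      Nat.factorial_succ]
    push_cast
    field_simp

/-- The Dyson series converges and may be differentiated term by term, being dominated on bounded
intervals by an exponential series. -/
theorem exists_linear_solution [CompleteSpace E] {a : ℝ → E →L[ℝ] E} (ha : Continuous a) (y₀ : E) :
    ∃ y : ℝ → E, y 0 = y₀ ∧ ∀ x, HasDerivAt y (a x (y x)) x := by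
  have hbound : ∀ T : ℝ, ∃ C : ℝ, ∀ x, |x| ≤ T → ‖a x‖ ≤ C := fun T => by
    obtain ⟨C, hC⟩ := (isCompact_Icc (a := -T) (b := T)).exists_bound_of_continuousOn
      ha.continuousOn
    exact ⟨C, fun x hx => hC x (abs_le.1 hx)⟩
  have hsummable : ∀ x, Summable fun k => dyson a y₀ k x := fun x => by
    obtain ⟨C, hC⟩ := hbound |x|
    refine Summable.of_norm_bounded
      (((Real.summable_pow_div_factorial (C * |x|)).mul_right ‖y₀‖))
      fun k => (norm_dyson_le ha y₀ hC k le_rfl).trans (le_of_eq ?_)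
    rw [mul_pow]; ring
  refine ⟨fun x => ∑' k, dyson a y₀ k x, ?_, fun x => ?_⟩
  · change ∑' k, dyson a y₀ k 0 = y₀
    rw [tsum_eq_single 0]
    · rfl
    · intro k hk
      obtain ⟨l, rfl⟩ := Nat.exists_eq_succ_of_ne_zero hk
      simp [dyson]
  · obtain ⟨C, hC⟩ := hbound (|x| + 1)
    have hC0 : 0 ≤ C := (norm_nonneg _).trans (hC 0 (by simp; positivity))
    -- Term `k + 1` differentiates to `a` applied to term `k`, so the differentiated series is `a`
    -- applied to the original one, with indices shifted by one.
    set g' : ℕ → ℝ → E := fun k => match k with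
      | 0 => fun _ => 0
      | k + 1 => fun s => a s (dyson a y₀ k s) with hg'
    set u : ℕ → ℝ := fun k => match k with
      | 0 => 0
      | k + 1 => C * ((C * (|x| + 1)) ^ k / k.factorial * ‖y₀‖) with hu
    have hus : Summable u := by
      rw [← summable_nat_add_iff 1]
      exact ((Real.summable_pow_div_factorial (C * (|x| + 1))).mul_right ‖y₀‖).mul_left C
    have hx : x ∈ Ioo (-(|x| + 1)) (|x| + 1) := abs_lt.1 (by linarith)
    have hd := hasDerivAt_tsum_of_isPreconnected (g := dyson a y₀) (g' := g') hus isOpen_Ioo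
      isPreconnected_Ioo (fun k s _ => ?_) (fun k s hs => ?_) hx (hsummable x) hx
    · have hsum : ∑' k, g' k x = a x (∑' k, dyson a y₀ k x) := by
        have h1 : HasSum (fun k => g' (k + 1) x) (a x (∑' k, dyson a y₀ k x)) :=
          (a x).hasSum (hsummable x).hasSum
        have h2 := (hasSum_nat_add_iff (f := fun k => g' k x) 1).1 h1
        simpa [hg'] using h2.tsum_eq
      rw [hsum] at hd
      exact hd
    · cases k with
      | zero => exact hasDerivAt_const s y₀
      | succ k =>
        exact intervalIntegral.integral_hasDerivAt_right
          ((ha.clm_apply (continuous_dyson ha y₀ k)).intervalIntegrable _ _)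
          ((ha.clm_apply (continuous_dyson ha y₀ k)).stronglyMeasurableAtFilter _ _)
          (ha.clm_apply (continuous_dyson ha y₀ k)).continuousAt
    · have hsT : |s| ≤ |x| + 1 := (abs_lt.2 hs).le
      cases k with
      | zero => simp [hg', hu]
      | succ k =>
        calc ‖a s (dyson a y₀ k s)‖ ≤ ‖a s‖ * ‖dyson a y₀ k s‖ := (a s).le_opNorm _
          _ ≤ C * (C ^ k / k.factorial * ‖y₀‖ * |s| ^ k) :=
            mul_le_mul (hC s hsT) (norm_dyson_le ha y₀ hC k hsT) (norm_nonneg _) hC0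
          _ ≤ C * (C ^ k / k.factorial * ‖y₀‖ * (|x| + 1) ^ k) := by gcongr
          _ = _ := by simp only [hu, mul_pow]; ring

/-- Gronwall's inequality on `[0, x]`; negative `x` is reached by reflection, with coefficient
`-a(-s)`. -/
theorem linear_solution_eq_zero {a : ℝ → E →L[ℝ] E} (ha : Continuous a) {y : ℝ → E}
    (hy : ∀ x, HasDerivAt y (a x (y x)) x) (h0 : y 0 = 0) (x : ℝ) : y x = 0 := by
  have key : ∀ (b : ℝ → E →L[ℝ] E), Continuous b → ∀ z : ℝ → E,
      (∀ x, HasDerivAt z (b x (z x)) x) → z 0 = 0 → ∀ x, 0 ≤ x → z x = 0 := by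
    intro b hb z hz hz0 x hx
    obtain ⟨C, hC⟩ := (isCompact_Icc (a := 0) (b := x)).exists_bound_of_continuousOn
      hb.continuousOn
    refine eq_zero_of_abs_deriv_le_mul_abs_self_of_eq_zero_right (f := z)
      (f' := fun s => b s (z s)) (K := C) (fun s _ => (hz s).continuousAt.continuousWithinAt)
      (fun s _ => (hz s).hasDerivWithinAt) hz0 (fun s hs => ?_) x ⟨hx, le_rfl⟩
    exact ((b s).le_opNorm _).trans
      (mul_le_mul_of_nonneg_right (hC s ⟨hs.1, hs.2.le⟩) (norm_nonneg _))
  rcases le_total 0 x with h | h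
  · exact key a ha y hy h0 x h
  · have := key (fun s => -a (-s)) (by fun_prop) (fun s => y (-s)) (fun s => ?_) (by simpa using h0)
      (-x) (by linarith)
    · simpa using this
    · simpa [Function.comp_def] using (hy (-s)).scomp s (hasDerivAt_neg s)

end LinearODE

/-! ### Fundamental matrices: existence, uniqueness, representation of solutions. -/

section PrincipalSolution

variable {n : ℕ}

/-- Multiplication by a complex matrix as a real-linear operator. -/
def matCLM (n : ℕ) : Matrix (Fin n) (Fin n) ℂ →ₗ[ℝ] ((Fin n → ℂ) →L[ℝ] (Fin n → ℂ)) where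
  toFun A := (Matrix.toLin' A).toContinuousLinearMap.restrictScalars ℝ
  map_add' A B := by ext v; simp
  map_smul' c A := by ext v; simp [Matrix.smul_mulVec]

lemma matCLM_apply (A : Matrix (Fin n) (Fin n) ℂ) (v : Fin n → ℂ) :
    matCLM n A v = A.mulVec v := by
  simp [matCLM]

lemma continuous_matCLM_comp {A : ℝ → Matrix (Fin n) (Fin n) ℂ}
    (hA : ∀ i j, Continuous fun x => A x i j) : Continuous fun x => matCLM n (A x) :=
  (LinearMap.continuous_of_finiteDimensional (matCLM n)).comp (continuous_matrix hA)

lemma hasDerivAt_mulVec_iff {R : ℝ → Matrix (Fin n) (Fin n) ℂ} {A : Matrix (Fin n) (Fin n) ℂ}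
    {x : ℝ} (h : ∀ i j, HasDerivAt (fun y => R y i j) ((A * R x) i j) x) (v : Fin n → ℂ) :
    HasDerivAt (fun y => (R y).mulVec v) (A.mulVec ((R x).mulVec v)) x := by
  rw [hasDerivAt_pi]
  intro i
  rw [Matrix.mulVec_mulVec]
  simp only [Matrix.mulVec, dotProduct]
  exact HasDerivAt.fun_sum fun j _ => (h i j).mul_const (v j)

/-- `principalSolution` is a choice and means something only because a solution exists; its columns
are the solutions with unit vectors as data. -/
theorem isPrincipalSolution_principalSolution {A : ℝ → Matrix (Fin n) (Fin n) ℂ}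
    (hA : ∀ i j, Continuous fun x => A x i j) : IsPrincipalSolution A (principalSolution A) := by
  refine Classical.epsilon_spec (p := IsPrincipalSolution A) ?_
  have hex := fun j : Fin n =>
    exists_linear_solution (continuous_matCLM_comp hA) (Pi.single j (1 : ℂ))
  choose y hy0 hy using hex
  refine ⟨fun x => Matrix.of fun i j => y j x i, ?_, fun x i j => ?_⟩
  · ext i j
    simp [hy0, Matrix.one_apply, Pi.single_apply]
  · have := (hasDerivAt_pi.1 (hy j x)) i
    rw [matCLM_apply] at this
    exact this

theorem solution_eq_mulVec {A R : ℝ → Matrix (Fin n) (Fin n) ℂ}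
    (hA : ∀ i j, Continuous fun x => A x i j) (hR : IsPrincipalSolution A R) {v : ℝ → Fin n → ℂ}
    (hv : ∀ x, HasDerivAt v ((A x).mulVec (v x)) x) (x : ℝ) : v x = (R x).mulVec (v 0) := by
  have := linear_solution_eq_zero (continuous_matCLM_comp hA)
    (y := fun x => v x - (R x).mulVec (v 0)) (fun x => ?_) (by simp [hR.1]) x
  · exact sub_eq_zero.1 this
  · rw [matCLM_apply, Matrix.mulVec_sub]
    exact (hv x).sub (hasDerivAt_mulVec_iff (hR.2 x) (v 0))

theorem IsPrincipalSolution.eq {A R Q : ℝ → Matrix (Fin n) (Fin n) ℂ}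
    (hA : ∀ i j, Continuous fun x => A x i j) (hR : IsPrincipalSolution A R)
    (hQ : IsPrincipalSolution A Q) : Q = R := by
  ext x i j
  have h1 := solution_eq_mulVec hA hR
    (fun x => hasDerivAt_mulVec_iff (hQ.2 x) (Pi.single j (1 : ℂ))) x
  have h2 := congrFun h1 i
  rw [hQ.1, Matrix.one_mulVec, Matrix.mulVec_single_one, Matrix.mulVec_single_one] at h2
  exact h2

end PrincipalSolution

/-! ### The integral equation -/

section IntegralEquation

variable {X : ℝ}

/-- The restriction of a continuous function to `[0, X]`. -/
def restr {E : Type} [TopologicalSpace E] (X : ℝ) (f : ℝ → E) (hf : Continuous f) :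
    C(Icc 0 X, E) := ⟨fun x => f x, hf.comp continuous_subtype_val⟩

@[simp] lemma restr_apply {E : Type} [TopologicalSpace E] {f : ℝ → E} (hf : Continuous f)
    (x : Icc 0 X) : restr X f hf x = f x := rfl

lemma conv_one_eq_sub {𝕜 : Type} [RCLike 𝕜] {E : Type} [NormedAddCommGroup E] [NormedSpace ℝ E]
    [NormedSpace 𝕜 E] [SMulCommClass ℝ 𝕜 E] [CompleteSpace E] (hX : 0 ≤ X) {v : ℝ → E}
    (hvc : Continuous v) {w : C(Icc 0 X, E)}
    (hv : ∀ x : Icc 0 X, HasDerivAt v (w x) x) :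
    conv 𝕜 E hX 1 w = restr X v hvc - ContinuousMap.const _ (v 0) := by
  ext x
  rw [conv_one_apply]
  have hw : Continuous (IccExtend hX w) := w.continuous.Icc_extend'
  rw [intervalIntegral.integral_eq_sub_of_hasDerivAt (f := v) (fun s hs => ?_)
    (hw.intervalIntegrable _ _)]
  · simp
  · rw [uIcc_of_le x.2.1] at hs
    have hs' : s ∈ Icc 0 X := ⟨hs.1, hs.2.trans x.2.2⟩
    rw [IccExtend_of_mem _ _ hs']
    exact hv ⟨s, hs'⟩

variable {𝕜 : Type} [RCLike 𝕜] [NormedAlgebra 𝕜 ℂ] [SMulCommClass ℝ 𝕜 ℂ] {n : ℕ}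

lemma contDiff_mulOp {K : Type} [TopologicalSpace K] [CompactSpace K] {n m : ℕ}
    {k : WithTop ℕ∞} : ContDiff 𝕜 k fun A : Fin n → Fin m → C(K, ℂ) => mulOp 𝕜 K n m A :=
  ContinuousLinearMap.contDiff (𝕜 := 𝕜) (E := Fin n → Fin m → C(K, ℂ))
    (F := C(K, Fin m → ℂ) →L[𝕜] C(K, Fin n → ℂ)) (mulOp 𝕜 K n m)

/-- The Volterra operator `f ↦ ∫₀ˣ A f`. -/
def volterraOp (𝕜 : Type) [RCLike 𝕜] [NormedAlgebra 𝕜 ℂ] [SMulCommClass ℝ 𝕜 ℂ] {X : ℝ}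
    (hX : 0 ≤ X) {n : ℕ} (A : Fin n → Fin n → C(Icc 0 X, ℂ)) :
    C(Icc 0 X, Fin n → ℂ) →L[𝕜] C(Icc 0 X, Fin n → ℂ) :=
  (conv 𝕜 (Fin n → ℂ) hX 1).comp (mulOp 𝕜 (Icc 0 X) n n A)

lemma isVolterra_volterraOp (hX : 0 ≤ X) (A : Fin n → Fin n → C(Icc 0 X, ℂ)) :
    ∃ C, 0 ≤ C ∧ IsVolterra hX C (volterraOp 𝕜 hX A) := by
  refine ⟨‖(1 : C(Icc 0 X, 𝕜))‖ * (n * ‖A‖), by positivity, fun f x => ?_⟩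
  refine (norm_conv_apply_le hX _ _ x).trans ?_
  rw [mul_assoc]
  gcongr
  have h1 : Continuous (IccExtend hX (mulOp 𝕜 (Icc 0 X) n n A f)) :=
    (mulOp 𝕜 (Icc 0 X) n n A f).continuous.Icc_extend'
  have h2 : Continuous (IccExtend hX f) := f.continuous.Icc_extend'
  rw [← intervalIntegral.integral_const_mul]
  exact intervalIntegral.integral_mono_on x.2.1 (h1.norm.intervalIntegrable _ _)
    (Continuous.intervalIntegrable (by fun_prop) _ _) fun s _ => norm_mulOp_apply_le A f _

lemma isUnit_one_sub_volterraOp (hX : 0 ≤ X) (A : Fin n → Fin n → C(Icc 0 X, ℂ)) :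
    IsUnit (1 - volterraOp 𝕜 hX A) := by
  obtain ⟨C, hC, h⟩ := isVolterra_volterraOp (𝕜 := 𝕜) hX A
  exact h.isUnit_one_sub hC

theorem eq_inverse_one_sub_apply {F : Type} [NormedAddCommGroup F] [NormedSpace 𝕜 F]
    {T : F →L[𝕜] F} (hT : IsUnit (1 - T)) {f g : F} (h : f = g + T f) :
    f = Ring.inverse (1 - T) g := by
  have h1 : (1 - T) f = g := by
    rw [sub_apply, one_apply_eq_self, sub_eq_iff_eq_add]
    exact h
  rw [← h1, ← mul_apply_eq_comp, Ring.inverse_mul_cancel _ hT, one_apply_eq_self]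

/-- Integrating the equation once gives `v = v(0) + T v` with `T` of Volterra type. Dependence on
parameters then reduces to smoothness of inversion in a Banach algebra; the field `𝕜` is kept
general to get real smoothness and holomorphy from one argument. -/
theorem solution_eq_inverse (hX : 0 ≤ X) {A : ℝ → Matrix (Fin n) (Fin n) ℂ}
    (hA : ∀ i j, Continuous fun x => A x i j) {v : ℝ → Fin n → ℂ} (hc : Continuous v)
    (hv : ∀ x, HasDerivAt v ((A x).mulVec (v x)) x) :
    restr X v hc
      = Ring.inverse (1 - volterraOp 𝕜 hX fun i j => restr X (fun x => A x i j) (hA i j))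
        (ContinuousMap.const _ (v 0)) := by
  have h1 := conv_one_eq_sub (𝕜 := 𝕜) hX hc
    (w := mulOp 𝕜 (Icc 0 X) n n (fun i j => restr X (fun x => A x i j) (hA i j))
      (restr X _ hc)) (fun x => by
        have e : mulOp 𝕜 (Icc 0 X) n n (fun i j => restr X (fun x => A x i j) (hA i j))
            (restr X _ hc) x = (A x).mulVec (v x) := by
          ext i
          rw [mulOp_apply, Matrix.mulVec, dotProduct]
          rfl
        rw [e]
        exact hv x)
  refine eq_inverse_one_sub_apply (isUnit_one_sub_volterraOp (𝕜 := 𝕜) hX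
    fun i j => restr X (fun x => A x i j) (hA i j)) ?_
  rw [volterraOp, ContinuousLinearMap.comp_apply, h1]
  abel

theorem principalSolution_eq_inverse (hX : 0 ≤ X) {A : ℝ → Matrix (Fin n) (Fin n) ℂ}
    (hA : ∀ i j, Continuous fun x => A x i j) (i j : Fin n) :
    principalSolution A X i j
      = Ring.inverse (1 - volterraOp 𝕜 hX fun i j => restr X (fun x => A x i j) (hA i j))
        (ContinuousMap.const _ (Pi.single j 1)) ⟨X, hX, le_rfl⟩ i := by
  set R := principalSolution A
  have hR := isPrincipalSolution_principalSolution hA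
  have hd : ∀ x, HasDerivAt (fun y => (R y).mulVec (Pi.single j 1))
      ((A x).mulVec ((R x).mulVec (Pi.single j 1))) x :=
    fun x => hasDerivAt_mulVec_iff (hR.2 x) _
  have hc : Continuous fun y => (R y).mulVec (Pi.single j 1) :=
    continuous_iff_continuousAt.2 fun x => (hd x).continuousAt
  have h2 := solution_eq_inverse (𝕜 := 𝕜) hX hA hc hd
  rw [show R 0 = 1 from hR.1, Matrix.one_mulVec] at h2
  rw [← h2, restr_apply, Matrix.mulVec_single_one]
  rfl

theorem contDiffOn_inverse_one_sub_apply {P F : Type} [NormedAddCommGroup P] [NormedSpace 𝕜 P]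
    [NormedAddCommGroup F] [NormedSpace 𝕜 F] [CompleteSpace F] {S : Set P} {k : WithTop ℕ∞}
    {T : P → F →L[𝕜] F} {g : P → F} (hT : ContDiffOn 𝕜 k T S)
    (hu : ∀ p ∈ S, IsUnit (1 - T p)) (hg : ContDiffOn 𝕜 k g S) :
    ContDiffOn 𝕜 k (fun p => Ring.inverse (1 - T p) (g p)) S := by
  refine ContDiffOn.clm_apply (fun p hp => ?_) hg
  obtain ⟨u, hu⟩ := hu p hp
  have h1 : ContDiffWithinAt 𝕜 k (fun p => 1 - T p) S p := contDiffWithinAt_const.sub (hT p hp)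
  have h2 : ContDiffAt 𝕜 k Ring.inverse (1 - T p) := by
    rw [← hu]; exact contDiffAt_ringInverse 𝕜 u
  exact h2.comp_contDiffWithinAt p h1

lemma contDiff_volterraOp (hX : 0 ≤ X) {k : WithTop ℕ∞} :
    ContDiff 𝕜 k fun B : Fin n → Fin n → C(Icc 0 X, ℂ) => volterraOp 𝕜 hX B :=
  contDiff_const.clm_comp contDiff_mulOp

/-- Being `C¹` over `ℂ` is holomorphy in the spectral parameter, with values in the space of
continuous functions. -/
theorem contDiff_solution (hX : 0 ≤ X) {A : ℂ → ℝ → Matrix (Fin n) (Fin n) ℂ}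
    (hA : ∀ l i j, Continuous fun x => A l x i j)
    (hd : ∀ i j, ContDiff ℂ 1 fun l => restr X (fun x => A l x i j) (hA l i j))
    {v : ℂ → ℝ → Fin n → ℂ} (hc : ∀ l, Continuous (v l))
    (hv : ∀ l x, HasDerivAt (v l) ((A l x).mulVec (v l x)) x) {y₀ : Fin n → ℂ}
    (h0 : ∀ l, v l 0 = y₀) : ContDiff ℂ 1 fun l => restr X (v l) (hc l) := by
  have heq : (fun l => restr X (v l) (hc l)) = fun l =>
      Ring.inverse (1 - volterraOp ℂ hX fun i j => restr X (fun x => A l x i j) (hA l i j))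
        (ContinuousMap.const _ y₀) :=
    funext fun l => by rw [solution_eq_inverse (𝕜 := ℂ) hX (hA l) (hc l) (hv l), h0]
  rw [heq]
  have hA' : ContDiff ℂ 1 fun l => (fun i j => restr X (fun x => A l x i j) (hA l i j) :
      Fin n → Fin n → C(Icc 0 X, ℂ)) :=
    contDiff_pi.2 fun i => contDiff_pi.2 fun j => hd i j
  have h1 : ContDiff ℂ 1 fun l =>
      volterraOp ℂ hX fun i j => restr X (fun x => A l x i j) (hA l i j) :=
    (contDiff_volterraOp hX).comp hA'
  exact contDiffOn_univ.1 (contDiffOn_inverse_one_sub_apply h1.contDiffOn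
    (fun l _ => isUnit_one_sub_volterraOp (𝕜 := ℂ) hX _)
    (contDiffOn_const (s := univ) (c := ContinuousMap.const (Icc 0 X) y₀)))

theorem differentiable_principalSolution (hX : 0 ≤ X) {A : ℂ → ℝ → Matrix (Fin n) (Fin n) ℂ}
    (hA : ∀ l i j, Continuous fun x => A l x i j)
    (hd : ∀ i j, ContDiff ℂ 1 fun l => restr X (fun x => A l x i j) (hA l i j)) (i j : Fin n) :
    Differentiable ℂ fun l => principalSolution (A l) X i j := by
  have hv : ∀ l x, HasDerivAt (fun y => (principalSolution (A l) y).mulVec (Pi.single j 1))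
      ((A l x).mulVec ((principalSolution (A l) x).mulVec (Pi.single j 1))) x := fun l x =>
    hasDerivAt_mulVec_iff ((isPrincipalSolution_principalSolution (hA l)).2 x) _
  have h2 := contDiff_solution hX hA hd
    (fun l => continuous_iff_continuousAt.2 fun x => (hv l x).continuousAt) hv
    (y₀ := Pi.single j 1) fun l => by
      rw [(isPrincipalSolution_principalSolution (hA l)).1, Matrix.one_mulVec]
  have h3 := (ContinuousMap.evalCLM (M := Fin n → ℂ) ℂ
    (⟨X, hX, le_rfl⟩ : Icc 0 X)).contDiff.comp h2
  have heq : (fun l => principalSolution (A l) X i j)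
      = fun l => (principalSolution (A l) X).mulVec (Pi.single j 1) i :=
    funext fun l => by rw [Matrix.mulVec_single_one]; rfl
  rw [heq]
  exact ((contDiff_pi.1 h3) i).differentiable one_ne_zero

end IntegralEquation

end

end KdVKS

namespace KdVKS

noncomputable section

set_option linter.unusedSectionVars false

open Set Filter Topology Metric

/-! ### Counting zeros of entire functions -/

section ArgumentPrinciple

/-- The local cofactor at `a` and the quotient `f / (z - a)^n` elsewhere glue to an entire function.
-/
lemma exists_eq_pow_mul {f : ℂ → ℂ} (hf : Differentiable ℂ f) {a : ℂ}
    (hne : ∃ z, f z ≠ 0) : ∃ (n : ℕ) (g : ℂ → ℂ), Differentiable ℂ g ∧ g a ≠ 0 ∧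
      ∀ z, f z = (z - a) ^ n * g z := by
  have han : AnalyticOnNhd ℂ f univ := fun z _ => hf.analyticAt z
  have htop : analyticOrderAt f a ≠ ⊤ := by
    intro h
    rw [analyticOrderAt_eq_top] at h
    obtain ⟨z, hz⟩ := hne
    exact hz (han.eqOn_zero_of_preconnected_of_eventuallyEq_zero isPreconnected_univ
      (mem_univ a) h (mem_univ z))
  obtain ⟨g, hg, hga, hfg⟩ := (hf.analyticAt a).analyticOrderAt_ne_top.1 htop
  set n := analyticOrderNatAt f a
  classical
  refine ⟨n, Function.update (fun z => f z / (z - a) ^ n) a (g a), fun z => ?_, by simpa using hga,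
    fun z => ?_⟩
  · by_cases hz : z = a
    · subst hz
      refine (hg.differentiableAt).congr_of_eventuallyEq ?_
      filter_upwards [hfg] with w hw
      by_cases hwz : w = z
      · subst hwz; simp
      · rw [Function.update_of_ne hwz, hw, smul_eq_mul,
          mul_div_cancel_left₀ _ (pow_ne_zero _ (sub_ne_zero.2 hwz))]
    · have h1 : DifferentiableAt ℂ (fun z => f z / (z - a) ^ n) z :=
        (hf z).div (by fun_prop) (pow_ne_zero _ (sub_ne_zero.2 hz))
      refine h1.congr_of_eventuallyEq ?_
      filter_upwards [isOpen_ne.mem_nhds hz] with w hw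
      exact Function.update_of_ne hw _ _
  · by_cases hz : z = a
    · subst hz
      have := hfg.self_of_nhds
      simpa using this
    · rw [Function.update_of_ne hz, mul_div_cancel₀ _ (pow_ne_zero _ (sub_ne_zero.2 hz))]

lemma finite_zeros {f : ℂ → ℂ} (hf : Differentiable ℂ f) (hne : ∃ z, f z ≠ 0) {K : Set ℂ}
    (hK : IsCompact K) : {z ∈ K | f z = 0}.Finite := by
  by_contra hinf
  obtain ⟨x, -, hx⟩ := Set.Infinite.exists_accPt_of_subset_isCompact hinf hK (sep_subset _ _)
  have han : AnalyticOnNhd ℂ f univ := fun z _ => hf.analyticAt z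
  rw [accPt_iff_frequently_nhdsNE] at hx
  obtain ⟨z, hz⟩ := hne
  exact hz (han.eqOn_zero_of_preconnected_of_frequently_eq_zero isPreconnected_univ (mem_univ x)
    (hx.mono fun y hy => hy.2) (mem_univ z))

/-- `s` lists, with multiplicity, the zeros of `f` in the ball of radius `r` about `c`; there are
none on the boundary. -/
def HasZeros (f : ℂ → ℂ) (c : ℂ) (r : ℝ) (s : Multiset ℂ) : Prop :=
  ∃ g : ℂ → ℂ, Differentiable ℂ g ∧ (∀ z ∈ closedBall c r, g z ≠ 0) ∧ (∀ a ∈ s, a ∈ ball c r) ∧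
    ∀ z, f z = (s.map fun a => z - a).prod * g z

/-- Induction on the number of distinct zeros in the closed disc: a zero is split off with its full
multiplicity, so the cofactor has strictly fewer. The condition on the circle excludes the zero
function and keeps all zeros inside. -/
theorem exists_hasZeros {f : ℂ → ℂ} (hf : Differentiable ℂ f) {c : ℂ} {r : ℝ} (hr : 0 ≤ r)
    (hne : ∀ z ∈ sphere c r, f z ≠ 0) : ∃ s, HasZeros f c r s := by
  have hex : ∀ f : ℂ → ℂ, (∀ z ∈ sphere c r, f z ≠ 0) → ∃ z, f z ≠ 0 := fun f h => by
    obtain ⟨z, hz⟩ := (NormedSpace.sphere_nonempty (x := c)).2 hr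
    exact ⟨z, h z hz⟩
  induction hn : {z ∈ closedBall c r | f z = 0}.ncard using Nat.strong_induction_on
    generalizing f with
  | _ n ih =>
    have hfin := finite_zeros hf (hex f hne) (isCompact_closedBall c r)
    rcases ({z ∈ closedBall c r | f z = 0}).eq_empty_or_nonempty with h0 | ⟨a, ha⟩
    · refine ⟨0, f, hf, fun z hz h => ?_, by simp, by simp⟩
      have : z ∈ {z ∈ closedBall c r | f z = 0} := ⟨hz, h⟩
      rw [h0] at this
      exact this
    · obtain ⟨k, g, hg, hga, hfg⟩ := exists_eq_pow_mul hf (a := a) (hex f hne)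
      have hgne : ∀ z ∈ sphere c r, g z ≠ 0 := fun z hz h => hne z hz (by rw [hfg, h, mul_zero])
      have hab : a ∈ ball c r := by
        rcases (mem_closedBall.1 ha.1).lt_or_eq with h | h
        · exact h
        · exact absurd ha.2 (hne a h)
      have hsub : {z ∈ closedBall c r | g z = 0} ⊂ {z ∈ closedBall c r | f z = 0} := by
        refine ⟨fun z hz => ⟨hz.1, by rw [hfg, hz.2, mul_zero]⟩, fun h => hga (h ha).2⟩
      obtain ⟨s, g', hg', hg'ne, hs, hgg'⟩ := ih _ (hn ▸ ncard_lt_ncard hsub hfin) hg hgne rfl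
      refine ⟨Multiset.replicate k a + s, g', hg', hg'ne, fun b hb => ?_, fun z => ?_⟩
      · rcases Multiset.mem_add.1 hb with h | h
        · rw [Multiset.eq_of_mem_replicate h]; exact hab
        · exact hs b h
      · rw [hfg, hgg', Multiset.map_add, Multiset.prod_add, Multiset.map_replicate,
          Multiset.prod_replicate, mul_assoc]

lemma HasZeros.mem_of_eq_zero {f : ℂ → ℂ} {c : ℂ} {r : ℝ} {s : Multiset ℂ} (h : HasZeros f c r s)
    {z : ℂ} (hz : z ∈ closedBall c r) (hfz : f z = 0) : z ∈ s := by
  obtain ⟨g, -, hgne, -, hfg⟩ := h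
  rw [hfg, mul_eq_zero, or_iff_left (hgne z hz), Multiset.prod_eq_zero_iff, Multiset.mem_map] at hfz
  obtain ⟨a, ha, haz⟩ := hfz
  rwa [sub_eq_zero.1 haz]

lemma HasZeros.eq_zero_of_mem {f : ℂ → ℂ} {c : ℂ} {r : ℝ} {s : Multiset ℂ} (h : HasZeros f c r s)
    {z : ℂ} (hz : z ∈ s) : f z = 0 := by
  obtain ⟨g, -, -, -, hfg⟩ := h
  rw [hfg, mul_eq_zero, Multiset.prod_eq_zero_iff, Multiset.mem_map]
  exact Or.inl ⟨z, hz, sub_self z⟩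

lemma HasZeros.mem_ball {f : ℂ → ℂ} {c : ℂ} {r : ℝ} {s : Multiset ℂ} (h : HasZeros f c r s)
    {z : ℂ} (hz : z ∈ s) : z ∈ ball c r := by
  obtain ⟨g, -, -, hs, -⟩ := h
  exact hs z hz

lemma differentiable_multiset_prod_sub (s : Multiset ℂ) :
    Differentiable ℂ fun z => (s.map fun a => z - a).prod := by
  induction s using Multiset.induction with
  | empty => simp
  | cons a s ih =>
    simp only [Multiset.map_cons, Multiset.prod_cons]
    fun_prop

lemma HasZeros.cons_inv {f : ℂ → ℂ} {c : ℂ} {r : ℝ} {a : ℂ} {s : Multiset ℂ}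
    (h : HasZeros f c r (a ::ₘ s)) :
    ∃ f₁, Differentiable ℂ f₁ ∧ HasZeros f₁ c r s ∧ ∀ z, f z = (z - a) * f₁ z := by
  obtain ⟨g, hg, hgne, hs, hfg⟩ := h
  refine ⟨fun z => (s.map fun a => z - a).prod * g z,
    (differentiable_multiset_prod_sub s).mul hg, ⟨g, hg, hgne,
      fun b hb => hs b (Multiset.mem_cons_of_mem hb), fun z => rfl⟩, fun z => ?_⟩
  rw [hfg, Multiset.map_cons, Multiset.prod_cons, mul_assoc]

/-- Weighted argument principle: each factor `z - a` adds the Cauchy integral of `w / (z - a)`. The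
weight `1` counts the zeros, the weight `z` sums them. -/
theorem circleIntegral_logDeriv {f : ℂ → ℂ} {c : ℂ} {r : ℝ} (hr : 0 < r)
    {s : Multiset ℂ} (h : HasZeros f c r s) {w : ℂ → ℂ} (hw : Differentiable ℂ w) :
    (∮ z in C(c, r), w z * (deriv f z / f z)) = 2 * Real.pi * Complex.I * (s.map w).sum := by
  have key : ∀ g : ℂ → ℂ, Differentiable ℂ g → (∀ z ∈ sphere c r, g z ≠ 0) →
      ContinuousOn (fun z => w z * (deriv g z / g z)) (sphere c r) := fun g hg hgne =>
    hw.continuous.continuousOn.mul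
      ((hg.deriv.continuous.continuousOn).div hg.continuous.continuousOn hgne)
  induction s using Multiset.induction generalizing f with
  | empty =>
    obtain ⟨g, hg, hgne, -, hfg⟩ := h
    have : f = g := funext fun z => by simpa using hfg z
    subst this
    rw [Multiset.map_zero, Multiset.sum_zero, mul_zero]
    refine Complex.circleIntegral_eq_zero_of_differentiable_on_off_countable hr.le
      countable_empty ?_ fun z hz => ?_
    · exact hw.continuous.continuousOn.mul
        ((hg.deriv.continuous.continuousOn).div hg.continuous.continuousOn hgne)
    · exact (hw z).mul ((hg.deriv z).div (hg z) (hgne z (ball_subset_closedBall hz.1)))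
  | cons a s ih =>
    have ha : a ∈ ball c r := h.mem_ball (Multiset.mem_cons_self a s)
    obtain ⟨f₁, hf₁, hz₁, hff₁⟩ := h.cons_inv
    have hf₁ne : ∀ z ∈ sphere c r, f₁ z ≠ 0 := fun z hz h0 => by
      have h1 := hz₁.mem_ball (hz₁.mem_of_eq_zero (sphere_subset_closedBall hz) h0)
      exact absurd (mem_sphere.1 hz) (mem_ball.1 h1).ne
    have hane : ∀ z ∈ sphere c r, z - a ≠ 0 := fun z hz h0 => by
      rw [sub_eq_zero.1 h0] at hz
      exact absurd (mem_sphere.1 hz) (mem_ball.1 ha).ne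
    have hsplit : ∀ z ∈ sphere c r, w z * (deriv f z / f z)
        = (z - a)⁻¹ • w z + w z * (deriv f₁ z / f₁ z) := by
      intro z hz
      have hd : deriv f z = f₁ z + (z - a) * deriv f₁ z := by
        have : f = fun z => (z - a) * f₁ z := funext hff₁
        rw [this]
        have h2 := ((hasDerivAt_id z).sub_const a).mul (hf₁ z).hasDerivAt
        rw [HasDerivAt.deriv (f := fun z => (z - a) * f₁ z) h2]
        simp
      rw [hd, hff₁]
      have := hane z hz
      have := hf₁ne z hz
      rw [smul_eq_mul]
      field_simp
    rw [circleIntegral.integral_congr hr.le hsplit, circleIntegral.integral_add]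
    · rw [ih hz₁, (DifferentiableOn.diffContOnCl hw.differentiableOn).circleIntegral_sub_inv_smul ha,
        Multiset.map_cons, Multiset.sum_cons, smul_eq_mul]
      ring
    · refine ContinuousOn.circleIntegrable hr.le (ContinuousOn.smul (ContinuousOn.inv₀
        (by fun_prop) hane) hw.continuous.continuousOn)
    · exact (key f₁ hf₁ hf₁ne).circleIntegrable hr.le

/-- The order of vanishing in terms of a factorization. -/
lemma areTheRoots_of_hasZeros {f : ℂ → ℂ} (hf : Differentiable ℂ f) {M : ℝ} {r : Fin 3 → ℂ}
    (h : HasZeros f 0 M {r 0, r 1, r 2}) : AreTheRoots f M r := by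
  refine ⟨hf, fun j => ?_, fun z hz => ?_⟩
  · have : r j ∈ ({r 0, r 1, r 2} : Multiset ℂ) := by fin_cases j <;> simp
    simpa using (ball_subset_closedBall (h.mem_ball this))
  · obtain ⟨g, hg, hgne, -, hfg⟩ := h
    have hfac : f = (fun z => z - r 0) * ((fun z => z - r 1) * ((fun z => z - r 2) * g)) := by
      funext z
      simp [hfg z, mul_assoc]
    have hord : ∀ a : ℂ, analyticOrderAt (fun z => z - a) z = if a = z then 1 else 0 := by
      intro a
      split_ifs with h
      · subst h
        have : AnalyticAt ℂ (fun z => z - a) a := by fun_prop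
        rw [← Nat.cast_one, this.analyticOrderAt_eq_natCast]
        exact ⟨fun _ => 1, by fun_prop, one_ne_zero, by simp⟩
      · rw [analyticOrderAt_eq_zero]
        exact Or.inr (sub_ne_zero.2 (Ne.symm h))
    have hgo : analyticOrderAt g z = 0 :=
      analyticOrderAt_eq_zero.2 (Or.inr (hgne z (by simpa using hz)))
    have hga : AnalyticAt ℂ g z := hg.analyticAt z
    have hsa : ∀ a : ℂ, AnalyticAt ℂ (fun z => z - a) z := fun a => by fun_prop
    rw [hfac, analyticOrderAt_mul (hsa _) ((hsa _).mul ((hsa _).mul hga)),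
      analyticOrderAt_mul (hsa _) ((hsa _).mul hga), analyticOrderAt_mul (hsa _) hga, hgo,
      hord, hord, hord]
    classical
    have hcard : Set.ncard {j | r j = z} = ∑ j, if r j = z then 1 else 0 := by
      rw [Set.ncard_eq_toFinset_card', Finset.sum_boole]
      simp
    rw [hcard, Fin.sum_univ_three]
    push_cast
    ring

end ArgumentPrinciple

/-! ### Zeros of holomorphic functions depending smoothly on parameters. -/

section Parameters

variable {P : Type} [NormedAddCommGroup P] [NormedSpace ℝ P] {S : Set P} {f : P × ℂ → ℂ}

lemma hasFDerivAt_right (hf : ContDiffOn ℝ ∞ f (S ×ˢ univ)) {p : P} (hp : p ∈ S) (z : ℂ) :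
    HasFDerivAt (fun z => f (p, z))
      ((fderivWithin ℝ f (S ×ˢ univ) (p, z)).comp (ContinuousLinearMap.inr ℝ P ℂ)) z := by
  have h2 : HasFDerivWithinAt f (fderivWithin ℝ f (S ×ˢ univ) (p, z)) (S ×ˢ univ) (p, z) :=
    (hf.differentiableOn (by simp) _ ⟨hp, mem_univ _⟩).hasFDerivWithinAt
  rw [← hasFDerivWithinAt_univ]
  have hmaps : MapsTo (fun z : ℂ => (p, z)) univ (S ×ˢ univ) := fun _ _ => ⟨hp, mem_univ _⟩
  exact h2.comp z (hasFDerivAt_prodMk_right p z).hasFDerivWithinAt hmaps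

/-- The complex derivative is the real Fréchet derivative applied to `1`, hence jointly smooth in
`(p, z)`. -/
lemma contDiffOn_deriv_right (hSu : UniqueDiffOn ℝ S) (hf : ContDiffOn ℝ ∞ f (S ×ˢ univ))
    (hd : ∀ p ∈ S, Differentiable ℂ fun z => f (p, z)) :
    ContDiffOn ℝ ∞ (fun x : P × ℂ => deriv (fun z => f (x.1, z)) x.2) (S ×ˢ univ) := by
  have hu : UniqueDiffOn ℝ (S ×ˢ (univ : Set ℂ)) := hSu.prod uniqueDiffOn_univ
  have h1 : ContDiffOn ℝ ∞ (fun x => fderivWithin ℝ f (S ×ˢ univ) x ((0 : P), (1 : ℂ)))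
      (S ×ˢ univ) := (hf.fderivWithin hu (by simp)).clm_apply contDiffOn_const
  refine h1.congr fun x hx => ?_
  obtain ⟨p, z⟩ := x
  have h4 : HasFDerivAt (𝕜 := ℝ) (fun z => f (p, z)) _ z :=
    ((hd p hx.1) z).hasDerivAt.hasFDerivAt.restrictScalars ℝ
  have h5 := congrArg (fun L : ℂ →L[ℝ] ℂ => L 1) (h4.unique (hasFDerivAt_right hf hx.1 z))
  simpa using h5

lemma contDiffOn_contour (hS : Convex ℝ S) (hSu : UniqueDiffOn ℝ S)
    (hf : ContDiffOn ℝ ∞ f (S ×ˢ univ)) (hd : ∀ p ∈ S, Differentiable ℂ fun z => f (p, z))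
    {c : ℂ} {r : ℝ} (hne : ∀ p ∈ S, ∀ z ∈ sphere c |r|, f (p, z) ≠ 0) {w : ℂ → ℂ}
    (hw : ContDiff ℝ ∞ w) :
    ContDiffOn ℝ ∞ (fun p => ∮ z in C(c, r), w z * (deriv (fun z => f (p, z)) z / f (p, z))) S := by
  have hcm : ContDiff ℝ ∞ (circleMap c r) := contDiff_circleMap c r
  have hcm' : ContDiff ℝ ∞ (deriv (circleMap c r)) := by
    have : deriv (circleMap c r) = fun θ => circleMap 0 r θ * Complex.I := by
      funext θ; exact deriv_circleMap c r θ
    rw [this]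
    exact (contDiff_circleMap 0 r).mul contDiff_const
  have hmap : ContDiffOn ℝ ∞ (fun x : P × ℝ => (x.1, circleMap c r x.2))
      (S ×ˢ Icc 0 (2 * Real.pi)) :=
    contDiffOn_fst.prodMk (hcm.comp_contDiffOn contDiffOn_snd)
  have hmaps : MapsTo (fun x : P × ℝ => (x.1, circleMap c r x.2)) (S ×ˢ Icc 0 (2 * Real.pi))
      (S ×ˢ univ) := fun x hx => ⟨hx.1, mem_univ _⟩
  refine contDiffOn_integral hS hSu Real.two_pi_pos (f := fun x : P × ℝ =>
    deriv (circleMap c r) x.2 • (w (circleMap c r x.2) *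
      (deriv (fun z => f (x.1, z)) (circleMap c r x.2) / f (x.1, circleMap c r x.2)))) ?_
  have hdc : ContDiffOn ℝ ∞ (fun x : P × ℝ => deriv (fun z => f (x.1, z)) (circleMap c r x.2))
      (S ×ˢ Icc 0 (2 * Real.pi)) := (contDiffOn_deriv_right hSu hf hd).comp hmap hmaps
  have hic : ContDiffOn ℝ ∞ (fun x : P × ℝ => (f (x.1, circleMap c r x.2))⁻¹)
      (S ×ˢ Icc 0 (2 * Real.pi)) :=
    (hf.comp hmap hmaps).inv fun x hx => hne _ hx.1 _ (by simp)
  simp only [div_eq_mul_inv]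
  exact (hcm'.comp_contDiffOn contDiffOn_snd).smul
    (((hw.comp hcm).comp_contDiffOn contDiffOn_snd).mul (hdc.mul hic))

/-- The count is a contour integral that is continuous in the parameter and takes integer values,
while `S`, being convex, is connected. -/
theorem card_zeros_eq (hS : Convex ℝ S) (hSu : UniqueDiffOn ℝ S)
    (hf : ContDiffOn ℝ ∞ f (S ×ˢ univ)) (hd : ∀ p ∈ S, Differentiable ℂ fun z => f (p, z))
    {c : ℂ} {r : ℝ} (hr : 0 < r) (hne : ∀ p ∈ S, ∀ z ∈ sphere c r, f (p, z) ≠ 0)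
    {p q : P} (hp : p ∈ S) (hq : q ∈ S) {s t : Multiset ℂ}
    (hs : HasZeros (fun z => f (p, z)) c r s) (ht : HasZeros (fun z => f (q, z)) c r t) :
    Multiset.card s = Multiset.card t := by
  classical
  have hex : ∀ p ∈ S, ∃ s, HasZeros (fun z => f (p, z)) c r s := fun p hp =>
    exists_hasZeros (hd p hp) hr.le (hne p hp)
  have hval : ∀ p ∈ S, ∀ s, HasZeros (fun z => f (p, z)) c r s →
      ((∮ z in C(c, r), 1 * (deriv (fun z => f (p, z)) z / f (p, z)))
        / (2 * Real.pi * Complex.I)).re = (Multiset.card s : ℝ) := by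
    intro p _ s hs
    rw [circleIntegral_logDeriv hr hs (w := fun _ => 1) (by fun_prop),
      mul_div_cancel_left₀ _ Complex.two_pi_I_ne_zero]
    simp
  set N : P → ℕ := fun p => if h : p ∈ S then Multiset.card (hex p h).choose else 0 with hN
  have hNv : ∀ p ∈ S, ∀ s, HasZeros (fun z => f (p, z)) c r s → N p = Multiset.card s := by
    intro p hp s hs
    have h1 := hval p hp s hs
    have h2 := hval p hp _ (hex p hp).choose_spec
    rw [h1] at h2
    simp only [hN, hp, dif_pos]
    exact_mod_cast h2.symm
  have hNc : ContinuousOn N S := by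
    rw [Nat.isClosedEmbedding_coe_real.isInducing.continuousOn_iff]
    have h1 := (contDiffOn_contour hS hSu hf hd (r := r) (c := c) (w := fun _ => 1)
      (by rwa [abs_of_pos hr]) contDiff_const).continuousOn
    have h2 := Complex.continuous_re.comp_continuousOn (h1.div_const (2 * Real.pi * Complex.I))
    refine h2.congr fun p hp => ?_
    obtain ⟨s, hs⟩ := hex p hp
    simp only [Function.comp_apply]
    rw [hval p hp s hs, hNv p hp s hs]
  have := hS.isPreconnected.constant hNc hp hq
  rwa [hNv p hp s hs, hNv q hq t ht] at this

/-- A single zero in the disc is the value of the contour integral with weight `z`, and so is as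
smooth as that integral. This plays the role of an implicit function theorem on parameter sets with
boundary, and gives uniqueness in a fixed disc as well. -/
theorem exists_contDiffOn_zero (hS : Convex ℝ S) (hSu : UniqueDiffOn ℝ S)
    (hf : ContDiffOn ℝ ∞ f (S ×ˢ univ)) (hd : ∀ p ∈ S, Differentiable ℂ fun z => f (p, z))
    {c : ℂ} {r : ℝ} (hr : 0 < r) (hne : ∀ p ∈ S, ∀ z ∈ sphere c r, f (p, z) ≠ 0)
    {p₀ : P} (hp₀ : p₀ ∈ S) {a : ℂ} (ha : HasZeros (fun z => f (p₀, z)) c r {a}) :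
    ∃ ζ : P → ℂ, ContDiffOn ℝ ∞ ζ S ∧ ∀ p ∈ S, ζ p ∈ ball c r ∧ f (p, ζ p) = 0 ∧
      ∀ z ∈ closedBall c r, f (p, z) = 0 → z = ζ p := by
  have hex : ∀ p ∈ S, ∃ b, HasZeros (fun z => f (p, z)) c r {b} := fun p hp => by
    obtain ⟨s, hs⟩ := exists_hasZeros (hd p hp) hr.le (hne p hp)
    have := card_zeros_eq hS hSu hf hd hr hne hp hp₀ hs ha
    rw [Multiset.card_singleton, Multiset.card_eq_one] at this
    obtain ⟨b, rfl⟩ := this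
    exact ⟨b, hs⟩
  refine ⟨fun p => (∮ z in C(c, r), z * (deriv (fun z => f (p, z)) z / f (p, z)))
    / (2 * Real.pi * Complex.I), ?_, fun p hp => ?_⟩
  · exact (contDiffOn_contour hS hSu hf hd (r := r) (c := c) (w := fun z => z)
      (by rwa [abs_of_pos hr]) contDiff_id).div_const _
  · obtain ⟨b, hb⟩ := hex p hp
    have hval : (∮ z in C(c, r), z * (deriv (fun z => f (p, z)) z / f (p, z)))
        / (2 * Real.pi * Complex.I) = b := by
      rw [circleIntegral_logDeriv hr hb (w := fun z => z) (by fun_prop),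
        mul_div_cancel_left₀ _ Complex.two_pi_I_ne_zero]
      simp
    simp only [hval]
    refine ⟨hb.mem_ball (by simp), hb.eq_zero_of_mem (by simp), fun z hz h => ?_⟩
    simpa using hb.mem_of_eq_zero hz h

end Parameters

end

end KdVKS

namespace KdVKS

noncomputable section

set_option linter.unusedSectionVars false

open Set Filter Topology

/-! ### Formal slow manifolds -/

section SlowManifold

/-- The parameters `(δ, lam)`. -/
def paramSet (δ₀ : ℝ) : Set (ℝ × ℂ) := Ico 0 δ₀ ×ˢ univ

lemma convex_paramSet (δ₀ : ℝ) : Convex ℝ (paramSet δ₀) := (convex_Ico 0 δ₀).prod convex_univ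

lemma uniqueDiffOn_paramSet (δ₀ : ℝ) : UniqueDiffOn ℝ (paramSet δ₀) :=
  (uniqueDiffOn_Ico 0 δ₀).prod uniqueDiffOn_univ

/-- Functions of `((δ, lam), x)` that are smooth up to `δ = 0`. -/
def IsSmoothCoeff (δ₀ : ℝ) (a : (ℝ × ℂ) × ℝ → ℂ) : Prop :=
  ContDiffOn ℝ ∞ a (paramSet δ₀ ×ˢ univ)

/-- Functions of `((δ, lam), x)` that are smooth up to `δ = 0` and periodic in `x`. -/
structure IsCoeff (X δ₀ : ℝ) (a : (ℝ × ℂ) × ℝ → ℂ) : Prop where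
  smooth : IsSmoothCoeff δ₀ a
  periodic : ∀ p ∈ paramSet δ₀, Function.Periodic (fun x => a (p, x)) X

/-- The derivative in `x`. -/
def dx (δ₀ : ℝ) (a : (ℝ × ℂ) × ℝ → ℂ) (y : (ℝ × ℂ) × ℝ) : ℂ :=
  fderivWithin ℝ a (paramSet δ₀ ×ˢ univ) y (0, 1)

variable {X δ₀ : ℝ} {a b : (ℝ × ℂ) × ℝ → ℂ} {p : ℝ × ℂ}

lemma IsSmoothCoeff.hasDerivAt (ha : IsSmoothCoeff δ₀ a) (hp : p ∈ paramSet δ₀) (x : ℝ) :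
    HasDerivAt (fun x => a (p, x)) (dx δ₀ a (p, x)) x := by
  have h1 : HasFDerivWithinAt a (fderivWithin ℝ a (paramSet δ₀ ×ˢ univ) (p, x))
      (paramSet δ₀ ×ˢ univ) (p, x) :=
    (ha.differentiableOn (by simp) _ ⟨hp, mem_univ _⟩).hasFDerivWithinAt
  have h2 : HasDerivWithinAt (fun x : ℝ => (p, x)) (0, 1) univ x :=
    ((hasDerivAt_const x p).prodMk (hasDerivAt_id x)).hasDerivWithinAt
  have hmaps : MapsTo (fun x : ℝ => (p, x)) univ (paramSet δ₀ ×ˢ univ) :=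
    fun _ _ => ⟨hp, mem_univ _⟩
  exact hasDerivWithinAt_univ.1 (h1.comp_hasDerivWithinAt x h2 hmaps)

lemma IsSmoothCoeff.continuous (ha : IsSmoothCoeff δ₀ a) (hp : p ∈ paramSet δ₀) :
    Continuous fun x => a (p, x) :=
  continuous_iff_continuousAt.2 fun x => (ha.hasDerivAt hp x).continuousAt

lemma IsSmoothCoeff.dx (ha : IsSmoothCoeff δ₀ a) : IsSmoothCoeff δ₀ (dx δ₀ a) :=
  (ContDiffOn.fderivWithin ha ((uniqueDiffOn_paramSet δ₀).prod uniqueDiffOn_univ)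
    (by simp)).clm_apply contDiffOn_const

lemma IsCoeff.dx (ha : IsCoeff X δ₀ a) : IsCoeff X δ₀ (dx δ₀ a) := by
  refine ⟨ha.smooth.dx, fun p hp x => ?_⟩
  have h1 := ha.smooth.hasDerivAt hp x
  have h2 := (ha.smooth.hasDerivAt hp (x + X)).comp_add_const x X
  have h3 : (fun y => a (p, y + X)) = fun y => a (p, y) := funext fun y => ha.periodic p hp y
  rw [h3] at h2
  exact h2.unique h1

lemma IsCoeff.add (ha : IsCoeff X δ₀ a) (hb : IsCoeff X δ₀ b) :
    IsCoeff X δ₀ fun y => a y + b y :=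
  ⟨ContDiffOn.add ha.smooth hb.smooth, fun p hp => (ha.periodic p hp).add (hb.periodic p hp)⟩

lemma IsCoeff.mul (ha : IsCoeff X δ₀ a) (hb : IsCoeff X δ₀ b) :
    IsCoeff X δ₀ fun y => a y * b y :=
  ⟨ContDiffOn.mul ha.smooth hb.smooth, fun p hp => (ha.periodic p hp).mul (hb.periodic p hp)⟩

lemma IsCoeff.neg (ha : IsCoeff X δ₀ a) : IsCoeff X δ₀ fun y => -a y :=
  ⟨ContDiffOn.neg ha.smooth, fun p hp x => by simpa using ha.periodic p hp x⟩

lemma isCoeff_of_param {f : ℝ × ℂ → ℂ} (hf : ContDiffOn ℝ ∞ f (paramSet δ₀)) :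
    IsCoeff X δ₀ fun y => f y.1 :=
  ⟨hf.comp contDiffOn_fst fun _ hy => hy.1, fun _ _ _ => rfl⟩

lemma isCoeff_zero : IsCoeff X δ₀ fun _ => 0 := isCoeff_of_param contDiffOn_const

lemma contDiff_ofReal_fst : ContDiff ℝ ∞ fun p : ℝ × ℂ => (p.1 : ℂ) :=
  Complex.ofRealCLM.contDiff.comp contDiff_fst

lemma isCoeff_delta_pow (n : ℕ) : IsCoeff X δ₀ fun y => (y.1.1 : ℂ) ^ n :=
  isCoeff_of_param (f := fun p => (p.1 : ℂ) ^ n) (contDiff_ofReal_fst.pow n).contDiffOn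

/-- The reduced vector field along the slow manifold `v''' = h · (v, v', v'')`. -/
def slowDeriv (δ₀ : ℝ) (h : Fin 3 → (ℝ × ℂ) × ℝ → ℂ) (j : Fin 3) (y : (ℝ × ℂ) × ℝ) : ℂ :=
  dx δ₀ (h j) y + ![0, h 0 y, h 1 y] j + h 2 y * h j y

lemma isCoeff_shift {h : Fin 3 → (ℝ × ℂ) × ℝ → ℂ} (hh : ∀ j, IsCoeff X δ₀ (h j)) (j : Fin 3) :
    IsCoeff X δ₀ fun y => ![0, h 0 y, h 1 y] j := by
  fin_cases j
  · exact isCoeff_zero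
  · exact hh 0
  · exact hh 1

lemma isCoeff_slowDeriv {h : Fin 3 → (ℝ × ℂ) × ℝ → ℂ} (hh : ∀ j, IsCoeff X δ₀ (h j)) (j : Fin 3) :
    IsCoeff X δ₀ (slowDeriv δ₀ h j) :=
  ((hh j).dx.add (isCoeff_shift hh j)).add ((hh 2).mul (hh j))

/-- `h` is an approximate slow manifold for the fast equation `δ v'''' = -v''' + g · (v, v', v'')`,
with residual `δ ^ (n + 1) e`. -/
structure IsSlowManifold (X δ₀ : ℝ) (g : Fin 3 → (ℝ × ℂ) × ℝ → ℂ) (n : ℕ)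
    (h e : Fin 3 → (ℝ × ℂ) × ℝ → ℂ) : Prop where
  coeff : ∀ j, IsCoeff X δ₀ (h j)
  residual_coeff : ∀ j, IsCoeff X δ₀ (e j)
  at_zero : ∀ j, ∀ p ∈ paramSet δ₀, p.1 = 0 → ∀ x, h j (p, x) = g j (p, x)
  eq : ∀ j, ∀ p ∈ paramSet δ₀, ∀ x,
    g j (p, x) - p.1 * slowDeriv δ₀ h j (p, x) = h j (p, x) + (p.1 : ℂ) ^ (n + 1) * e j (p, x)

/-- Replacing `h` by `h + δ^(n+1) e` cancels the residual to one more order; the quadratic term `h₂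
h_j` changes by `δ^(n+1) (h₂ e_j + e₂ k_j)`. Only algebra and differentiation in `x` occur, so
smoothness and periodicity persist, and no convergence as `n → ∞` is needed. -/
theorem exists_isSlowManifold {g : Fin 3 → (ℝ × ℂ) × ℝ → ℂ} (hg : ∀ j, IsCoeff X δ₀ (g j)) (n : ℕ) :
    ∃ h e, IsSlowManifold X δ₀ g n h e := by
  induction n with
  | zero =>
    refine ⟨g, fun j y => -slowDeriv δ₀ g j y, hg, fun j => (isCoeff_slowDeriv hg j).neg,
      fun j p _ _ x => rfl, fun j p _ x => by ring⟩
  | succ n ih =>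
    obtain ⟨h, e, hh, he, h0, heq⟩ := ih
    set k : Fin 3 → (ℝ × ℂ) × ℝ → ℂ := fun j y => h j y + (y.1.1 : ℂ) ^ (n + 1) * e j y with hk
    have hkc : ∀ j, IsCoeff X δ₀ (k j) := fun j => (hh j).add ((isCoeff_delta_pow _).mul (he j))
    refine ⟨k, fun j y => -(dx δ₀ (e j) y + ![0, e 0 y, e 1 y] j + h 2 y * e j y + e 2 y * k j y),
      hkc, fun j => ?_, fun j p hp hp0 x => ?_, fun j p hp x => ?_⟩
    · exact ((((he j).dx.add (isCoeff_shift he j)).add ((hh 2).mul (he j))).add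
        ((he 2).mul (hkc j))).neg
    · simp [hk, hp0, h0 j p hp hp0 x]
    · have hd : dx δ₀ (k j) (p, x) = dx δ₀ (h j) (p, x) + (p.1 : ℂ) ^ (n + 1) * dx δ₀ (e j) (p, x) :=
        ((hkc j).smooth.hasDerivAt hp x).unique
          (((hh j).smooth.hasDerivAt hp x).add (((he j).smooth.hasDerivAt hp x).const_mul
            ((p.1 : ℂ) ^ (n + 1))))
      have hs : (![0, k 0 (p, x), k 1 (p, x)] : Fin 3 → ℂ) j
          = (![0, h 0 (p, x), h 1 (p, x)] : Fin 3 → ℂ) j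
            + (p.1 : ℂ) ^ (n + 1) * (![0, e 0 (p, x), e 1 (p, x)] : Fin 3 → ℂ) j := by
        fin_cases j <;> simp [hk]
      have h1 := heq j p hp x
      simp only [slowDeriv] at h1 ⊢
      rw [hd, hs]
      simp only [hk]
      linear_combination h1

end SlowManifold

/-! ### Primitives and families of continuous functions -/

section Primitive

variable {P : Type} [NormedAddCommGroup P] [NormedSpace ℝ P] {E : Type} [NormedAddCommGroup E]
  [NormedSpace ℝ E]

/-- The form `x ∫₀¹ a(p, tx) dt` moves the variable end point into the integrand. -/
theorem contDiffOn_primitive {S : Set P} (hS : Convex ℝ S) (hSu : UniqueDiffOn ℝ S)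
    {a : P × ℝ → E} (ha : ContDiffOn ℝ ∞ a (S ×ˢ univ)) :
    ContDiffOn ℝ ∞ (fun y : P × ℝ => ∫ s in (0 : ℝ)..y.2, a (y.1, s)) (S ×ˢ univ) := by
  have h1 : ContDiffOn ℝ ∞ (fun z : (P × ℝ) × ℝ => a (z.1.1, z.2 * z.1.2))
      ((S ×ˢ univ) ×ˢ Icc 0 1) :=
    ha.comp (f := fun z : (P × ℝ) × ℝ => (z.1.1, z.2 * z.1.2)) (t := S ×ˢ univ)
      (by fun_prop) fun z hz => ⟨hz.1.1, mem_univ _⟩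
  have h2 := contDiffOn_integral (hS.prod convex_univ) (hSu.prod uniqueDiffOn_univ) one_pos h1
  refine (contDiffOn_snd.smul h2).congr fun y _ => ?_
  have := intervalIntegral.smul_integral_comp_mul_right (a := 0) (b := 1)
    (fun s => a (y.1, s)) y.2
  simpa using this.symm

/-- The family of restrictions to `[0, X]` of `x ↦ a (p, x)`, where these are continuous. -/
def cur (X : ℝ) (a : P × ℝ → ℂ) (p : P) : C(Icc 0 X, ℂ) :=
  open Classical in if h : Continuous fun x => a (p, x) then restr X _ h else 0

lemma cur_apply {X : ℝ} {a : P × ℝ → ℂ} {p : P} (h : Continuous fun x => a (p, x)) (x : Icc 0 X) :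
    cur X a p x = a (p, x) := by
  simp [cur, h]

lemma contDiffOn_cur {X : ℝ} (hX : 0 < X) {S : Set P} (hS : Convex ℝ S) (hSu : UniqueDiffOn ℝ S)
    {a : P × ℝ → ℂ} (ha : ContDiffOn ℝ ∞ a (S ×ˢ univ)) : ContDiffOn ℝ ∞ (cur X a) S := by
  refine contDiffOn_curry hS hSu hX (ha.mono (prod_mono le_rfl (subset_univ _))) fun p hp t => ?_
  exact cur_apply (ha.continuousOn.comp_continuous (f := fun x : ℝ => (p, x)) (by fun_prop)
    fun x => ⟨hp, mem_univ _⟩) t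

end Primitive

/-! ### Volterra operators between different spaces -/

section VolterraComp

variable {X : ℝ} {E F G : Type} [NormedAddCommGroup E] [NormedSpace ℝ E] [NormedAddCommGroup F]
  [NormedSpace ℝ F] [NormedAddCommGroup G] [NormedSpace ℝ G]

/-- A causal operator from `C([0, X], E)` to `C([0, X], F)`, with constant `C`. -/
def IsCausal (hX : 0 ≤ X) (C : ℝ) (T : C(Icc 0 X, E) →L[ℝ] C(Icc 0 X, F)) : Prop :=
  ∀ f x, ‖T f x‖ ≤ C * ∫ s in (0 : ℝ)..x, ‖IccExtend hX f s‖

lemma continuous_norm_IccExtend (hX : 0 ≤ X) (f : C(Icc 0 X, E)) :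
    Continuous fun s => ‖IccExtend hX f s‖ := f.continuous.Icc_extend'.norm

lemma IsCausal.comp_right {hX : 0 ≤ X} {C D : ℝ} (hC : 0 ≤ C)
    {T : C(Icc 0 X, F) →L[ℝ] C(Icc 0 X, G)} (hT : IsCausal hX C T)
    {M : C(Icc 0 X, E) →L[ℝ] C(Icc 0 X, F)} (hM : ∀ f x, ‖M f x‖ ≤ D * ‖f x‖) :
    IsCausal hX (C * D) (T.comp M) := fun f x => by
  refine (hT _ x).trans ?_
  rw [mul_assoc]
  gcongr
  rw [← intervalIntegral.integral_const_mul]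
  exact intervalIntegral.integral_mono_on x.2.1
    ((continuous_norm_IccExtend hX (M f)).intervalIntegrable _ _)
    ((continuous_const.mul (continuous_norm_IccExtend hX f)).intervalIntegrable _ _)
    fun s _ => hM f _

lemma IsCausal.comp_left {hX : 0 ≤ X} {C D : ℝ} (hD : 0 ≤ D)
    {T : C(Icc 0 X, E) →L[ℝ] C(Icc 0 X, F)} (hT : IsCausal hX C T)
    {M : C(Icc 0 X, F) →L[ℝ] C(Icc 0 X, G)} (hM : ∀ f x, ‖M f x‖ ≤ D * ‖f x‖) :
    IsCausal hX (D * C) (M.comp T) := fun f x => by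
  refine (hM _ x).trans ?_
  rw [mul_assoc]
  exact mul_le_mul_of_nonneg_left (hT f x) hD

/-- The bound for the inner operator increases with its end point, so on `[0, x]` it may be replaced
by its value at `x`; the outer integration then costs a factor `X`. -/
lemma IsCausal.comp {hX : 0 ≤ X} {C D : ℝ} (hC : 0 ≤ C) (hD : 0 ≤ D)
    {T : C(Icc 0 X, F) →L[ℝ] C(Icc 0 X, G)} (hT : IsCausal hX C T)
    {M : C(Icc 0 X, E) →L[ℝ] C(Icc 0 X, F)} (hM : IsCausal hX D M) :
    IsCausal hX (C * (D * X)) (T.comp M) := fun f x => by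
  refine (hT _ x).trans ?_
  rw [mul_assoc]
  gcongr
  have hi := fun u v => (continuous_norm_IccExtend hX f).intervalIntegrable
    (μ := MeasureTheory.volume) u v
  have hnn : 0 ≤ ∫ s in (0 : ℝ)..x, ‖IccExtend hX f s‖ :=
    intervalIntegral.integral_nonneg x.2.1 fun _ _ => norm_nonneg _
  calc ∫ s in (0 : ℝ)..x, ‖IccExtend hX (M f) s‖
      ≤ ∫ _s in (0 : ℝ)..x, D * ∫ s in (0 : ℝ)..x, ‖IccExtend hX f s‖ := by
        refine intervalIntegral.integral_mono_on x.2.1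
          ((continuous_norm_IccExtend hX (M f)).intervalIntegrable _ _)
          (by simp) fun s hs => ?_
        have hs' : s ∈ Icc 0 X := ⟨hs.1, hs.2.trans x.2.2⟩
        rw [IccExtend_of_mem _ _ hs']
        refine (hM f ⟨s, hs'⟩).trans (mul_le_mul_of_nonneg_left ?_ hD)
        exact intervalIntegral.integral_mono_interval le_rfl hs.1 hs.2
          (Eventually.of_forall fun _ => norm_nonneg _) (hi _ _)
    _ = x * (D * ∫ s in (0 : ℝ)..x, ‖IccExtend hX f s‖) := by
        rw [intervalIntegral.integral_const, sub_zero, smul_eq_mul]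
    _ ≤ X * (D * ∫ s in (0 : ℝ)..x, ‖IccExtend hX f s‖) := by
        gcongr
        exact x.2.2
    _ = D * X * ∫ s in (0 : ℝ)..x, ‖IccExtend hX f s‖ := by ring

lemma isCausal_conv (hX : 0 ≤ X) (k : C(Icc 0 X, ℝ)) : IsCausal hX ‖k‖ (conv ℝ E hX k) :=
  fun f x => norm_conv_apply_le hX k f x

lemma IsCausal.add {hX : 0 ≤ X} {C D : ℝ} {T M : C(Icc 0 X, E) →L[ℝ] C(Icc 0 X, F)}
    (hT : IsCausal hX C T) (hM : IsCausal hX D M) : IsCausal hX (C + D) (T + M) := fun f x => by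
  rw [add_apply, ContinuousMap.add_apply, add_mul]
  exact (norm_add_le _ _).trans (add_le_add (hT f x) (hM f x))

/-- Variation of constants with the integrating factor `e^{x/δ}`. The kernel enters only through its
values, which lets `expKernel X 0 0 δ` take its place. -/
lemma duhamel [CompleteSpace E] {δ : ℝ} (hX : 0 ≤ X) {z : ℝ → E} (hz : Continuous z)
    {f : C(Icc 0 X, E)} (hd : ∀ x : Icc 0 X, HasDerivAt z (-(δ⁻¹ • z x) + f x) x)
    (k : C(Icc 0 X, ℝ)) (hk : ∀ x : Icc 0 X, k x = Real.exp (-(x / δ))) :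
    restr X z hz = (⟨fun x => k x • z 0, by fun_prop⟩ : C(Icc 0 X, E)) + conv ℝ E hX k f := by
  ext x
  rw [ContinuousMap.add_apply, conv_apply]
  have hw : Continuous (IccExtend hX f) := f.continuous.Icc_extend'
  have h1 : ∫ s in (0 : ℝ)..x, Real.exp (s / δ) • IccExtend hX f s
      = Real.exp (x / δ) • z x - Real.exp (0 / δ) • z 0 := by
    refine intervalIntegral.integral_eq_sub_of_hasDerivAt
      (f := fun s => Real.exp (s / δ) • z s) (fun s hs => ?_)
      (Continuous.intervalIntegrable (by fun_prop) _ _)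
    rw [uIcc_of_le x.2.1] at hs
    have hs' : s ∈ Icc 0 X := ⟨hs.1, hs.2.trans x.2.2⟩
    rw [IccExtend_of_mem _ _ hs']
    have h2 : HasDerivAt (fun s : ℝ => Real.exp (s / δ)) (Real.exp (s / δ) * δ⁻¹) s := by
      have := ((hasDerivAt_id s).div_const δ).exp
      simpa using this
    have h3 := h2.smul (hd ⟨s, hs'⟩)
    refine HasDerivAt.congr_deriv (f := fun s => Real.exp (s / δ) • z s) h3 ?_
    simp only [smul_add, smul_neg, smul_smul]
    abel
  have h4 : ∫ s in (0 : ℝ)..x, IccExtend hX k (x - s) • IccExtend hX f s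
      = Real.exp (-(x / δ)) • ∫ s in (0 : ℝ)..x, Real.exp (s / δ) • IccExtend hX f s := by
    rw [← intervalIntegral.integral_smul]
    refine intervalIntegral.integral_congr fun s hs => ?_
    rw [uIcc_of_le x.2.1] at hs
    have hs' : (x : ℝ) - s ∈ Icc 0 X := ⟨by linarith [hs.2], by linarith [hs.1, x.2.2]⟩
    rw [IccExtend_of_mem _ _ hs', hk, smul_smul, ← Real.exp_add]
    congr 2
    simp only
    ring
  rw [h4, h1, restr_apply]
  simp only [ContinuousMap.coe_mk, hk, zero_div, Real.exp_zero, one_smul, smul_sub, smul_smul,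
    ← Real.exp_add]
  simp

end VolterraComp

end

end KdVKS

namespace KdVKS

noncomputable section

set_option linter.unusedSectionVars false

open Set Filter Topology

/-! ### The monodromy matrix in slow-fast coordinates -/

section Monodromy

variable {X δ₀ : ℝ}

/-- The integrating factor `exp (-∫₀ˣ h₂)` of the fast equation. -/
def fastFactor (h₂ : (ℝ × ℂ) × ℝ → ℂ) (y : (ℝ × ℂ) × ℝ) : ℂ :=
  Complex.exp (-∫ s in (0 : ℝ)..y.2, h₂ (y.1, s))

/-- The inverse of the integrating factor. -/
def fastFactorInv (h₂ : (ℝ × ℂ) × ℝ → ℂ) (y : (ℝ × ℂ) × ℝ) : ℂ :=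
  Complex.exp (∫ s in (0 : ℝ)..y.2, h₂ (y.1, s))

lemma fastFactor_mul_inv (h₂ : (ℝ × ℂ) × ℝ → ℂ) (y : (ℝ × ℂ) × ℝ) :
    fastFactor h₂ y * fastFactorInv h₂ y = 1 := by
  rw [fastFactor, fastFactorInv, ← Complex.exp_add]; simp

lemma fastFactorInv_zero (h₂ : (ℝ × ℂ) × ℝ → ℂ) (p : ℝ × ℂ) : fastFactorInv h₂ (p, 0) = 1 := by
  simp [fastFactorInv]

variable {h₂ : (ℝ × ℂ) × ℝ → ℂ}

lemma isSmoothCoeff_fastFactor (h : IsSmoothCoeff δ₀ h₂) : IsSmoothCoeff δ₀ (fastFactor h₂) :=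
  (contDiffOn_primitive (convex_paramSet δ₀) (uniqueDiffOn_paramSet δ₀) h).neg.cexp

lemma isSmoothCoeff_fastFactorInv (h : IsSmoothCoeff δ₀ h₂) :
    IsSmoothCoeff δ₀ (fastFactorInv h₂) :=
  (contDiffOn_primitive (convex_paramSet δ₀) (uniqueDiffOn_paramSet δ₀) h).cexp

lemma hasDerivAt_fastFactorInv (h : IsSmoothCoeff δ₀ h₂) {p : ℝ × ℂ} (hp : p ∈ paramSet δ₀)
    (x : ℝ) : HasDerivAt (fun x => fastFactorInv h₂ (p, x))
      (fastFactorInv h₂ (p, x) * h₂ (p, x)) x := by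
  have hc := h.continuous hp
  exact (intervalIntegral.integral_hasDerivAt_right (hc.intervalIntegrable _ _)
    (hc.stronglyMeasurableAtFilter _ _) hc.continuousAt).cexp

variable (hX : 0 < X) (m : ℕ) (h e : Fin 3 → (ℝ × ℂ) × ℝ → ℂ)

/-- Coefficients of the reduced equation on the slow manifold. -/
def slowMat (X : ℝ) (h : Fin 3 → (ℝ × ℂ) × ℝ → ℂ) (p : ℝ × ℂ) : Fin 3 → Fin 3 → C(Icc 0 X, ℂ) :=
  ![![0, 1, 0], ![0, 0, 1], fun j => cur X (h j) p]

/-- Coupling of the fast variable into the slow equations. -/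
def fastCol (X : ℝ) (h : Fin 3 → (ℝ × ℂ) × ℝ → ℂ) (p : ℝ × ℂ) : Fin 3 → Fin 1 → C(Icc 0 X, ℂ) :=
  ![fun _ => 0, fun _ => 0, fun _ => cur X (fastFactor (h 2)) p]

/-- Coupling of the slow variables into the fast equation. -/
def fastRow (X : ℝ) (h e : Fin 3 → (ℝ × ℂ) × ℝ → ℂ) (p : ℝ × ℂ) :
    Fin 1 → Fin 3 → C(Icc 0 X, ℂ) :=
  fun _ j => cur X (fun y => fastFactorInv (h 2) y * e j y) p

/-- The response of the fast variable to the slow ones. -/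
def layerOp (p : ℝ × ℂ) : C(Icc 0 X, Fin 3 → ℂ) →L[ℝ] C(Icc 0 X, Fin 1 → ℂ) :=
  (conv ℝ (Fin 1 → ℂ) hX.le (expKernel X m 0 p.1)).comp (mulOp ℝ (Icc 0 X) 1 3 (fastRow X h e p))

/-- The Volterra operator of the slow equations. -/
def slowOp (p : ℝ × ℂ) : C(Icc 0 X, Fin 3 → ℂ) →L[ℝ] C(Icc 0 X, Fin 3 → ℂ) :=
  volterraOp ℝ hX.le (slowMat X h p) +
    (conv ℝ (Fin 3 → ℂ) hX.le 1).comp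
      ((mulOp ℝ (Icc 0 X) 3 1 (p.1 ^ m • fastCol X h p)).comp (layerOp hX m h e p))

/-- The diagonal embedding of real functions. -/
def realToVec (X : ℝ) : C(Icc 0 X, ℝ) →L[ℝ] C(Icc 0 X, Fin 1 → ℂ) :=
  ContinuousLinearMap.compLeftContinuous ℝ (Icc 0 X)
    (ContinuousLinearMap.pi fun _ => Complex.ofRealCLM)

lemma realToVec_apply (f : C(Icc 0 X, ℝ)) (x : Icc 0 X) (i : Fin 1) :
    realToVec X f x i = (f x : ℂ) := rfl

/-- The inhomogeneity of the slow equations. -/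
def slowRhs (y₀ : Fin 3 → ℂ) (z₀ : ℝ) (p : ℝ × ℂ) : C(Icc 0 X, Fin 3 → ℂ) :=
  ContinuousMap.const _ y₀ + z₀ • conv ℝ (Fin 3 → ℂ) hX.le 1
    (mulOp ℝ (Icc 0 X) 3 1 (fastCol X h p) (realToVec X (expKernel X m 0 p.1)))

/-- The solution of the slow equations with data `(y₀, z₀)`. -/
def slowSol (y₀ : Fin 3 → ℂ) (z₀ : ℝ) (p : ℝ × ℂ) : C(Icc 0 X, Fin 3 → ℂ) :=
  Ring.inverse (1 - slowOp hX m h e p) (slowRhs hX m h y₀ z₀ p)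

/-- The right end point of the interval. -/
def lastPt (hX : 0 < X) : Icc 0 X := ⟨X, hX.le, le_rfl⟩

/-- The terminal value of the fast variable. -/
def fastEnd (y₀ : Fin 3 → ℂ) (z₀ : ℝ) (p : ℝ × ℂ) : ℂ :=
  cur X (fastFactor (h 2)) p (lastPt hX) * ((z₀ * expNegInvGlue (p.1 / X) : ℝ) +
    layerOp hX m h e p (slowSol hX m h e y₀ z₀ p) (lastPt hX) 0)

/-- The monodromy matrix in slow-fast coordinates. -/
def monodromy (p : ℝ × ℂ) : Matrix (Fin 4) (Fin 4) ℂ :=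
  Matrix.of fun i j => Fin.lastCases
    (fastEnd hX m h e (fun k => if k.castSucc = j then 1 else 0) (if j = Fin.last 3 then 1 else 0) p)
    (fun i => slowSol hX m h e (fun k => if k.castSucc = j then 1 else 0)
      (if j = Fin.last 3 then 1 else 0) p (lastPt hX) i) i

lemma monodromy_last (p : ℝ × ℂ) (j : Fin 4) :
    monodromy hX m h e p (Fin.last 3) j = fastEnd hX m h e
      (fun k => if k.castSucc = j then 1 else 0) (if j = Fin.last 3 then 1 else 0) p := by
  rw [monodromy, Matrix.of_apply, Fin.lastCases_last]

lemma monodromy_castSucc (p : ℝ × ℂ) (i : Fin 3) (j : Fin 4) :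
    monodromy hX m h e p i.castSucc j = slowSol hX m h e
      (fun k => if k.castSucc = j then 1 else 0) (if j = Fin.last 3 then 1 else 0) p
        (lastPt hX) i := by
  rw [monodromy, Matrix.of_apply, Fin.lastCases_castSucc]

/-- The feedback through the boundary layer is causal too, so the whole operator is of Volterra type
and invertibility holds for every `p`, without smallness of `δ`. -/
lemma isUnit_one_sub_slowOp (p : ℝ × ℂ) : IsUnit (1 - slowOp hX m h e p) := by
  obtain ⟨C, hC, h1⟩ := isVolterra_volterraOp (𝕜 := ℝ) hX.le (slowMat X h p)
  have h2 : IsCausal hX.le C (volterraOp ℝ hX.le (slowMat X h p)) := h1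
  have h3 := (isCausal_conv (E := Fin 1 → ℂ) hX.le (expKernel X m 0 p.1)).comp_right
    (norm_nonneg _) (norm_mulOp_apply_le (𝕜 := ℝ) (fastRow X h e p))
  have h4 := h3.comp_left (by positivity)
    (norm_mulOp_apply_le (𝕜 := ℝ) (p.1 ^ m • fastCol X h p))
  have h5 := (isCausal_conv (E := Fin 3 → ℂ) hX.le 1).comp (norm_nonneg _) (by positivity) h4
  have h6 := h2.add h5
  have h7 : IsVolterra (𝕜 := ℝ) hX.le _ (slowOp hX m h e p) := h6
  exact h7.isUnit_one_sub (by positivity)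

variable {h e} {m}

lemma contDiffOn_slowMat (hX : 0 < X) (hh : ∀ j, IsSmoothCoeff δ₀ (h j)) :
    ContDiffOn ℝ ∞ (slowMat X h) (paramSet δ₀) := by
  refine contDiffOn_pi.2 fun i => contDiffOn_pi.2 fun j => ?_
  have hc := contDiffOn_cur hX (convex_paramSet δ₀) (uniqueDiffOn_paramSet δ₀) (hh j)
  fin_cases i
  · exact contDiffOn_const
  · exact contDiffOn_const
  · exact hc

lemma contDiffOn_fastCol (hX : 0 < X) (hh : ∀ j, IsSmoothCoeff δ₀ (h j)) :
    ContDiffOn ℝ ∞ (fastCol X h) (paramSet δ₀) := by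
  refine contDiffOn_pi.2 fun i => contDiffOn_pi.2 fun j => ?_
  have hc := contDiffOn_cur hX (convex_paramSet δ₀) (uniqueDiffOn_paramSet δ₀)
    (isSmoothCoeff_fastFactor (hh 2))
  fin_cases i
  · exact contDiffOn_const
  · exact contDiffOn_const
  · exact hc

lemma contDiffOn_fastRow (hX : 0 < X) (hh : ∀ j, IsSmoothCoeff δ₀ (h j))
    (he : ∀ j, IsSmoothCoeff δ₀ (e j)) :
    ContDiffOn ℝ ∞ (fastRow X h e) (paramSet δ₀) := by
  refine contDiffOn_pi.2 fun i => contDiffOn_pi.2 fun j => ?_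
  exact contDiffOn_cur hX (convex_paramSet δ₀) (uniqueDiffOn_paramSet δ₀)
    (ContDiffOn.mul (isSmoothCoeff_fastFactorInv (hh 2)) (he j))

lemma contDiff_conv (E : Type) [NormedAddCommGroup E] [NormedSpace ℝ E] (hX : 0 ≤ X)
    {k : WithTop ℕ∞} : ContDiff ℝ k fun f : C(Icc 0 X, ℝ) => conv ℝ E hX f :=
  ContinuousLinearMap.contDiff (𝕜 := ℝ) (E := C(Icc 0 X, ℝ))
    (F := C(Icc 0 X, E) →L[ℝ] C(Icc 0 X, E)) (conv ℝ E hX)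

variable {k : ℕ}

lemma contDiffOn_expKernel_fst (hX : 0 < X) (hm : 2 * k + 2 ≤ m) (S : Set (ℝ × ℂ)) :
    ContDiffOn ℝ k (fun p : ℝ × ℂ => expKernel X m 0 p.1) S :=
  ((contDiff_expKernel hX k hm 0).comp contDiff_fst).contDiffOn

lemma contDiffOn_layerOp (hm : 2 * k + 2 ≤ m) (hh : ∀ j, IsSmoothCoeff δ₀ (h j))
    (he : ∀ j, IsSmoothCoeff δ₀ (e j)) :
    ContDiffOn ℝ k (layerOp hX m h e) (paramSet δ₀) := by
  have h1 : ContDiffOn ℝ k (fun p : ℝ × ℂ => conv ℝ (Fin 1 → ℂ) hX.le (expKernel X m 0 p.1))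
      (paramSet δ₀) := (contDiff_conv _ hX.le).comp_contDiffOn (contDiffOn_expKernel_fst hX hm _)
  have h2 : ContDiffOn ℝ k (fun p => mulOp ℝ (Icc 0 X) 1 3 (fastRow X h e p)) (paramSet δ₀) :=
    contDiff_mulOp.comp_contDiffOn ((contDiffOn_fastRow hX hh he).of_le (by exact_mod_cast le_top))
  exact h1.clm_comp h2

lemma contDiffOn_slowOp (hm : 2 * k + 2 ≤ m) (hh : ∀ j, IsSmoothCoeff δ₀ (h j))
    (he : ∀ j, IsSmoothCoeff δ₀ (e j)) : ContDiffOn ℝ k (slowOp hX m h e) (paramSet δ₀) := by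
  have h1 : ContDiffOn ℝ k (fun p => volterraOp ℝ hX.le (slowMat X h p)) (paramSet δ₀) :=
    (contDiff_volterraOp hX.le).comp_contDiffOn
      ((contDiffOn_slowMat hX hh).of_le (by exact_mod_cast le_top))
  have h2 : ContDiffOn ℝ k (fun p : ℝ × ℂ => mulOp ℝ (Icc 0 X) 3 1 (p.1 ^ m • fastCol X h p))
      (paramSet δ₀) :=
    contDiff_mulOp.comp_contDiffOn (((contDiff_fst.pow m).contDiffOn).smul
      ((contDiffOn_fastCol hX hh).of_le (by exact_mod_cast le_top)))
  exact h1.add (contDiffOn_const.clm_comp (h2.clm_comp (contDiffOn_layerOp hX hm hh he)))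

lemma contDiffOn_slowRhs (hm : 2 * k + 2 ≤ m) (hh : ∀ j, IsSmoothCoeff δ₀ (h j))
    (y₀ : Fin 3 → ℂ) (z₀ : ℝ) : ContDiffOn ℝ k (slowRhs hX m h y₀ z₀) (paramSet δ₀) := by
  have h2 : ContDiffOn ℝ k (fun p : ℝ × ℂ => mulOp ℝ (Icc 0 X) 3 1 (fastCol X h p))
      (paramSet δ₀) :=
    contDiff_mulOp.comp_contDiffOn ((contDiffOn_fastCol hX hh).of_le (by exact_mod_cast le_top))
  have h3 : ContDiffOn ℝ k (fun p : ℝ × ℂ => realToVec X (expKernel X m 0 p.1)) (paramSet δ₀) :=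
    (realToVec X).contDiff.comp_contDiffOn (contDiffOn_expKernel_fst hX hm _)
  have h4 := (conv ℝ (Fin 3 → ℂ) hX.le 1).contDiff.comp_contDiffOn (h2.clm_apply h3)
  exact contDiffOn_const.add (h4.const_smul z₀)

lemma contDiffOn_slowSol (hm : 2 * k + 2 ≤ m) (hh : ∀ j, IsSmoothCoeff δ₀ (h j))
    (he : ∀ j, IsSmoothCoeff δ₀ (e j)) (y₀ : Fin 3 → ℂ) (z₀ : ℝ) :
    ContDiffOn ℝ k (slowSol hX m h e y₀ z₀) (paramSet δ₀) :=
  contDiffOn_inverse_one_sub_apply (contDiffOn_slowOp hX hm hh he)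
    (fun p _ => isUnit_one_sub_slowOp hX m h e p) (contDiffOn_slowRhs hX hm hh y₀ z₀)

lemma contDiff_eval {n : ℕ} (x : Icc 0 X) (i : Fin n) {k : WithTop ℕ∞} :
    ContDiff ℝ k fun f : C(Icc 0 X, Fin n → ℂ) => f x i :=
  contDiff_pi.1 (ContinuousMap.evalCLM (M := Fin n → ℂ) ℝ x).contDiff i

lemma contDiffOn_fastEnd (hm : 2 * k + 2 ≤ m) (hh : ∀ j, IsSmoothCoeff δ₀ (h j))
    (he : ∀ j, IsSmoothCoeff δ₀ (e j)) (y₀ : Fin 3 → ℂ) (z₀ : ℝ) :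
    ContDiffOn ℝ k (fastEnd hX m h e y₀ z₀) (paramSet δ₀) := by
  have h1 : ContDiffOn ℝ k (fun p => cur X (fastFactor (h 2)) p (lastPt hX)) (paramSet δ₀) :=
    (ContinuousMap.evalCLM (M := ℂ) ℝ (lastPt hX)).contDiff.comp_contDiffOn
      ((contDiffOn_cur hX (convex_paramSet δ₀) (uniqueDiffOn_paramSet δ₀)
        (isSmoothCoeff_fastFactor (hh 2))).of_le (by exact_mod_cast le_top))
  -- The exponential `e^{-X/δ}` carries no factor `δ^m`, but `X` is fixed and positive, so it is
  -- flat at `δ = 0`.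
  have h2 : ContDiffOn ℝ k (fun p : ℝ × ℂ => ((z₀ * expNegInvGlue (p.1 / X) : ℝ) : ℂ))
      (paramSet δ₀) := by
    have : ContDiff ℝ k fun p : ℝ × ℂ => z₀ * expNegInvGlue (p.1 / X) :=
      contDiff_const.mul (expNegInvGlue.contDiff.comp (contDiff_fst.div_const X))
    exact (Complex.ofRealCLM.contDiff.comp this).contDiffOn
  have h3 := (contDiff_eval (lastPt hX) (0 : Fin 1)).comp_contDiffOn
    ((contDiffOn_layerOp hX hm hh he).clm_apply (contDiffOn_slowSol hX hm hh he y₀ z₀))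
  exact h1.mul (h2.add h3)

theorem contDiffOn_monodromy (hm : 2 * k + 2 ≤ m) (hh : ∀ j, IsSmoothCoeff δ₀ (h j))
    (he : ∀ j, IsSmoothCoeff δ₀ (e j)) (i j : Fin 4) :
    ContDiffOn ℝ k (fun p => monodromy hX m h e p i j) (paramSet δ₀) := by
  induction i using Fin.lastCases with
  | last => simpa only [monodromy_last] using contDiffOn_fastEnd hX hm hh he _ _
  | cast i =>
    simp only [monodromy_castSucc]
    exact (contDiff_eval (lastPt hX) i).comp_contDiffOn (contDiffOn_slowSol hX hm hh he _ _)

end Monodromy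

end

end KdVKS

namespace KdVKS

noncomputable section

set_option linter.unusedSectionVars false

open Set Filter Topology

/-! ### From solutions of the fast-slow system to the Volterra equations. -/

section Reduction

variable {X δ₀ : ℝ} (hX : 0 < X) {m : ℕ} {g h e : Fin 3 → (ℝ × ℂ) × ℝ → ℂ}

/-- The fast coordinate `δ^{-m} q⁻¹ (v''' - h · (v, v', v''))`. -/
def fastVar (m : ℕ) (h : Fin 3 → (ℝ × ℂ) × ℝ → ℂ) (p : ℝ × ℂ) (V : ℝ → Fin 4 → ℂ) (x : ℝ) : ℂ :=
  fastFactorInv (h 2) (p, x) * ((p.1 : ℂ) ^ m)⁻¹ *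
    (V x 3 - (h 0 (p, x) * V x 0 + h 1 (p, x) * V x 1 + h 2 (p, x) * V x 2))

/-- `V` solves `v' = v₁, v₁' = v₂, v₂' = v₃, δ v₃' = -v₃ + g · (v, v₁, v₂)`. -/
structure IsFastSlowSolution (g : Fin 3 → (ℝ × ℂ) × ℝ → ℂ) (p : ℝ × ℂ) (V : ℝ → Fin 4 → ℂ) :
    Prop where
  d0 : ∀ x, HasDerivAt (fun x => V x 0) (V x 1) x
  d1 : ∀ x, HasDerivAt (fun x => V x 1) (V x 2) x
  d2 : ∀ x, HasDerivAt (fun x => V x 2) (V x 3) x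
  d3 : ∀ x, HasDerivAt (fun x => V x 3)
    ((p.1 : ℂ)⁻¹ * (-V x 3 + (g 0 (p, x) * V x 0 + g 1 (p, x) * V x 1 + g 2 (p, x) * V x 2))) x

variable {p : ℝ × ℂ} {V : ℝ → Fin 4 → ℂ}

lemma fast_eq (hp0 : 0 < p.1) (x : ℝ) : V x 3 = h 0 (p, x) * V x 0 + h 1 (p, x) * V x 1
    + h 2 (p, x) * V x 2 + (p.1 : ℂ) ^ m * (fastFactor (h 2) (p, x) * fastVar m h p V x) := by
  have h1 := fastFactor_mul_inv (h 2) (p, x)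
  have h2 : (p.1 : ℂ) ^ m * ((p.1 : ℂ) ^ m)⁻¹ = 1 :=
    mul_inv_cancel₀ (pow_ne_zero _ (by exact_mod_cast hp0.ne'))
  have h3 : (p.1 : ℂ) ^ m * (fastFactor (h 2) (p, x) * fastVar m h p V x)
      = (fastFactor (h 2) (p, x) * fastFactorInv (h 2) (p, x)) *
        ((p.1 : ℂ) ^ m * ((p.1 : ℂ) ^ m)⁻¹) *
        (V x 3 - (h 0 (p, x) * V x 0 + h 1 (p, x) * V x 1 + h 2 (p, x) * V x 2)) := by
    rw [fastVar]; ring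
  rw [h3, h1, h2]
  ring

/-- For `W = v''' - h · (v, v', v'')` the slow manifold equation gives `W' = -(δ⁻¹ + h₂) W + δ^(2m)
e · (v, v', v'')`. The integrating factor removes `h₂`; dividing by `δ^m` leaves `δ^m` in front of
the residual, which is why the manifold is taken to order `2m`. -/
lemma hasDerivAt_fastVar (hs : IsSlowManifold X δ₀ g (2 * m) h e) (hp : p ∈ paramSet δ₀)
    (hp0 : 0 < p.1) (hV : IsFastSlowSolution g p V) (x : ℝ) :
    HasDerivAt (fastVar m h p V) (-((p.1 : ℂ)⁻¹ * fastVar m h p V x) + (p.1 : ℂ) ^ m *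
      (fastFactorInv (h 2) (p, x) * e 0 (p, x) * V x 0 + fastFactorInv (h 2) (p, x) * e 1 (p, x)
        * V x 1 + fastFactorInv (h 2) (p, x) * e 2 (p, x) * V x 2)) x := by
  have hd : ∀ j, HasDerivAt (fun x => h j (p, x)) (dx δ₀ (h j) (p, x)) x := fun j =>
    (hs.coeff j).smooth.hasDerivAt hp x
  have h1 := ((hasDerivAt_fastFactorInv (hs.coeff 2).smooth hp x).mul_const
    ((p.1 : ℂ) ^ m)⁻¹).mul ((hV.d3 x).sub
      ((((hd 0).mul (hV.d0 x)).add ((hd 1).mul (hV.d1 x))).add ((hd 2).mul (hV.d2 x))))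
  refine HasDerivAt.congr_deriv (f := fastVar m h p V) h1 ?_
  have e0 := hs.eq 0 p hp x
  have e1 := hs.eq 1 p hp x
  have e2 := hs.eq 2 p hp x
  have hδ : (p.1 : ℂ) ≠ 0 := by exact_mod_cast hp0.ne'
  simp only [slowDeriv, Matrix.cons_val_zero, Matrix.cons_val_one, Matrix.cons_val] at e0 e1 e2
  -- The three slow manifold equations, solved for the `x`-derivatives of the coefficients.
  have f0 : dx δ₀ (h 0) (p, x) = (p.1 : ℂ)⁻¹ * (g 0 (p, x) - h 0 (p, x))
      - (p.1 : ℂ) ^ (2 * m) * e 0 (p, x) - h 2 (p, x) * h 0 (p, x) := by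
    field_simp; rw [pow_succ] at e0; linear_combination -e0
  have f1 : dx δ₀ (h 1) (p, x) = (p.1 : ℂ)⁻¹ * (g 1 (p, x) - h 1 (p, x))
      - (p.1 : ℂ) ^ (2 * m) * e 1 (p, x) - h 0 (p, x) - h 2 (p, x) * h 1 (p, x) := by
    field_simp; rw [pow_succ] at e1; linear_combination -e1
  have f2 : dx δ₀ (h 2) (p, x) = (p.1 : ℂ)⁻¹ * (g 2 (p, x) - h 2 (p, x))
      - (p.1 : ℂ) ^ (2 * m) * e 2 (p, x) - h 1 (p, x) - h 2 (p, x) * h 2 (p, x) := by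
    field_simp; rw [pow_succ] at e2; linear_combination -e2
  have hpow : (p.1 : ℂ) ^ (2 * m) = (p.1 : ℂ) ^ m * (p.1 : ℂ) ^ m := by rw [two_mul, pow_add]
  have hm : ((p.1 : ℂ) ^ m)⁻¹ * (p.1 : ℂ) ^ m = 1 := inv_mul_cancel₀ (pow_ne_zero _ hδ)
  simp only [Pi.sub_apply, Pi.add_apply, Pi.mul_apply]
  rw [f0, f1, f2, fastVar, hpow]
  linear_combination (fastFactorInv (h 2) (p, x) * (p.1 : ℂ) ^ m * (e 0 (p, x) * V x 0
    + e 1 (p, x) * V x 1 + e 2 (p, x) * V x 2)) * hm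

/-- The slow coordinates. -/
def slowVar (V : ℝ → Fin 4 → ℂ) (x : ℝ) : Fin 3 → ℂ := fun i => V x i.castSucc

/-- Duhamel's formula for the fast variable, inserted into the integrated slow equations, closes the
system on the slow variables. Each exponential kernel meets a factor `δ^m`: the initial layer takes
it from the coupling of `z` into `v'''`, the forced response from the residual. This makes both
smooth at `δ = 0`. -/
theorem reduction (hs : IsSlowManifold X δ₀ g (2 * m) h e) (hp : p ∈ paramSet δ₀)
    (hp0 : 0 < p.1) (hV : IsFastSlowSolution g p V) {z₀ : ℝ} (hz₀ : fastVar m h p V 0 = z₀) :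
    slowVar V X = slowSol hX m h e (slowVar V 0) z₀ p (lastPt hX) ∧
      fastFactor (h 2) (p, X) * fastVar m h p V X = fastEnd hX m h e (slowVar V 0) z₀ p := by
  have hYd : ∀ x, HasDerivAt (slowVar V) ![V x 1, V x 2, V x 3] x := fun x => by
    rw [hasDerivAt_pi]
    intro i
    fin_cases i
    · exact hV.d0 x
    · exact hV.d1 x
    · exact hV.d2 x
  have hYc : Continuous (slowVar V) := continuous_iff_continuousAt.2 fun x => (hYd x).continuousAt
  set z : ℝ → Fin 1 → ℂ := fun x _ => fastVar m h p V x with hz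
  have hzd' := hasDerivAt_fastVar hs hp hp0 hV
  have hzc : Continuous z := by
    have : Continuous (fastVar m h p V) :=
      continuous_iff_continuousAt.2 fun x => (hzd' x).continuousAt
    exact continuous_pi fun _ => this
  set Y := restr X (slowVar V) hYc with hY
  set Z := restr X z hzc with hZ
  have hcq : ∀ x : Icc 0 X, cur X (fastFactor (h 2)) p x = fastFactor (h 2) (p, x) := fun x =>
    cur_apply ((isSmoothCoeff_fastFactor (hs.coeff 2).smooth).continuous hp) x
  have hch : ∀ j, ∀ x : Icc 0 X, cur X (h j) p x = h j (p, x) := fun j x =>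
    cur_apply ((hs.coeff j).smooth.continuous hp) x
  have hce : ∀ j, ∀ x : Icc 0 X, cur X (fun y => fastFactorInv (h 2) y * e j y) p x
      = fastFactorInv (h 2) (p, x) * e j (p, x) := fun j x =>
    cur_apply (IsSmoothCoeff.continuous (ContDiffOn.mul
      (isSmoothCoeff_fastFactorInv (hs.coeff 2).smooth) (hs.residual_coeff j).smooth) hp) x
  -- the fast equation
  have hker : ∀ x : Icc 0 X, expKernel X 0 0 p.1 x = Real.exp (-(x / p.1)) := fun x => by
    rw [expKernel_of_pos hp0]; simp
  have hkm : expKernel X m 0 p.1 = p.1 ^ m • expKernel X 0 0 p.1 := by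
    ext x
    rw [ContinuousMap.smul_apply, expKernel_of_pos hp0, expKernel_of_pos hp0]
    simp
  have hconv : conv ℝ (Fin 1 → ℂ) hX.le (expKernel X 0 0 p.1)
      (p.1 ^ m • mulOp ℝ (Icc 0 X) 1 3 (fastRow X h e p) Y) = layerOp hX m h e p Y := by
    rw [layerOp, ContinuousLinearMap.comp_apply, hkm, map_smul, map_smul, smul_apply]
  have hfast := duhamel (δ := p.1) hX.le hzc
    (f := p.1 ^ m • mulOp ℝ (Icc 0 X) 1 3 (fastRow X h e p) Y) (fun x => by
      rw [hasDerivAt_pi]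
      intro i
      have h1 := hzd' x
      refine HasDerivAt.congr_deriv (f := fastVar m h p V) h1 ?_
      simp only [Pi.add_apply, Pi.neg_apply, Pi.smul_apply, ContinuousMap.smul_apply, mulOp_apply,
        fastRow, hce, Fin.sum_univ_three, hz, Complex.real_smul]
      push_cast
      rfl) _ hker
  rw [hconv] at hfast
  -- the slow equations
  have hslow := conv_one_eq_sub (𝕜 := ℝ) hX.le hYc
    (w := mulOp ℝ (Icc 0 X) 3 3 (slowMat X h p) Y
      + mulOp ℝ (Icc 0 X) 3 1 (p.1 ^ m • fastCol X h p) Z) (fun x => by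
      have h1 := hYd x
      refine HasDerivAt.congr_deriv (f := slowVar V) h1 ?_
      ext i
      rw [ContinuousMap.add_apply, Pi.add_apply, mulOp_apply, mulOp_apply, Fin.sum_univ_three,
        Fin.sum_univ_one]
      fin_cases i
      · simp [slowMat, fastCol, hY, slowVar]
      · simp [slowMat, fastCol, hY, slowVar]
      · simp only [slowMat, fastCol, hY, hZ]
        simp [slowVar, hcq, hch, hz]
        rw [fast_eq (m := m) (h := h) (V := V) hp0]
        ring)
  have hYeq : Y = slowRhs hX m h (slowVar V 0) z₀ p + slowOp hX m h e p Y := by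
    have h1 : mulOp ℝ (Icc 0 X) 3 1 (p.1 ^ m • fastCol X h p) Z
        = z₀ • mulOp ℝ (Icc 0 X) 3 1 (fastCol X h p) (realToVec X (expKernel X m 0 p.1))
          + mulOp ℝ (Icc 0 X) 3 1 (p.1 ^ m • fastCol X h p) (layerOp hX m h e p Y) := by
      rw [hZ, hfast, map_add]
      congr 1
      ext x i
      rw [ContinuousMap.smul_apply, Pi.smul_apply, mulOp_apply, mulOp_apply, Fin.sum_univ_one,
        Fin.sum_univ_one, realToVec_apply, hkm]
      simp only [Pi.smul_apply, ContinuousMap.smul_apply, ContinuousMap.coe_mk, hz, hz₀,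
        Complex.real_smul, smul_eq_mul]
      push_cast
      ring
    rw [map_add, h1, map_add, map_smul] at hslow
    rw [slowRhs, slowOp, add_apply, volterraOp, ContinuousLinearMap.comp_apply,
      ContinuousLinearMap.comp_apply, ContinuousLinearMap.comp_apply]
    refine (eq_add_of_sub_eq hslow.symm).trans ?_
    abel
  have hsol : Y = slowSol hX m h e (slowVar V 0) z₀ p :=
    eq_inverse_one_sub_apply (isUnit_one_sub_slowOp hX m h e p) hYeq
  refine ⟨by rw [← hsol]; rfl, ?_⟩
  rw [fastEnd, ← hsol, hcq]
  have h2 := congrArg (fun F : C(Icc 0 X, Fin 1 → ℂ) => F (lastPt hX) 0) hfast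
  simp only [ContinuousMap.add_apply, ContinuousMap.coe_mk, Pi.add_apply, Pi.smul_apply, hz, hz₀,
    restr_apply, hker] at h2
  have h3 : expNegInvGlue (p.1 / X) = Real.exp (-(X / p.1)) := by
    rw [expNegInvGlue, if_neg (not_le.2 (div_pos hp0 hX)), inv_div]
  rw [h3, show ((lastPt hX : Icc 0 X) : ℝ) = X from rfl] at *
  rw [h2]
  simp only [Complex.real_smul]
  push_cast
  ring

end Reduction

end

end KdVKS

namespace KdVKS

noncomputable section

set_option linter.unusedSectionVars false

open Set Filter Topology

/-! ### The renormalized Evans function -/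

section RenormalizedEvans

variable {X δ₀ : ℝ} {U : ℝ → ℝ → ℝ} {c : ℝ → ℝ}

/-- The coefficients of the fast equation `δ v'''' = -v''' + g · (v, v', v'')`. -/
def waveCoeff (U : ℝ → ℝ → ℝ) (c : ℝ → ℝ) : Fin 3 → (ℝ × ℂ) × ℝ → ℂ :=
  ![fun y => -(((deriv (U y.1.1) y.2 : ℝ) : ℂ) + y.1.2),
    fun y => -((U y.1.1 y.2 - c y.1.1 : ℝ) : ℂ), fun y => -(y.1.1 : ℂ)]

lemma IsWaveFamily.contDiff_profile (hw : IsWaveFamily X δ₀ U c) {δ : ℝ} (hδ : δ ∈ Ico 0 δ₀) :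
    ContDiff ℝ ∞ (U δ) := by
  have h1 := hw.smooth_profile.comp (f := fun x : ℝ => (δ, x)) (s := univ)
    (by fun_prop) fun x _ => ⟨hδ, mem_univ x⟩
  exact contDiffOn_univ.1 h1

lemma IsWaveFamily.isCoeff_profile (hw : IsWaveFamily X δ₀ U c) :
    IsCoeff X δ₀ fun y => ((U y.1.1 y.2 : ℝ) : ℂ) := by
  refine ⟨?_, fun p hp x => ?_⟩
  · exact Complex.ofRealCLM.contDiff.comp_contDiffOn (hw.smooth_profile.comp
      (f := fun y : (ℝ × ℂ) × ℝ => (y.1.1, y.2)) (by fun_prop) fun y hy => ⟨hy.1.1, mem_univ _⟩)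
  · simp only [hw.periodic p.1 hp.1 x]

lemma IsWaveFamily.dx_profile (hw : IsWaveFamily X δ₀ U c) {p : ℝ × ℂ} (hp : p ∈ paramSet δ₀)
    (x : ℝ) : dx δ₀ (fun y => ((U y.1.1 y.2 : ℝ) : ℂ)) (p, x) = (deriv (U p.1) x : ℝ) := by
  have h1 := hw.isCoeff_profile.smooth.hasDerivAt hp x
  have h2 : HasDerivAt (U p.1) (deriv (U p.1) x) x :=
    ((hw.contDiff_profile hp.1).differentiable (by simp) x).hasDerivAt
  exact h1.unique h2.ofReal_comp

lemma IsWaveFamily.isCoeff_waveCoeff (hw : IsWaveFamily X δ₀ U c) (j : Fin 3) :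
    IsCoeff X δ₀ (waveCoeff U c j) := by
  have hlam : IsCoeff X δ₀ fun y => y.1.2 :=
    isCoeff_of_param (f := fun p : ℝ × ℂ => p.2) contDiffOn_snd
  have hdU : IsCoeff X δ₀ fun y => ((deriv (U y.1.1) y.2 : ℝ) : ℂ) := by
    have h1 := hw.isCoeff_profile.dx
    refine ⟨ContDiffOn.congr h1.smooth fun y hy => (hw.dx_profile hy.1 y.2).symm,
      fun p hp x => ?_⟩
    have := h1.periodic p hp x
    simp only [hw.dx_profile hp] at this
    exact this
  have hc : IsCoeff X δ₀ fun y => ((c y.1.1 : ℝ) : ℂ) :=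
    isCoeff_of_param (f := fun p : ℝ × ℂ => ((c p.1 : ℝ) : ℂ))
      (Complex.ofRealCLM.contDiff.comp_contDiffOn
        (hw.smooth_speed.comp contDiffOn_fst fun p hp => hp.1))
  have hUc : IsCoeff X δ₀ fun y => ((U y.1.1 y.2 - c y.1.1 : ℝ) : ℂ) := by
    have := hw.isCoeff_profile.add hc.neg
    convert this using 2
    push_cast
    ring
  have hδ : IsCoeff X δ₀ fun y => (y.1.1 : ℂ) := by
    simpa using isCoeff_delta_pow (X := X) (δ₀ := δ₀) 1
  fin_cases j
  · exact (hdU.add hlam).neg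
  · exact hUc.neg
  · exact hδ.neg

lemma IsWaveFamily.continuous_kdvksMatrix (hw : IsWaveFamily X δ₀ U c) {δ : ℝ}
    (hδ : δ ∈ Ico 0 δ₀) (lam : ℂ) (i j : Fin 4) :
    Continuous fun x => kdvksMatrix δ (U δ) (c δ) lam x i j := by
  have h1 : Continuous (U δ) := (hw.contDiff_profile hδ).continuous
  have h2 : Continuous (deriv (U δ)) := (hw.contDiff_profile hδ).continuous_deriv (by simp)
  fin_cases i <;> fin_cases j <;> simp [kdvksMatrix] <;> fun_prop

lemma IsWaveFamily.continuous_kdvMatrix (hw : IsWaveFamily X δ₀ U c) (lam : ℂ) (i j : Fin 3) :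
    Continuous fun x => kdvMatrix (U 0) (c 0) lam x i j := by
  have hδ : (0 : ℝ) ∈ Ico 0 δ₀ := ⟨le_rfl, hw.delta_pos⟩
  have h1 : Continuous (U 0) := (hw.contDiff_profile hδ).continuous
  have h2 : Continuous (deriv (U 0)) := (hw.contDiff_profile hδ).continuous_deriv (by simp)
  fin_cases i <;> fin_cases j <;> simp [kdvMatrix] <;> fun_prop

lemma isFastSlowSolution_of_kdvks {δ : ℝ} (hδ : 0 < δ) {lam : ℂ} {V : ℝ → Fin 4 → ℂ}
    (hV : ∀ x, HasDerivAt V ((kdvksMatrix δ (U δ) (c δ) lam x).mulVec (V x)) x) :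
    IsFastSlowSolution (waveCoeff U c) (δ, lam) V := by
  have hd : (δ : ℂ) ≠ 0 := by exact_mod_cast hδ.ne'
  refine ⟨fun x => ?_, fun x => ?_, fun x => ?_, fun x => ?_⟩
  · refine (hasDerivAt_pi.1 (hV x) 0).congr_deriv ?_
    simp [kdvksMatrix, Matrix.mulVec, dotProduct, Fin.sum_univ_four]
  · refine (hasDerivAt_pi.1 (hV x) 1).congr_deriv ?_
    simp [kdvksMatrix, Matrix.mulVec, dotProduct, Fin.sum_univ_four]
  · refine (hasDerivAt_pi.1 (hV x) 2).congr_deriv ?_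
    simp [kdvksMatrix, Matrix.mulVec, dotProduct, Fin.sum_univ_four]
  · refine (hasDerivAt_pi.1 (hV x) 3).congr_deriv ?_
    simp [kdvksMatrix, Matrix.mulVec, dotProduct, Fin.sum_univ_four, waveCoeff]
    field_simp
    ring

/-- The passage to slow-fast coordinates at `x = 0`. -/
def toSlowFast (m : ℕ) (h : Fin 3 → (ℝ × ℂ) × ℝ → ℂ) (p : ℝ × ℂ) : Matrix (Fin 4) (Fin 4) ℂ :=
  !![1, 0, 0, 0;
     0, 1, 0, 0;
     0, 0, 1, 0;
     -h 0 (p, 0) * ((p.1 : ℂ) ^ m)⁻¹, -h 1 (p, 0) * ((p.1 : ℂ) ^ m)⁻¹,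
      -h 2 (p, 0) * ((p.1 : ℂ) ^ m)⁻¹, ((p.1 : ℂ) ^ m)⁻¹]

/-- The inverse of `toSlowFast`. -/
def ofSlowFast (m : ℕ) (h : Fin 3 → (ℝ × ℂ) × ℝ → ℂ) (p : ℝ × ℂ) : Matrix (Fin 4) (Fin 4) ℂ :=
  !![1, 0, 0, 0;
     0, 1, 0, 0;
     0, 0, 1, 0;
     h 0 (p, 0), h 1 (p, 0), h 2 (p, 0), (p.1 : ℂ) ^ m]

lemma toSlowFast_mul_ofSlowFast (m : ℕ) (h : Fin 3 → (ℝ × ℂ) × ℝ → ℂ) {p : ℝ × ℂ}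
    (hp0 : 0 < p.1) : toSlowFast m h p * ofSlowFast m h p = 1 := by
  have hd : (p.1 : ℂ) ^ m ≠ 0 := pow_ne_zero _ (by exact_mod_cast hp0.ne')
  ext i j
  fin_cases i <;> fin_cases j <;>
    simp [toSlowFast, ofSlowFast, Matrix.mul_apply, Fin.sum_univ_four, hd] <;> ring

lemma det_conj_sub_smul {n : ℕ} {A B R : Matrix (Fin n) (Fin n) ℂ} (hAB : A * B = 1) (μ : ℂ) :
    (A * R * B - μ • 1).det = (R - μ • 1).det := by
  have h1 : A * R * B - μ • 1 = A * (R - μ • 1) * B := by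
    rw [mul_sub, sub_mul, mul_smul_comm, mul_one, smul_mul_assoc, hAB]
  rw [h1, Matrix.det_mul, Matrix.det_mul, mul_right_comm, ← Matrix.det_mul, hAB, Matrix.det_one,
    one_mul]

/-- Column `j` starts from the `j`-th unit vector in slow-fast coordinates. The change of
coordinates at `x = X` is the one at `x = 0`, since `h` is periodic and `fastEnd` multiplies the
integrating factor back in; hence a true conjugation. -/
theorem monodromy_eq_conj (hw : IsWaveFamily X δ₀ U c) (hX : 0 < X) {m : ℕ}
    {h e : Fin 3 → (ℝ × ℂ) × ℝ → ℂ} (hs : IsSlowManifold X δ₀ (waveCoeff U c) (2 * m) h e)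
    {p : ℝ × ℂ} (hp : p ∈ paramSet δ₀) (hp0 : 0 < p.1) :
    monodromy hX m h e p = toSlowFast m h p *
      principalSolution (kdvksMatrix p.1 (U p.1) (c p.1) p.2) X * ofSlowFast m h p := by
  set A := kdvksMatrix p.1 (U p.1) (c p.1) p.2
  set R := principalSolution A
  have hA := hw.continuous_kdvksMatrix hp.1 p.2
  have hR := isPrincipalSolution_principalSolution hA
  have hd : (p.1 : ℂ) ^ m ≠ 0 := pow_ne_zero _ (by exact_mod_cast hp0.ne')
  ext i j
  set V : ℝ → Fin 4 → ℂ := fun x => (R x).mulVec ((ofSlowFast m h p).col j) with hVdef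
  have hV : IsFastSlowSolution (waveCoeff U c) p V :=
    isFastSlowSolution_of_kdvks hp0 fun x => hasDerivAt_mulVec_iff (hR.2 x) _
  have hV0 : V 0 = (ofSlowFast m h p).col j := by
    rw [hVdef]; simp only; rw [show R 0 = 1 from hR.1, Matrix.one_mulVec]
  have hz0 : fastVar m h p V 0 = ((if j = Fin.last 3 then 1 else 0 : ℝ) : ℂ) := by
    rw [fastVar, fastFactorInv_zero, hV0]
    fin_cases j <;> simp [ofSlowFast, Matrix.col, hd]
  have hy0 : slowVar V 0 = fun k => if k.castSucc = j then 1 else 0 := by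
    ext k
    rw [slowVar, hV0]
    fin_cases j <;> fin_cases k <;> simp [ofSlowFast, Matrix.col]
  obtain ⟨h1, h2⟩ := reduction hX hs hp hp0 hV hz0
  rw [hy0] at h1 h2
  have hprod : (toSlowFast m h p * R X * ofSlowFast m h p) i j
      = (toSlowFast m h p).mulVec (V X) i := by
    rw [hVdef, Matrix.mulVec_mulVec]
    rfl
  rw [hprod]
  induction i using Fin.lastCases with
  | last =>
    rw [monodromy_last, ← h2, fastVar]
    have hper : ∀ j, h j (p, X) = h j (p, 0) := fun j => by
      have := (hs.coeff j).periodic p hp 0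
      simpa using this
    have h3 := fastFactor_mul_inv (h 2) (p, X)
    rw [hper, hper, hper, ← mul_assoc, ← mul_assoc, h3]
    simp [toSlowFast, Matrix.mulVec, dotProduct, Fin.sum_univ_four]
    ring
  | cast i =>
    rw [monodromy_castSucc, ← h1, slowVar]
    fin_cases i <;> simp [toSlowFast, Matrix.mulVec, dotProduct, Fin.sum_univ_four]

lemma det_sub_smul_of_last_zero {M : Matrix (Fin 4) (Fin 4) ℂ} {R : Matrix (Fin 3) (Fin 3) ℂ}
    (hlast : ∀ j, M (Fin.last 3) j = 0) (hR : ∀ i j : Fin 3, M i.castSucc j.castSucc = R i j)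
    (μ : ℂ) : (M - μ • 1).det = -μ * (R - μ • 1).det := by
  rw [Matrix.det_succ_row _ (Fin.last 3), Fin.sum_univ_castSucc]
  have h0 : ∀ j : Fin 3, (M - μ • 1) (Fin.last 3) j.castSucc = 0 := fun j => by
    rw [Matrix.sub_apply, Matrix.smul_apply, hlast,
      Matrix.one_apply_ne (Fin.castSucc_lt_last j).ne', smul_zero, sub_zero]
  have h1 : (M - μ • 1).submatrix (Fin.last 3).succAbove (Fin.last 3).succAbove = R - μ • 1 := by
    ext i j
    rw [Matrix.submatrix_apply, Fin.succAbove_last, Matrix.sub_apply, hR]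
    simp [Matrix.one_apply]
  have h2 : (M - μ • 1) (Fin.last 3) (Fin.last 3) = -μ := by
    rw [Matrix.sub_apply, Matrix.smul_apply, hlast, Matrix.one_apply_eq, smul_eq_mul, mul_one,
      zero_sub]
  rw [h1, h2]
  simp only [h0, mul_zero, zero_mul, Finset.sum_const_zero, zero_add]
  norm_num

/-- At `δ = 0` the layer kernels and `expNegInvGlue` vanish, so the last row is zero and contributes
the factor `-μ`. There `h = g` with `g₂ = -δ = 0`, which is the KdV equation. -/
theorem det_monodromy_zero (hw : IsWaveFamily X δ₀ U c) (hX : 0 < X) {m : ℕ} 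
    {h e : Fin 3 → (ℝ × ℂ) × ℝ → ℂ} (hs : IsSlowManifold X δ₀ (waveCoeff U c) (2 * m) h e)
    (lam μ : ℂ) : (monodromy hX m h e (0, lam) - μ • 1).det =
      -μ * (principalSolution (kdvMatrix (U 0) (c 0) lam) X - μ • 1).det := by
  have hp : ((0 : ℝ), lam) ∈ paramSet δ₀ := ⟨⟨le_rfl, hw.delta_pos⟩, mem_univ _⟩
  have hlay : layerOp hX m h e (0, lam) = 0 := by
    rw [layerOp, expKernel_of_nonpos le_rfl, map_zero, ContinuousLinearMap.zero_comp]
  have hA := hw.continuous_kdvMatrix lam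
  have hmat : slowMat X h (0, lam)
      = fun i j => restr X (fun x => kdvMatrix (U 0) (c 0) lam x i j) (hA i j) := by
    funext i j
    ext x
    have hch : ∀ j, cur X (h j) (0, lam) x = waveCoeff U c j ((0, lam), x) := fun j => by
      rw [cur_apply ((hs.coeff j).smooth.continuous hp) x]
      exact hs.at_zero j _ hp rfl x
    fin_cases i
    · fin_cases j <;> simp [slowMat, kdvMatrix]
    · fin_cases j <;> simp [slowMat, kdvMatrix]
    · have h3 : slowMat X h (0, lam) 2 j x = waveCoeff U c j ((0, lam), x) := hch j
      refine h3.trans ?_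
      fin_cases j <;> simp [waveCoeff, kdvMatrix]
  refine det_sub_smul_of_last_zero (fun j => ?_) (fun i j => ?_) μ
  · rw [monodromy_last, fastEnd, hlay]
    simp [expNegInvGlue]
  · rw [monodromy_castSucc, principalSolution_eq_inverse (𝕜 := ℝ) hX.le hA, slowSol, slowOp, hlay,
      ContinuousLinearMap.comp_zero, ContinuousLinearMap.comp_zero, add_zero, hmat, slowRhs]
    have h4 : (j.castSucc = Fin.last 3) = False := eq_false (Fin.castSucc_lt_last j).ne
    have h5 : (fun k : Fin 3 => if k.castSucc = j.castSucc then (1 : ℂ) else 0) = Pi.single j 1 := by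
      ext k
      simp [Pi.single_apply, Fin.castSucc_inj]
    simp only [h4, if_false, zero_smul, add_zero, h5]
    rfl

/-- The renormalized Evans function, extended by the Evans function of KdV to `δ = 0`. -/
def evansExt (X : ℝ) (U : ℝ → ℝ → ℝ) (c : ℝ → ℝ) (y : (ℝ × ℝ) × ℂ) : ℂ :=
  if 0 < y.1.1 then
    -(Complex.exp (-(Complex.I * y.1.2 * X))) * evans X y.1.1 (U y.1.1) (c y.1.1) y.2 y.1.2
  else evansKdV X (U 0) (c 0) y.2 y.1.2

/-- `evansExt` does not involve the slow manifold, so each order `k` may be proved with its own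
choice: `m = 2k + 2` and a manifold of order `2m`. -/
theorem contDiffOn_evansExt (hw : IsWaveFamily X δ₀ U c) :
    ContDiffOn ℝ ∞ (evansExt X U c) ((Ico 0 δ₀ ×ˢ univ) ×ˢ univ) := by
  have hX := hw.period_pos
  refine contDiffOn_infty.2 fun k => ?_
  obtain ⟨h, e, hs⟩ := exists_isSlowManifold hw.isCoeff_waveCoeff (2 * (2 * k + 2))
  set Φ : ℝ × ℂ → Matrix (Fin 4) (Fin 4) ℂ := monodromy hX (2 * k + 2) h e with hΦ
  have hΦs : ∀ i j, ContDiffOn ℝ k (fun p => Φ p i j) (paramSet δ₀) := fun i j =>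
    contDiffOn_monodromy hX le_rfl (fun j => (hs.coeff j).smooth)
      (fun j => (hs.residual_coeff j).smooth) i j
  have heq : ∀ y ∈ ((Ico 0 δ₀ ×ˢ univ) ×ˢ univ : Set ((ℝ × ℝ) × ℂ)), evansExt X U c y
      = -(Complex.exp (-(Complex.I * y.1.2 * X))) *
        (Φ (y.1.1, y.2) - Complex.exp (Complex.I * y.1.2 * X) • 1).det := by
    rintro ⟨⟨δ, ξ⟩, lam⟩ hy
    have hp : (δ, lam) ∈ paramSet δ₀ := ⟨hy.1.1, mem_univ _⟩
    rcases hy.1.1.1.lt_or_eq with hδ | hδ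
    · have hδ' : 0 < δ := hδ
      simp only [evansExt, hδ', if_true]
      rw [hΦ, monodromy_eq_conj hw hX hs hp hδ',
        det_conj_sub_smul (toSlowFast_mul_ofSlowFast _ h hδ'), evans]
    · have hδ' : δ = 0 := hδ.symm
      subst hδ'
      simp only [evansExt, lt_irrefl, if_false]
      rw [hΦ, det_monodromy_zero hw hX hs, evansKdV, ← mul_assoc, neg_mul_neg, ← Complex.exp_add]
      simp
  refine ContDiffOn.congr ?_ heq
  have hξ : ContDiff ℝ k fun y : (ℝ × ℝ) × ℂ => Complex.I * y.1.2 * X :=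
    (contDiff_const.mul (Complex.ofRealCLM.contDiff.comp (contDiff_snd.comp contDiff_fst))).mul
      contDiff_const
  have hent : ∀ i j, ContDiffOn ℝ k (fun y : (ℝ × ℝ) × ℂ =>
      (Φ (y.1.1, y.2) - Complex.exp (Complex.I * y.1.2 * X) • (1 : Matrix (Fin 4) (Fin 4) ℂ)) i j)
      ((Ico 0 δ₀ ×ˢ univ) ×ˢ univ) := fun i j => by
    have h1 : ContDiffOn ℝ k (fun y : (ℝ × ℝ) × ℂ => Φ (y.1.1, y.2) i j)
        ((Ico 0 δ₀ ×ˢ univ) ×ˢ univ) :=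
      (hΦs i j).comp (f := fun y : (ℝ × ℝ) × ℂ => (y.1.1, y.2)) (by fun_prop)
        fun y hy => ⟨hy.1.1, mem_univ _⟩
    exact h1.sub (hξ.cexp.mul contDiff_const).contDiffOn
  have hdet : ContDiffOn ℝ k (fun y : (ℝ × ℝ) × ℂ =>
      (Φ (y.1.1, y.2) - Complex.exp (Complex.I * y.1.2 * X) • (1 : Matrix (Fin 4) (Fin 4) ℂ)).det)
      ((Ico 0 δ₀ ×ˢ univ) ×ˢ univ) := by
    simp only [Matrix.det_apply]
    refine ContDiffOn.sum fun σ _ => ContDiffOn.const_smul _ ?_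
    exact contDiffOn_prod fun i _ => hent (σ i) i
  exact (hξ.neg.cexp.neg.contDiffOn).mul hdet

end RenormalizedEvans

end

end KdVKS

namespace KdVKS

noncomputable section

set_option linter.unusedSectionVars false

open Set Filter Topology

/-! ### Holomorphy, symmetry and degeneracy of the Evans functions -/

section EvansStructure

variable {X δ₀ : ℝ} {U : ℝ → ℝ → ℝ} {c : ℝ → ℝ}

lemma contDiff_restr_affine {f : ℂ → ℝ → ℂ} (hf : ∀ l, Continuous (f l)) {b : ℂ}
    (h : ∀ l x, f l x = f 0 x + l * b) {k : WithTop ℕ∞} :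
    ContDiff ℂ k fun l => restr X (f l) (hf l) := by
  have heq : (fun l => restr X (f l) (hf l))
      = fun l => restr X (f 0) (hf 0) + l • ContinuousMap.const (Icc 0 X) b := by
    funext l
    ext x
    exact h l x
  rw [heq]
  exact contDiff_const.add (contDiff_id.smul contDiff_const)

lemma kdvksMatrix_affine (δ : ℝ) (u : ℝ → ℝ) (c : ℝ) (i j : Fin 4) :
    ∃ b : ℂ, ∀ l x, kdvksMatrix δ u c l x i j = kdvksMatrix δ u c 0 x i j + l * b := by
  by_cases h : i = 3 ∧ j = 0
  · obtain ⟨rfl, rfl⟩ := h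
    exact ⟨-1 / δ, fun l x => by simp [kdvksMatrix]; ring⟩
  · refine ⟨0, fun l x => ?_⟩
    rw [mul_zero, add_zero]
    fin_cases i <;> fin_cases j <;> simp_all [kdvksMatrix]

lemma kdvMatrix_affine (u : ℝ → ℝ) (c : ℝ) (i j : Fin 3) :
    ∃ b : ℂ, ∀ l x, kdvMatrix u c l x i j = kdvMatrix u c 0 x i j + l * b := by
  by_cases h : i = 2 ∧ j = 0
  · obtain ⟨rfl, rfl⟩ := h
    exact ⟨-1, fun l x => by simp [kdvMatrix]; ring⟩
  · refine ⟨0, fun l x => ?_⟩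
    rw [mul_zero, add_zero]
    fin_cases i <;> fin_cases j <;> simp_all [kdvMatrix]

lemma IsWaveFamily.contDiff_restr_kdvksMatrix (hw : IsWaveFamily X δ₀ U c) {δ : ℝ}
    (hδ : δ ∈ Ico 0 δ₀) (i j : Fin 4) : ContDiff ℂ 1 fun l => restr X
      (fun x => kdvksMatrix δ (U δ) (c δ) l x i j) (hw.continuous_kdvksMatrix hδ l i j) := by
  obtain ⟨b, hb⟩ := kdvksMatrix_affine δ (U δ) (c δ) i j
  exact contDiff_restr_affine (f := fun l x => kdvksMatrix δ (U δ) (c δ) l x i j) _ hb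

lemma IsWaveFamily.differentiable_kdvks (hw : IsWaveFamily X δ₀ U c) {δ : ℝ}
    (hδ : δ ∈ Ico 0 δ₀) (i j : Fin 4) :
    Differentiable ℂ fun l => principalSolution (kdvksMatrix δ (U δ) (c δ) l) X i j :=
  differentiable_principalSolution hw.period_pos.le (fun l => hw.continuous_kdvksMatrix hδ l)
    (hw.contDiff_restr_kdvksMatrix hδ) i j

lemma differentiable_det {n : ℕ} {M : ℂ → Matrix (Fin n) (Fin n) ℂ}
    (h : ∀ i j, Differentiable ℂ fun l => M l i j) : Differentiable ℂ fun l => (M l).det := by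
  simp only [Matrix.det_apply]
  refine Differentiable.fun_sum fun σ _ => Differentiable.const_smul ?_ _
  exact Differentiable.fun_finsetProd fun i _ => h (σ i) i

theorem IsWaveFamily.differentiable_evans (hw : IsWaveFamily X δ₀ U c) {δ : ℝ}
    (hδ : δ ∈ Ico 0 δ₀) (ξ : ℝ) : Differentiable ℂ fun l => evans X δ (U δ) (c δ) l ξ :=
  differentiable_det fun i j => (hw.differentiable_kdvks hδ i j).sub_const _

theorem IsWaveFamily.differentiable_evansKdV (hw : IsWaveFamily X δ₀ U c) (ξ : ℝ) :
    Differentiable ℂ fun l => evansKdV X (U 0) (c 0) l ξ := by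
  refine differentiable_det fun i j => Differentiable.sub_const ?_ _
  refine differentiable_principalSolution hw.period_pos.le
    (fun l => hw.continuous_kdvMatrix l) (fun i j => ?_) i j
  obtain ⟨b, hb⟩ := kdvMatrix_affine (U 0) (c 0) i j
  exact contDiff_restr_affine (f := fun l x => kdvMatrix (U 0) (c 0) l x i j) _ hb

theorem IsWaveFamily.differentiable_evansExt (hw : IsWaveFamily X δ₀ U c) {p : ℝ × ℝ}
    (hp : p ∈ Ico 0 δ₀ ×ˢ (univ : Set ℝ)) : Differentiable ℂ fun l => evansExt X U c (p, l) := by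
  by_cases h : 0 < p.1
  · simp only [evansExt, h, if_true]
    exact (hw.differentiable_evans hp.1 p.2).const_mul _
  · simp only [evansExt, h, if_false]
    exact hw.differentiable_evansKdV p.2

lemma IsPrincipalSolution.map_conj {n : ℕ} {A R : ℝ → Matrix (Fin n) (Fin n) ℂ}
    (h : IsPrincipalSolution A R) : IsPrincipalSolution
      (fun x => (A x).map (starRingEnd ℂ)) (fun x => (R x).map (starRingEnd ℂ)) := by
  refine ⟨?_, fun x i j => ?_⟩
  · simp only [h.1]
    ext i j
    by_cases hij : i = j <;> simp [hij, Matrix.one_apply]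
  · have h1 := Complex.conjCLE.toContinuousLinearMap.hasFDerivAt.comp_hasDerivAt x (h.2 x i j)
    rw [← Matrix.map_mul]
    exact h1

lemma conj_exp_I_mul (ξ X : ℝ) :
    (starRingEnd ℂ) (Complex.exp (Complex.I * ξ * X))
      = Complex.exp (Complex.I * ((-ξ : ℝ) : ℂ) * X) := by
  rw [← Complex.exp_conj]
  simp

lemma det_conj_symm {n : ℕ} {A A' : ℝ → Matrix (Fin n) (Fin n) ℂ}
    (hA : ∀ i j, Continuous fun x => A x i j) (hA' : ∀ i j, Continuous fun x => A' x i j)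
    (h : ∀ x i j, A' x i j = (starRingEnd ℂ) (A x i j)) (X ξ : ℝ) :
    (principalSolution A' X - Complex.exp (Complex.I * ((-ξ : ℝ) : ℂ) * X) • 1).det
      = (starRingEnd ℂ) (principalSolution A X - Complex.exp (Complex.I * ξ * X) • 1).det := by
  have h1 := (isPrincipalSolution_principalSolution hA).map_conj
  have h2 : (fun x => (A x).map (starRingEnd ℂ)) = A' := by
    funext x
    ext i j
    exact (h x i j).symm
  rw [h2] at h1
  have h3 := IsPrincipalSolution.eq hA' h1 (isPrincipalSolution_principalSolution hA')
  rw [h3, ← conj_exp_I_mul, RingHom.map_det]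
  congr 1
  ext i j
  by_cases hij : i = j <;> simp [hij]

/-- Apart from `lam` all coefficients of the equations are real, so conjugation takes the
fundamental matrix for `lam` to the one for its conjugate and reverses the sign of `ξ` in the
multiplier. -/
theorem IsWaveFamily.evansExt_conj (hw : IsWaveFamily X δ₀ U c) {δ : ℝ} (hδ : δ ∈ Ico 0 δ₀)
    (ξ : ℝ) (lam : ℂ) : evansExt X U c ((δ, -ξ), (starRingEnd ℂ) lam)
      = (starRingEnd ℂ) (evansExt X U c ((δ, ξ), lam)) := by
  unfold evansExt
  split_ifs with h
  · simp only [evans]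
    rw [det_conj_symm (hw.continuous_kdvksMatrix hδ lam) (hw.continuous_kdvksMatrix hδ _)
      (fun x i j => ?_), map_mul, map_neg, ← Complex.exp_conj]
    · simp
    · fin_cases i <;> fin_cases j <;> simp [kdvksMatrix]
  · simp only [evansKdV]
    rw [det_conj_symm (hw.continuous_kdvMatrix lam) (hw.continuous_kdvMatrix _) (fun x i j => ?_)]
    fin_cases i <;> fin_cases j <;> simp [kdvMatrix]

lemma evans_eq_evansExt {δ : ℝ} (hδ : 0 < δ) (ξ : ℝ) (lam : ℂ) :
    evans X δ (U δ) (c δ) lam ξ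
      = -Complex.exp (Complex.I * ξ * X) * evansExt X U c ((δ, ξ), lam) := by
  simp only [evansExt, hδ, if_true]
  rw [← mul_assoc, neg_mul_neg, ← Complex.exp_add]
  simp

/-- The vector `(v, v', v'', v''')`. -/
def jet (v : ℝ → ℂ) (x : ℝ) : Fin 4 → ℂ :=
  ![v x, deriv v x, iteratedDeriv 2 v x, iteratedDeriv 3 v x]

lemma hasDerivAt_iteratedDeriv {v : ℝ → ℂ} (hv : ContDiff ℝ 4 v) {k : ℕ} (hk : k < 4) (x : ℝ) :
    HasDerivAt (iteratedDeriv k v) (iteratedDeriv (k + 1) v x) x := by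
  rw [iteratedDeriv_succ]
  exact (hv.differentiable_iteratedDeriv k (by exact_mod_cast hk) x).hasDerivAt

lemma hasDerivAt_jet {δ : ℝ} (hδ : 0 < δ) {u : ℝ → ℝ} (hu : Differentiable ℝ u) {c : ℝ} {lam : ℂ}
    {v : ℝ → ℂ} (hv : ContDiff ℝ 4 v) (hL : ∀ x, linOp δ u c v x = lam * v x) (x : ℝ) :
    HasDerivAt (jet v) ((kdvksMatrix δ u c lam x).mulVec (jet v x)) x := by
  have hd : (δ : ℂ) ≠ 0 := by exact_mod_cast hδ.ne'
  have h0 := hasDerivAt_iteratedDeriv hv (k := 0) (by norm_num) x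
  have h1 := hasDerivAt_iteratedDeriv hv (k := 1) (by norm_num) x
  have h2 := hasDerivAt_iteratedDeriv hv (k := 2) (by norm_num) x
  have h3 := hasDerivAt_iteratedDeriv hv (k := 3) (by norm_num) x
  rw [iteratedDeriv_zero] at h0
  simp only [zero_add, iteratedDeriv_one] at h0 h1
  have h4 : HasDerivAt (fun y => ((u y - c : ℝ) : ℂ) * v y)
      (((deriv u x : ℝ) : ℂ) * v x + ((u x - c : ℝ) : ℂ) * deriv v x) x :=
    (((hu x).hasDerivAt.sub_const c).ofReal_comp).mul h0
  have h5 := hL x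
  rw [linOp, h4.deriv] at h5
  rw [hasDerivAt_pi]
  intro i
  fin_cases i
  · refine h0.congr_deriv ?_
    simp [kdvksMatrix, jet, Matrix.mulVec, dotProduct, Fin.sum_univ_four]
  · refine h1.congr_deriv ?_
    simp [kdvksMatrix, jet, Matrix.mulVec, dotProduct, Fin.sum_univ_four]
  · refine h2.congr_deriv ?_
    simp [kdvksMatrix, jet, Matrix.mulVec, dotProduct, Fin.sum_univ_four]
  · refine h3.congr_deriv ?_
    simp [kdvksMatrix, jet, Matrix.mulVec, dotProduct, Fin.sum_univ_four]
    field_simp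
    push_cast at h5
    linear_combination -h5

/-- The jet of `e^{iξx} w` at `0` is an eigenvector of the monodromy matrix for the multiplier
`e^{iξX}`; it is nonzero by uniqueness for the differential equation. -/
theorem IsWaveFamily.evans_eq_zero_of_isBlochEigenvalue (hw : IsWaveFamily X δ₀ U c) {δ : ℝ}
    (hδ : δ ∈ Ico 0 δ₀) (hδ0 : 0 < δ) {ξ : ℝ} {lam : ℂ}
    (h : IsBlochEigenvalue X δ (U δ) (c δ) ξ lam) : evans X δ (U δ) (c δ) lam ξ = 0 := by
  obtain ⟨w, hws, hwp, hw0, hL⟩ := h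
  set v : ℝ → ℂ := fun y => Complex.exp (Complex.I * ξ * y) * w y with hvdef
  have hexp : ContDiff ℝ 4 fun y : ℝ => Complex.exp (Complex.I * ξ * y) :=
    (contDiff_const.mul Complex.ofRealCLM.contDiff).cexp
  have hv : ContDiff ℝ 4 v := hexp.mul hws
  have hL' : ∀ x, linOp δ (U δ) (c δ) v x = lam * v x := fun x => by
    have h1 := congrArg (Complex.exp (Complex.I * ξ * x) * ·) (hL x)
    simp only [← mul_assoc, ← Complex.exp_add] at h1
    rw [add_neg_cancel, Complex.exp_zero, one_mul] at h1
    rw [h1, hvdef]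
    ring
  have hA := hw.continuous_kdvksMatrix hδ lam
  have hR := isPrincipalSolution_principalSolution hA
  have hjet := hasDerivAt_jet hδ0 ((hw.contDiff_profile hδ).differentiable (by simp)) hv hL'
  have hsol := solution_eq_mulVec hA hR hjet
  set μ := Complex.exp (Complex.I * ξ * X) with hμ
  have hvX : ∀ x, v (x + X) = μ * v x := fun x => by
    simp only [hvdef, hμ]
    rw [hwp x, ← mul_assoc, ← Complex.exp_add]
    push_cast
    ring_nf
  have hderiv : ∀ k : ℕ, k ≤ 4 → iteratedDeriv k v X = μ * iteratedDeriv k v 0 := fun k hk => by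
    have h1 : iteratedDeriv k (fun x => v (x + X)) 0 = iteratedDeriv k (fun x => μ * v x) 0 := by
      rw [funext hvX]
    rw [iteratedDeriv_comp_add_const, iteratedDeriv_const_mul_field] at h1
    simpa using h1
  have hjX : jet v X = μ • jet v 0 := by
    have h1 := hderiv 1 (by norm_num)
    rw [iteratedDeriv_one] at h1
    have h0 := hvX 0
    rw [zero_add] at h0
    ext i
    fin_cases i
    · exact h0
    · exact h1
    · exact hderiv 2 (by norm_num)
    · exact hderiv 3 (by norm_num)
  have hj0 : jet v 0 ≠ 0 := fun h0 => by
    refine hw0 (funext fun x => ?_)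
    have h1 := congrFun (hsol x) 0
    rw [h0, Matrix.mulVec_zero] at h1
    have h2 : Complex.exp (Complex.I * ξ * x) * w x = 0 := h1
    exact (mul_eq_zero.1 h2).resolve_left (Complex.exp_ne_zero _)
  rw [evans, ← Matrix.exists_mulVec_eq_zero_iff]
  refine ⟨jet v 0, hj0, ?_⟩
  rw [Matrix.sub_mulVec, ← hsol X, hjX, Matrix.smul_mulVec, Matrix.one_mulVec, sub_self]

end EvansStructure

end

end KdVKS

namespace KdVKS

noncomputable section

set_option linter.unusedSectionVars false

open Set Filter Topology

/-! ### The double zero of the Evans function at the origin -/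

section DoubleZero

variable {X δ₀ : ℝ} {U : ℝ → ℝ → ℝ} {c : ℝ → ℝ}

/-- Multiply by invertible `P` and `Q` having `l` as row `i` and `v` as column `j`. At `t = 0` row
`i` and column `j` of the product vanish, and the entry `(i, j)` has zero derivative as well. Each
Leibniz term then contains either that entry or two factors vanishing at `0`, so its derivative is
zero. -/
theorem hasDerivAt_det_zero {n : ℕ} {M : ℝ → Matrix (Fin n) (Fin n) ℂ}
    {M' : Matrix (Fin n) (Fin n) ℂ} (hM : ∀ i j, HasDerivAt (fun t => M t i j) (M' i j) 0)
    {l v : Fin n → ℂ} (hl : l ≠ 0) (hv : v ≠ 0) (h1 : (M 0).mulVec v = 0)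
    (h2 : Matrix.vecMul l (M 0) = 0) (h3 : l ⬝ᵥ M'.mulVec v = 0) :
    HasDerivAt (fun t => (M t).det) 0 0 := by
  obtain ⟨i, hi⟩ := Function.ne_iff.1 hl
  obtain ⟨j, hj⟩ := Function.ne_iff.1 hv
  set P : Matrix (Fin n) (Fin n) ℂ := (1 : Matrix (Fin n) (Fin n) ℂ).updateRow i l with hP
  set Q : Matrix (Fin n) (Fin n) ℂ := (1 : Matrix (Fin n) (Fin n) ℂ).updateCol j v with hQ
  have hPi : P i = l := Matrix.updateRow_self
  have hQj : (fun k => Q k j) = v := funext fun k => Matrix.updateCol_self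
  have hPdet : P.det = l i := by
    have := Matrix.det_updateRow_sum (1 : Matrix (Fin n) (Fin n) ℂ) i l
    rw [Matrix.det_one, smul_eq_mul, mul_one] at this
    rw [← this, hP]
    congr 2
    ext k
    simp [Finset.sum_apply, Matrix.one_apply]
  have hQdet : Q.det = v j := by
    have := Matrix.det_updateCol_sum (1 : Matrix (Fin n) (Fin n) ℂ) j v
    rw [Matrix.det_one, smul_eq_mul, mul_one] at this
    rw [← this, hQ]
    congr 2
    ext k
    simp [Matrix.one_apply]
  have hrow : ∀ b, (P * M 0 * Q) i b = 0 := fun b => by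
    have : (P * M 0) i = 0 := by rw [Matrix.mul_apply_eq_vecMul, hPi, h2]
    rw [Matrix.mul_apply_eq_vecMul, this, Matrix.zero_vecMul]
    rfl
  have hcol : ∀ (N : Matrix (Fin n) (Fin n) ℂ) a, (P * N * Q) a j = P a ⬝ᵥ N.mulVec v :=
    fun N a => by
      rw [Matrix.mul_assoc, Matrix.mul_apply, dotProduct]
      refine Finset.sum_congr rfl fun k _ => ?_
      rw [Matrix.mul_apply, ← hQj]
      rfl
  have hN : ∀ a b, HasDerivAt (fun t => (P * M t * Q) a b) ((P * M' * Q) a b) 0 := fun a b => by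
    simp only [Matrix.mul_apply]
    exact HasDerivAt.fun_sum fun k _ => HasDerivAt.mul_const
      (HasDerivAt.fun_sum fun m _ => (hM m k).const_mul _) _
  have hdet : HasDerivAt (fun t => (P * M t * Q).det) 0 0 := by
    simp only [Matrix.det_apply]
    have hterm : ∀ σ : Equiv.Perm (Fin n),
        HasDerivAt (fun t => Equiv.Perm.sign σ • ∏ k, (P * M t * Q) (σ k) k) 0 0 := fun σ => by
      have h4 := (HasDerivAt.fun_finsetProd (u := Finset.univ) (x := (0 : ℝ))
        (f := fun k t => (P * M t * Q) (σ k) k) fun k _ => hN (σ k) k).const_smul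
          (Equiv.Perm.sign σ)
      refine h4.congr_deriv ?_
      rw [Finset.sum_eq_zero, smul_zero]
      intro k _
      by_cases hk : k = j
      · subst hk
        by_cases hs : σ k = i
        · rw [hs, hcol, hPi, h3, smul_zero]
        · rw [Finset.prod_eq_zero (i := σ.symm i), zero_smul]
          · refine Finset.mem_erase.2 ⟨fun h => hs ?_, Finset.mem_univ _⟩
            rw [← h, Equiv.apply_symm_apply]
          · rw [Equiv.apply_symm_apply]
            exact hrow _
      · rw [Finset.prod_eq_zero (i := j), zero_smul]
        · exact Finset.mem_erase.2 ⟨Ne.symm hk, Finset.mem_univ _⟩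
        · rw [hcol, h1, dotProduct_zero]
    exact (HasDerivAt.fun_sum fun σ _ => hterm σ).congr_deriv (by simp)
  have heq : (fun t => (M t).det) = fun t => (l i * v j)⁻¹ * (P * M t * Q).det := by
    funext t
    rw [Matrix.det_mul, Matrix.det_mul, hPdet, hQdet]
    have hi' : l i ≠ 0 := hi
    have hj' : v j ≠ 0 := hj
    field_simp
  rw [heq]
  exact (hdet.const_mul _).congr_deriv (by simp)

/-- The row vector `(u - c, δ, 1, δ)`; the operator is `L v = -(massRow · (v, v', v'', v'''))'`. -/
def massRow (δ : ℝ) (u : ℝ → ℝ) (c x : ℝ) : Fin 4 → ℂ := ![((u x - c : ℝ) : ℂ), δ, 1, δ]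

/-- Since `L` is in divergence form, `L v = lam v` can be integrated once; `W` serves as
antiderivative of `v`. -/
lemma massRow_dotProduct_add_eq {δ : ℝ} (hδ : 0 < δ) {u : ℝ → ℝ} (hu : Differentiable ℝ u) {c : ℝ}
    {lam : ℂ} {V W : ℝ → Fin 4 → ℂ}
    (hV : ∀ x, HasDerivAt V ((kdvksMatrix δ u c lam x).mulVec (V x)) x)
    (hW : ∀ x, HasDerivAt W (V x) x) (x : ℝ) :
    massRow δ u c x ⬝ᵥ V x + lam * W x 0 = massRow δ u c 0 ⬝ᵥ V 0 + lam * W 0 0 := by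
  have hd : (δ : ℂ) ≠ 0 := by exact_mod_cast hδ.ne'
  have key : ∀ x, HasDerivAt (fun y => massRow δ u c y ⬝ᵥ V y + lam * W y 0) 0 x := fun x => by
    have hV' := hasDerivAt_pi.1 (hV x)
    have h0 := (((hu x).hasDerivAt.sub_const c).ofReal_comp).mul (hV' 0)
    have h1 := (((h0.add ((hV' 1).const_mul (δ : ℂ))).add (hV' 2)).add
      ((hV' 3).const_mul (δ : ℂ))).add ((hasDerivAt_pi.1 (hW x) 0).const_mul lam)
    have heq : (fun y => massRow δ u c y ⬝ᵥ V y + lam * W y 0) = fun y =>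
        ((u y - c : ℝ) : ℂ) * V y 0 + δ * V y 1 + V y 2 + δ * V y 3 + lam * W y 0 := by
      funext y
      simp [massRow, dotProduct, Fin.sum_univ_four]
    rw [heq]
    refine h1.congr_deriv ?_
    simp [kdvksMatrix, Matrix.mulVec, dotProduct, Fin.sum_univ_four]
    field_simp
    ring
  exact is_const_of_deriv_eq_zero (fun x => (key x).differentiableAt)
    (fun x => (key x).deriv) x 0

lemma iteratedDeriv_ofReal {f : ℝ → ℝ} (hf : ContDiff ℝ ∞ f) (k : ℕ) :
    iteratedDeriv k (fun x => ((f x : ℝ) : ℂ)) = fun x => ((iteratedDeriv k f x : ℝ) : ℂ) := by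
  induction k with
  | zero => simp
  | succ k ih =>
    rw [iteratedDeriv_succ, ih]
    funext x
    rw [iteratedDeriv_succ]
    exact ((hf.differentiable_iteratedDeriv k
      (by exact_mod_cast WithTop.coe_lt_top _) x).hasDerivAt.ofReal_comp).deriv

/-- Translation invariance: the differentiated profile equation. -/
lemma IsWaveFamily.linOp_deriv (hw : IsWaveFamily X δ₀ U c) {δ : ℝ} (hδ : δ ∈ Ico 0 δ₀) (x : ℝ) :
    linOp δ (U δ) (c δ) (fun y => ((deriv (U δ) y : ℝ) : ℂ)) x = 0 := by
  have hU := hw.contDiff_profile hδ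
  have hU' : ContDiff ℝ ∞ (deriv (U δ)) := (contDiff_infty_iff_deriv.1 hU).2
  have hd : ∀ k x, HasDerivAt (fun y => ((iteratedDeriv k (U δ) y : ℝ) : ℂ))
      ((iteratedDeriv (k + 1) (U δ) x : ℝ) : ℂ) x := fun k x => by
    rw [iteratedDeriv_succ]
    exact (hU.differentiable_iteratedDeriv k
      (by exact_mod_cast WithTop.coe_lt_top _) x).hasDerivAt.ofReal_comp
  have h1 : HasDerivAt (fun y => ((U δ y - c δ : ℝ) : ℂ) * ((deriv (U δ) y : ℝ) : ℂ))
      (((deriv (U δ) x : ℝ) : ℂ) * ((deriv (U δ) x : ℝ) : ℂ)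
        + ((U δ x - c δ : ℝ) : ℂ) * ((iteratedDeriv 2 (U δ) x : ℝ) : ℂ)) x := by
    have h2 := hd 1 x
    rw [iteratedDeriv_one] at h2
    exact (((hU.differentiable (by simp) x).hasDerivAt.sub_const (c δ)).ofReal_comp).mul h2
  have h3 := (h1.add (hd 3 x)).add (((hd 2 x).add (hd 4 x)).const_mul (δ : ℂ))
  have h4 := h3.congr_of_eventuallyEq (f₁ := fun _ => 0) (Eventually.of_forall fun y => by
    have := hw.profile_eq δ hδ y
    simp only [Pi.add_apply]
    exact_mod_cast this.symm)
  have h5 := h4.unique (hasDerivAt_const x (0 : ℂ))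
  rw [linOp, h1.deriv, iteratedDeriv_ofReal hU', iteratedDeriv_ofReal hU', iteratedDeriv_ofReal hU']
  simp only [← iteratedDeriv_succ']
  linear_combination -h5

/-- The pairing is the left side of the profile equation at `x = 0`. -/
lemma IsWaveFamily.massRow_dotProduct_jet (hw : IsWaveFamily X δ₀ U c) {δ : ℝ}
    (hδ : δ ∈ Ico 0 δ₀) : massRow δ (U δ) (c δ) 0 ⬝ᵥ jet (fun y => ((deriv (U δ) y : ℝ) : ℂ)) 0
      = 0 := by
  have hU' : ContDiff ℝ ∞ (deriv (U δ)) := (contDiff_infty_iff_deriv.1 (hw.contDiff_profile hδ)).2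
  have h1 := hw.profile_eq δ hδ 0
  have h2 := congrFun (iteratedDeriv_ofReal hU' 1) 0
  rw [iteratedDeriv_one] at h2
  simp only [massRow, jet, dotProduct, Fin.sum_univ_four]
  rw [h2, iteratedDeriv_ofReal hU', iteratedDeriv_ofReal hU']
  simp only [← iteratedDeriv_succ']
  have h3 : (((U δ 0 - c δ) * deriv (U δ) 0 + iteratedDeriv 3 (U δ) 0
      + δ * (iteratedDeriv 2 (U δ) 0 + iteratedDeriv 4 (U δ) 0) : ℝ) : ℂ) = 0 := by
    rw [h1, Complex.ofReal_zero]
  push_cast at h3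
  simp
  linear_combination h3

/-- At `lam = 0` the jet of `U'` and the mass row are right and left kernel vectors of the monodromy
matrix minus the identity. To first order, the `ξ`-direction contributes their pairing, which
vanishes, and the `lam`-direction contributes `-∫₀ˣ U'` at `x = X`, which vanishes by periodicity.
So every directional derivative of the determinant is zero. -/
theorem IsWaveFamily.evans_double_zero (hw : IsWaveFamily X δ₀ U c) {δ : ℝ} (hδ : δ ∈ Ico 0 δ₀)
    (hδ0 : 0 < δ) (hne : ∃ x y, U δ x ≠ U δ y) : evans X δ (U δ) (c δ) 0 0 = 0 ∧
      ∀ (σ : ℝ) (z : ℂ),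
        HasDerivAt (fun t : ℝ => evans X δ (U δ) (c δ) (t * z) (t * σ)) 0 0 := by
  have hX := hw.period_pos
  have hU := hw.contDiff_profile hδ
  have hUd : Differentiable ℝ (U δ) := hU.differentiable (by simp)
  have hU' : ContDiff ℝ ∞ (deriv (U δ)) := (contDiff_infty_iff_deriv.1 hU).2
  set v : ℝ → ℂ := fun y => ((deriv (U δ) y : ℝ) : ℂ) with hv
  have hv4 : ContDiff ℝ 4 v :=
    Complex.ofRealCLM.contDiff.comp ((contDiff_infty.1 hU') 4)
  have hjet := hasDerivAt_jet hδ0 hUd hv4 (lam := 0) (c := c δ) fun x => by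
    rw [zero_mul]; exact hw.linOp_deriv hδ x
  set A := kdvksMatrix δ (U δ) (c δ) with hAdef
  have hA : ∀ l i j, Continuous fun x => A l x i j := fun l => hw.continuous_kdvksMatrix hδ l
  set R : ℂ → ℝ → Matrix (Fin 4) (Fin 4) ℂ := fun l => principalSolution (A l) with hRdef
  have hR : ∀ l, IsPrincipalSolution (A l) (R l) := fun l =>
    isPrincipalSolution_principalSolution (hA l)
  have hsol := solution_eq_mulVec (hA 0) (hR 0) hjet
  have hperU : ∀ k x, iteratedDeriv k v (x + X) = iteratedDeriv k v x := fun k x => by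
    have h1 : iteratedDeriv k (fun x => v (x + X)) x = iteratedDeriv k v x := by
      congr 1
      funext y
      have h2 : deriv (fun y => U δ (y + X)) y = deriv (U δ) y := by
        rw [funext (hw.periodic δ hδ)]
      rw [deriv_comp_add_const] at h2
      simp only [hv, h2]
    rw [iteratedDeriv_comp_add_const] at h1
    exact h1
  have hjX : jet v X = jet v 0 := by
    have h1 : ∀ k, iteratedDeriv k v X = iteratedDeriv k v 0 := fun k => by
      have := hperU k 0
      rwa [zero_add] at this
    have h10 := h1 0
    have h11 := h1 1
    rw [iteratedDeriv_zero] at h10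
    rw [iteratedDeriv_one] at h11
    simp only [jet, h10, h11, h1]
  have hj0 : jet v 0 ≠ 0 := fun h0 => by
    obtain ⟨x, y, hxy⟩ := hne
    refine hxy (is_const_of_deriv_eq_zero hUd (fun x => ?_) x y)
    have h1 := congrFun (hsol x) 0
    rw [h0, Matrix.mulVec_zero] at h1
    have h2 : ((deriv (U δ) x : ℝ) : ℂ) = 0 := h1
    exact_mod_cast h2
  set l := massRow δ (U δ) (c δ) 0 with hl
  have hlX : massRow δ (U δ) (c δ) X = l := by
    have := hw.periodic δ hδ 0
    rw [zero_add] at this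
    simp only [hl, massRow, this]
  have hl0 : l ≠ 0 := fun h => by
    have := congrFun h 2
    simp [hl, massRow] at this
  set V : (Fin 4 → ℂ) → ℂ → ℝ → Fin 4 → ℂ := fun y lam x => (R lam x).mulVec y with hVdef
  have hV : ∀ y lam x, HasDerivAt (V y lam) ((A lam x).mulVec (V y lam x)) x := fun y lam x =>
    hasDerivAt_mulVec_iff ((hR lam).2 x) y
  have hVc : ∀ y lam, Continuous (V y lam) := fun y lam =>
    continuous_iff_continuousAt.2 fun x => (hV y lam x).continuousAt
  have hV0 : ∀ y lam, V y lam 0 = y := fun y lam => by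
    simp only [hVdef]; rw [(hR lam).1, Matrix.one_mulVec]
  set W : (Fin 4 → ℂ) → ℂ → ℝ → Fin 4 → ℂ := fun y lam x => ∫ s in (0 : ℝ)..x, V y lam s
  have hW : ∀ y lam x, HasDerivAt (W y lam) (V y lam x) x := fun y lam x =>
    intervalIntegral.integral_hasDerivAt_right ((hVc y lam).intervalIntegrable _ _)
      ((hVc y lam).stronglyMeasurableAtFilter _ _) (hVc y lam).continuousAt
  have hW0 : ∀ y lam, W y lam 0 = 0 := fun y lam => intervalIntegral.integral_same
  have hmass : ∀ y lam, l ⬝ᵥ (R lam X).mulVec y + lam * W y lam X 0 = l ⬝ᵥ y := fun y lam => by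
    have := massRow_dotProduct_add_eq hδ0 hUd (hV y lam) (hW y lam) X
    rw [hlX, hV0, hW0] at this
    simpa using this
  have hleft : Matrix.vecMul l (R 0 X) = l := by
    refine dotProduct_eq _ _ fun y => ?_
    rw [← Matrix.dotProduct_mulVec]
    simpa using hmass y 0
  have hright : (R 0 X).mulVec (jet v 0) = jet v 0 := by rw [← hsol X, hjX]
  -- The first component of `W` is a primitive of `U'`, so its value at `X` is `U(X) - U(0)`.
  have hWX : W (jet v 0) 0 X 0 = 0 := by
    have h1 : ∀ x, HasDerivAt (fun y => W (jet v 0) 0 y 0 - ((U δ y : ℝ) : ℂ)) 0 x := fun x => by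
      have h2 : V (jet v 0) 0 x 0 = v x := by
        simp only [hVdef]; rw [← hsol x]; rfl
      refine ((hasDerivAt_pi.1 (hW (jet v 0) 0 x) 0).sub
        ((hUd x).hasDerivAt.ofReal_comp)).congr_deriv ?_
      rw [h2, hv, sub_self]
    have h3 := is_const_of_deriv_eq_zero (fun x => (h1 x).differentiableAt)
      (fun x => (h1 x).deriv) X 0
    have h4 := hw.periodic δ hδ 0
    rw [zero_add] at h4
    simp only [hW0, h4] at h3
    simpa using h3
  -- Continuity in `lam` is enough: the pairing differentiated below is `t` times a continuous
  -- function of `t`.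
  have hWc : Continuous fun lam => W (jet v 0) lam X 0 := by
    have h1 := contDiff_solution hX.le hA (hw.contDiff_restr_kdvksMatrix hδ) (hVc (jet v 0))
      (hV (jet v 0)) (hV0 (jet v 0))
    have h2 : (fun lam => W (jet v 0) lam X 0) = fun lam =>
        conv ℂ (Fin 4 → ℂ) hX.le 1 (restr X (V (jet v 0) lam) (hVc _ lam)) ⟨X, hX.le, le_rfl⟩ 0 := by
      funext lam
      rw [conv_one_eq_sub (𝕜 := ℂ) hX.le (continuous_iff_continuousAt.2 fun x =>
        (hW (jet v 0) lam x).continuousAt) fun x => hW (jet v 0) lam x]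
      simp [hW0]
    rw [h2]
    have h3 : Continuous fun lam =>
        conv ℂ (Fin 4 → ℂ) hX.le 1 (restr X (V (jet v 0) lam) (hVc _ lam)) :=
      (conv ℂ (Fin 4 → ℂ) hX.le 1).continuous.comp h1.continuous
    exact (continuous_apply (0 : Fin 4)).comp
      ((continuous_eval_const (⟨X, hX.le, le_rfl⟩ : Icc 0 X)).comp h3)
  have hlj : l ⬝ᵥ jet v 0 = 0 := hw.massRow_dotProduct_jet hδ
  constructor
  · rw [evans, ← Matrix.exists_mulVec_eq_zero_iff]
    refine ⟨jet v 0, hj0, ?_⟩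
    rw [Matrix.sub_mulVec]
    change (R 0 X).mulVec (jet v 0) - _ = 0
    rw [hright]
    simp
  · intro σ z
    set M : ℝ → Matrix (Fin 4) (Fin 4) ℂ := fun t =>
      R (t * z) X - Complex.exp (Complex.I * ((t * σ : ℝ) : ℂ) * X) • 1 with hM
    have hMd : ∀ i j, DifferentiableAt ℝ (fun t => M t i j) 0 := fun i j => by
      have h1 : DifferentiableAt ℝ (fun t : ℝ => R (t * z) X i j) 0 :=
        ((hw.differentiable_kdvks hδ i j).restrictScalars ℝ).differentiableAt.comp (0 : ℝ)
          (f := fun t : ℝ => (t : ℂ) * z)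
          (Complex.ofRealCLM.differentiableAt.mul_const z)
      have h2 : DifferentiableAt ℝ
          (fun t : ℝ => Complex.exp (Complex.I * ((t * σ : ℝ) : ℂ) * X)) 0 := by
        have h3 : ContDiff ℝ 1 fun t : ℝ => Complex.exp (Complex.I * ((t * σ : ℝ) : ℂ) * X) :=
          ((contDiff_const.mul (Complex.ofRealCLM.contDiff.comp
            (contDiff_id.mul contDiff_const))).mul contDiff_const).cexp
        exact h3.differentiable one_ne_zero 0
      exact h1.sub (h2.mul_const _)
    have hM0 : M 0 = R 0 X - 1 := by simp [hM]
    refine hasDerivAt_det_zero (M := M) (M' := fun i j => deriv (fun t => M t i j) 0)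
      (fun i j => (hMd i j).hasDerivAt) hl0 hj0 ?_ ?_ ?_
    · rw [hM0, Matrix.sub_mulVec, hright, Matrix.one_mulVec, sub_self]
    · rw [hM0, Matrix.vecMul_sub, hleft, Matrix.vecMul_one, sub_self]
    · have h1 : HasDerivAt (fun t => l ⬝ᵥ (M t).mulVec (jet v 0))
          (l ⬝ᵥ Matrix.mulVec (fun i j => deriv (fun t => M t i j) 0) (jet v 0)) 0 := by
        simp only [dotProduct, Matrix.mulVec]
        exact HasDerivAt.fun_sum fun i _ => HasDerivAt.const_mul _
          (HasDerivAt.fun_sum fun j _ => (hMd i j).hasDerivAt.mul_const _)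
      have h2 : ∀ t ∈ (univ : Set ℝ), l ⬝ᵥ (M t).mulVec (jet v 0)
          = t • (-z * W (jet v 0) (t * z) X 0) := fun t _ => by
        simp only [hM]
        rw [Matrix.sub_mulVec, dotProduct_sub, Matrix.smul_mulVec, Matrix.one_mulVec,
          dotProduct_smul, hlj, smul_zero, sub_zero]
        have := hmass (jet v 0) (t * z)
        rw [hlj] at this
        rw [Complex.real_smul]
        linear_combination this
      have h3 : HasDerivWithinAt (fun t => l ⬝ᵥ (M t).mulVec (jet v 0)) _ univ 0 :=
        hasDerivWithinAt_of_eq_smul (mem_univ 0) h2 (Continuous.continuousWithinAt (by fun_prop))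
      have h4 := h1.unique (hasDerivWithinAt_univ.1 h3)
      rw [h4]
      simp [hWX]

/-- Only `U 0` is assumed nonconstant; two separating points persist for small `δ`, which keeps `U'`
a nonzero kernel vector. -/
lemma IsWaveFamily.exists_nonconstant (hw : IsWaveFamily X δ₀ U c) :
    ∃ δ₁, 0 < δ₁ ∧ δ₁ ≤ δ₀ ∧ ∀ δ ∈ Ico 0 δ₁, ∃ x y, U δ x ≠ U δ y := by
  obtain ⟨x, y, hxy⟩ := hw.nonconstant
  have h0 : (0 : ℝ) ∈ Ico 0 δ₀ := ⟨le_rfl, hw.delta_pos⟩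
  have hc : ∀ x, ContinuousOn (fun δ => U δ x) (Ico 0 δ₀) := fun x =>
    hw.smooth_profile.continuousOn.comp (f := fun δ : ℝ => (δ, x)) (by fun_prop)
      fun δ hδ => ⟨hδ, mem_univ _⟩
  have h1 : ∀ᶠ δ in 𝓝[Ico 0 δ₀] 0, U δ x - U δ y ≠ 0 :=
    ((hc x 0 h0).sub (hc y 0 h0)).eventually_ne (sub_ne_zero.2 hxy)
  rw [nhdsWithin_Ico_eq_nhdsGE hw.delta_pos] at h1
  obtain ⟨u, hu, hsub⟩ := (mem_nhdsGE_iff_exists_Ico_subset).1 h1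
  have hu' : 0 < u := hu
  exact ⟨min u δ₀, lt_min hu' hw.delta_pos, min_le_right _ _, fun δ hδ =>
    ⟨x, y, sub_ne_zero.1 (hsub ⟨hδ.1, hδ.2.trans_le (min_le_left _ _)⟩)⟩⟩

theorem IsWaveFamily.evansExt_double_zero (hw : IsWaveFamily X δ₀ U c) {δ : ℝ}
    (hδ : δ ∈ Ico 0 δ₀) (hδ0 : 0 < δ) (hne : ∃ x y, U δ x ≠ U δ y) :
    evansExt X U c ((δ, 0), 0) = 0 ∧ ∀ (σ : ℝ) (z : ℂ),
      HasDerivAt (fun t : ℝ => evansExt X U c ((δ, t * σ), t * z)) 0 0 := by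
  obtain ⟨h1, h2⟩ := hw.evans_double_zero hδ hδ0 hne
  simp only [evansExt, hδ0, if_true]
  refine ⟨by simp [h1], fun σ z => ?_⟩
  have h3 : ContDiff ℝ 1 fun t : ℝ => -Complex.exp (-(Complex.I * ((t * σ : ℝ) : ℂ) * X)) :=
    ((contDiff_const.mul (Complex.ofRealCLM.contDiff.comp
      (contDiff_id.mul contDiff_const))).mul contDiff_const).neg.cexp.neg
  refine ((h3.differentiable one_ne_zero 0).hasDerivAt.mul (h2 σ z)).congr_deriv ?_
  simp [h1]

end DoubleZero

end

end KdVKS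

namespace KdVKS

noncomputable section

set_option linter.unusedSectionVars false

open Set Filter Topology

/-! ### Division of smooth functions -/

section Division

variable {P : Type} [NormedAddCommGroup P] [NormedSpace ℝ P] {S : Set P}
  {E : Type} [NormedAddCommGroup E] [NormedSpace ℝ E]

theorem exists_contDiffOn_fst [CompleteSpace E] {I : Set ℝ} (hI : Convex ℝ I)
    (hIu : UniqueDiffOn ℝ I) (h0 : (0 : ℝ) ∈ I) (hS : Convex ℝ S) (hSu : UniqueDiffOn ℝ S)
    {f : ℝ × P → E} (hf : ContDiffOn ℝ ∞ f (I ×ˢ S)) :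
    ∃ g : ℝ × P → E, ContDiffOn ℝ ∞ g (I ×ˢ S) ∧
      ∀ s ∈ I, ∀ p ∈ S, f (s, p) = f (0, p) + s • g (s, p) := by
  have h1 : ContDiffOn ℝ ∞ (fun x : ℝ × P => f (0, x.2)) (I ×ˢ S) :=
    hf.comp (f := fun x : ℝ × P => ((0 : ℝ), x.2)) (by fun_prop) fun x hx => ⟨h0, hx.2⟩
  obtain ⟨g, hg, hfg⟩ := exists_contDiffOn_eq_smul hI hIu h0 hS hSu (hf.sub h1)
    fun p _ => sub_self _
  exact ⟨g, hg, fun s hs p hp => by rw [← hfg s hs p hp]; abel⟩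

theorem exists_contDiffOn_snd [CompleteSpace E] {I : Set ℝ} (hI : Convex ℝ I)
    (hIu : UniqueDiffOn ℝ I) (h0 : (0 : ℝ) ∈ I) (hS : Convex ℝ S) (hSu : UniqueDiffOn ℝ S)
    {f : P × ℝ → E} (hf : ContDiffOn ℝ ∞ f (S ×ˢ I)) :
    ∃ g : P × ℝ → E, ContDiffOn ℝ ∞ g (S ×ˢ I) ∧
      ∀ p ∈ S, ∀ s ∈ I, f (p, s) = f (p, 0) + s • g (p, s) := by
  have h1 : ContDiffOn ℝ ∞ (fun x : ℝ × P => f (x.2, x.1)) (I ×ˢ S) :=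
    hf.comp (f := fun x : ℝ × P => (x.2, x.1)) (by fun_prop) fun x hx => ⟨hx.2, hx.1⟩
  obtain ⟨g, hg, hfg⟩ := exists_contDiffOn_fst hI hIu h0 hS hSu h1
  exact ⟨fun x => g (x.2, x.1), hg.comp (f := fun x : P × ℝ => (x.2, x.1)) (by fun_prop)
    fun x hx => ⟨hx.2, hx.1⟩, fun p hp s hs => hfg s hs p hp⟩

/-- Hadamard's lemma in the complex variable. Away from `0` the quotient is holomorphic; at `0` the
integral formula gives continuity, and the singularity is removable. -/
theorem exists_contDiffOn_complex {f : P × ℂ → ℂ} (hS : Convex ℝ S) (hSu : UniqueDiffOn ℝ S)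
    (hf : ContDiffOn ℝ ∞ f (S ×ˢ univ)) (hd : ∀ p ∈ S, Differentiable ℂ fun z => f (p, z)) :
    ∃ g : P × ℂ → ℂ, ContDiffOn ℝ ∞ g (S ×ˢ univ) ∧
      (∀ p ∈ S, Differentiable ℂ fun z => g (p, z)) ∧
      ∀ p ∈ S, ∀ z, f (p, z) = f (p, 0) + z * g (p, z) := by
  have h1 := contDiffOn_deriv_right hSu hf hd
  have h2 : ContDiffOn ℝ ∞ (fun y : (P × ℂ) × ℝ =>
      deriv (fun z => f (y.1.1, z)) ((y.2 : ℂ) * y.1.2)) ((S ×ˢ univ) ×ˢ Icc 0 1) := by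
    have h3 : ContDiff ℝ ∞ fun y : (P × ℂ) × ℝ => (y.1.1, (y.2 : ℂ) * y.1.2) :=
      (contDiff_fst.comp contDiff_fst).prodMk
        ((Complex.ofRealCLM.contDiff.comp contDiff_snd).mul (contDiff_snd.comp contDiff_fst))
    exact h1.comp (f := fun y : (P × ℂ) × ℝ => (y.1.1, (y.2 : ℂ) * y.1.2)) h3.contDiffOn
      fun y hy => ⟨hy.1.1, mem_univ _⟩
  have h4 := contDiffOn_integral (hS.prod convex_univ) (hSu.prod uniqueDiffOn_univ) one_pos h2
  have heq : ∀ p ∈ S, ∀ z : ℂ, f (p, z)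
      = f (p, 0) + z * ∫ t in (0 : ℝ)..1, deriv (fun z => f (p, z)) ((t : ℂ) * z) := by
    intro p hp z
    have h5 : ∀ t : ℝ, HasDerivAt (fun t : ℝ => f (p, (t : ℂ) * z))
        (z * deriv (fun z => f (p, z)) ((t : ℂ) * z)) t := fun t => by
      have h6 : HasDerivAt (fun t : ℝ => (t : ℂ) * z) z t := by
        simpa using (Complex.ofRealCLM.hasDerivAt (x := t)).mul_const z
      have h7 := ((hd p hp) ((t : ℂ) * z)).hasDerivAt.comp t h6
      exact h7.congr_deriv (mul_comm _ _)
    have h8 : Continuous fun t : ℝ => z * deriv (fun z => f (p, z)) ((t : ℂ) * z) :=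
      continuous_const.mul (((hd p hp).contDiff (n := 1)).continuous_deriv le_rfl |>.comp
        (by fun_prop))
    have h9 := intervalIntegral.integral_eq_sub_of_hasDerivAt (a := 0) (b := 1)
      (fun t _ => h5 t) (h8.intervalIntegrable _ _)
    rw [intervalIntegral.integral_const_mul] at h9
    rw [h9]
    simp
  refine ⟨_, h4, fun p hp => ?_, heq⟩
  set g : ℂ → ℂ := fun z => ∫ t in (0 : ℝ)..1, deriv (fun z => f (p, z)) ((t : ℂ) * z)
  have hgc : Continuous g :=
    h4.continuousOn.comp_continuous (f := fun z : ℂ => (p, z)) (by fun_prop)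
      fun z => ⟨hp, mem_univ _⟩
  rw [← differentiableOn_univ,
    ← Complex.differentiableOn_compl_singleton_and_continuousAt_iff (c := 0) univ_mem]
  refine ⟨?_, hgc.continuousAt⟩
  have h10 : DifferentiableOn ℂ (fun z => (f (p, z) - f (p, 0)) / z) (univ \ {0}) :=
    ((hd p hp).differentiableOn.sub_const _).div differentiableOn_id fun z hz => hz.2
  refine h10.congr fun z hz => ?_
  have hz0 : z ≠ 0 := hz.2
  rw [heq p hp z, eq_div_iff hz0]
  ring

lemma eq_zero_of_forall_Ioo [T2Space E] {f : ℝ → E} {a : ℝ} (ha : 0 < a)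
    (hf : ContinuousOn f (Ico 0 a)) (h : ∀ x ∈ Ioo 0 a, f x = 0) : f 0 = 0 := by
  have h1 : Tendsto f (𝓝[>] 0) (𝓝 (f 0)) :=
    ((hf 0 ⟨le_rfl, ha⟩).mono_left (by
      rw [nhdsWithin_Ico_eq_nhdsGE ha]
      exact nhdsWithin_mono _ Ioi_subset_Ici_self))
  refine tendsto_nhds_unique h1 (tendsto_const_nhds.congr' ?_)
  filter_upwards [Ioo_mem_nhdsGT ha] with x hx
  exact (h x hx).symm

/-- The Cauchy-Riemann equations pass to the limit `δ → 0` by continuity of the real derivative.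
This is needed for quotients by `δ`, whose values at `δ = 0` are not given by a formula holomorphic
in `z`. -/
theorem differentiable_of_forall_Ioo {a : ℝ} (ha : 0 < a) {f : (ℝ × ℝ) × ℂ → ℂ}
    (hf : ContDiffOn ℝ ∞ f ((Ico 0 a ×ˢ univ) ×ˢ univ))
    (hd : ∀ δ ∈ Ioo 0 a, ∀ ξ, Differentiable ℂ fun z => f ((δ, ξ), z)) {p : ℝ × ℝ}
    (hp : p ∈ Ico 0 a ×ˢ (univ : Set ℝ)) : Differentiable ℂ fun z => f (p, z) := by
  obtain ⟨δ, ξ⟩ := p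
  rcases hp.1.1.lt_or_eq with h | h
  · exact hd δ ⟨h, hp.1.2⟩ ξ
  have h' : δ = 0 := h.symm
  subst h'
  have hu : UniqueDiffOn ℝ ((Ico 0 a ×ˢ univ) ×ˢ univ : Set ((ℝ × ℝ) × ℂ)) :=
    ((uniqueDiffOn_Ico 0 a).prod uniqueDiffOn_univ).prod uniqueDiffOn_univ
  set D : (ℝ × ℝ) × ℂ → ((ℝ × ℝ) × ℂ →L[ℝ] ℂ) :=
    fderivWithin ℝ f ((Ico 0 a ×ˢ univ) ×ˢ univ) with hD
  have hDc : ContinuousOn D ((Ico 0 a ×ˢ univ) ×ˢ univ) :=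
    hf.continuousOn_fderivWithin hu (by simp)
  intro z
  have key : ∀ δ ∈ Ico 0 a, HasFDerivAt (fun z => f ((δ, ξ), z))
      ((D ((δ, ξ), z)).comp (ContinuousLinearMap.inr ℝ (ℝ × ℝ) ℂ)) z := fun δ hδ =>
    hasFDerivAt_right hf ⟨hδ, mem_univ _⟩ z
  have hcr : D ((0, ξ), z) (0, Complex.I) - Complex.I * D ((0, ξ), z) (0, 1) = 0 := by
    refine eq_zero_of_forall_Ioo (f := fun δ =>
      D ((δ, ξ), z) (0, Complex.I) - Complex.I * D ((δ, ξ), z) (0, 1)) ha ?_ fun δ hδ => ?_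
    · have h1 : ContinuousOn (fun δ : ℝ => D ((δ, ξ), z)) (Ico 0 a) :=
        hDc.comp (f := fun δ : ℝ => ((δ, ξ), z)) (by fun_prop) fun δ hδ =>
          ⟨⟨hδ, mem_univ _⟩, mem_univ _⟩
      exact (h1.clm_apply continuousOn_const).sub
        (continuousOn_const.mul (h1.clm_apply continuousOn_const))
    · have h2 := (differentiableAt_complex_iff_differentiableAt_real.1 (hd δ hδ ξ z)).2
      rw [(key δ ⟨hδ.1.le, hδ.2⟩).fderiv] at h2
      simp only [ContinuousLinearMap.comp_apply, ContinuousLinearMap.inr_apply, smul_eq_mul] at h2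
      rw [h2, sub_self]
  refine differentiableAt_complex_iff_differentiableAt_real.2
    ⟨(key 0 hp.1).differentiableAt, ?_⟩
  rw [(key 0 hp.1).fderiv]
  simpa using sub_eq_zero.1 hcr

lemma iteratedDeriv_pow_smul {𝕜 F : Type} [NontriviallyNormedField 𝕜] [NormedAddCommGroup F]
    [NormedSpace 𝕜 F] {q : 𝕜 → F} (hq : ContDiff 𝕜 ∞ q) (k : ℕ) :
    iteratedDeriv k (fun z => z ^ k • q z) 0 = (k.factorial : 𝕜) • q 0 := by
  induction k generalizing q with
  | zero => simp
  | succ k ih =>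
    have hq' : ContDiff 𝕜 ∞ (deriv q) := (contDiff_infty_iff_deriv.1 hq).2
    have h1 : deriv (fun z => z ^ (k + 1) • q z)
        = fun z => z ^ k • (((k + 1 : ℕ) : 𝕜) • q z + z • deriv q z) := by
      funext z
      have h3 : HasDerivAt (fun z => z ^ (k + 1) • q z) _ z :=
        (hasDerivAt_pow (k + 1) z).smul (hq.differentiable (by simp) z).hasDerivAt
      rw [h3.deriv]
      simp only [Nat.add_sub_cancel]
      module
    rw [iteratedDeriv_succ', h1, ih (q := fun z => ((k + 1 : ℕ) : 𝕜) • q z + z • deriv q z)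
      ((contDiff_const.smul hq).add (contDiff_id.smul hq')), zero_smul, add_zero, smul_smul,
      Nat.factorial_succ, Nat.cast_mul, mul_comm]

end Division

end

end KdVKS

namespace KdVKS

noncomputable section

set_option linter.unusedSectionVars false

open Set Filter Topology

/-! ### The normal form of the Evans function at the origin -/

/-- A decomposition of `E ((δ, ξ), lam)` into `E ((0, ξ), lam)`, which vanishes to third order at
the origin, and a multiple of `δ` that vanishes to second order. -/
structure NormalForm (δ₁ : ℝ) (E : (ℝ × ℝ) × ℂ → ℂ) where
  pos : 0 < δ₁
  p₀ : ℝ → ℂ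
  p₁ : ℝ → ℂ
  p₂ : ℝ → ℂ
  p₃ : ℝ × ℂ → ℂ
  q₀ : ℝ × ℝ → ℂ
  q₁ : ℝ × ℝ → ℂ
  q₂ : (ℝ × ℝ) × ℂ → ℂ
  smooth_p₀ : ContDiff ℝ ∞ p₀
  smooth_p₁ : ContDiff ℝ ∞ p₁
  smooth_p₂ : ContDiff ℝ ∞ p₂
  smooth_p₃ : ContDiff ℝ ∞ p₃
  holo_p₃ : ∀ ξ, Differentiable ℂ fun z => p₃ (ξ, z)
  smooth_q₀ : ContDiffOn ℝ ∞ q₀ (Ico 0 δ₁ ×ˢ univ)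
  smooth_q₁ : ContDiffOn ℝ ∞ q₁ (Ico 0 δ₁ ×ˢ univ)
  smooth_q₂ : ContDiffOn ℝ ∞ q₂ ((Ico 0 δ₁ ×ˢ univ) ×ˢ univ)
  holo_q₂ : ∀ p ∈ Ico 0 δ₁ ×ˢ (univ : Set ℝ), Differentiable ℂ fun z => q₂ (p, z)
  eq : ∀ δ ∈ Ico 0 δ₁, ∀ (ξ : ℝ) (z : ℂ), E ((δ, ξ), z) =
    ξ ^ 3 * p₀ ξ + ξ ^ 2 * z * p₁ ξ + ξ * z ^ 2 * p₂ ξ + z ^ 3 * p₃ (ξ, z)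
      + δ * (ξ ^ 2 * q₀ (δ, ξ) + ξ * z * q₁ (δ, ξ) + z ^ 2 * q₂ ((δ, ξ), z))

lemma quadratic_eq_zero {c₀ c₁ c₂ : ℂ} {w : Fin 3 → ℂ} (hw : Function.Injective w)
    (h : ∀ j, c₀ + c₁ * w j + c₂ * w j ^ 2 = 0) : c₀ = 0 ∧ c₁ = 0 ∧ c₂ = 0 := by
  have h01 : w 0 - w 1 ≠ 0 := sub_ne_zero.2 fun h => by simpa using hw h
  have h02 : w 0 - w 2 ≠ 0 := sub_ne_zero.2 fun h => by simpa using hw h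
  have h12 : w 1 - w 2 ≠ 0 := sub_ne_zero.2 fun h => by simpa using hw h
  have e1 : c₁ + c₂ * (w 0 + w 1) = 0 := by
    refine (mul_eq_zero.1 (?_ : (w 0 - w 1) * (c₁ + c₂ * (w 0 + w 1)) = 0)).resolve_left h01
    linear_combination h 0 - h 1
  have e2 : c₁ + c₂ * (w 0 + w 2) = 0 := by
    refine (mul_eq_zero.1 (?_ : (w 0 - w 2) * (c₁ + c₂ * (w 0 + w 2)) = 0)).resolve_left h02
    linear_combination h 0 - h 2
  have e3 : c₂ = 0 := by
    refine (mul_eq_zero.1 (?_ : (w 1 - w 2) * c₂ = 0)).resolve_left h12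
    linear_combination e1 - e2
  subst e3
  have e4 : c₁ = 0 := by simpa using e1
  subst e4
  exact ⟨by simpa using h 0, rfl, rfl⟩

/-- After subtraction of `c₃ ∏ (z - w_j)` a quadratic with three distinct zeros is left. -/
lemma cubic_eq {c₀ c₁ c₂ c₃ : ℂ} {w : Fin 3 → ℂ} (hw : Function.Injective w)
    (h : ∀ j, c₀ + c₁ * w j + c₂ * w j ^ 2 + c₃ * w j ^ 3 = 0) (σ z : ℂ) :
    σ ^ 3 * c₀ + σ ^ 2 * z * c₁ + σ * z ^ 2 * c₂ + z ^ 3 * c₃ = c₃ * ∏ j, (z - w j * σ) := by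
  obtain ⟨h0, h1, h2⟩ := quadratic_eq_zero (c₀ := c₀ + c₃ * (w 0 * w 1 * w 2))
    (c₁ := c₁ - c₃ * (w 0 * w 1 + w 0 * w 2 + w 1 * w 2)) (c₂ := c₂ + c₃ * (w 0 + w 1 + w 2))
    hw fun j => by
      have hj := h j
      have hp : (w j - w 0) * (w j - w 1) * (w j - w 2) = 0 := by fin_cases j <;> simp
      linear_combination hj - c₃ * hp
  rw [Fin.prod_univ_three]
  linear_combination σ ^ 3 * h0 + σ ^ 2 * z * h1 + σ * z ^ 2 * h2

section EvansNormalForm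

variable {X δ₀ : ℝ} {U : ℝ → ℝ → ℝ} {c : ℝ → ℝ}

/-- Along the curve of roots the factor `ξ^k` cancels for `ξ ≠ 0`, and then `ξ → 0`. It is used with
`k = 2` for the quadratic part and with `k = 3` for the cubic part. -/
lemma IsKdVCharacteristic.eq_zero {u : ℝ → ℝ} {c a : ℝ} (ha : IsKdVCharacteristic X u c a) {k : ℕ}
    {h : ℝ × ℂ → ℂ} (hc : ContinuousAt h (0, (a : ℂ)))
    (heq : ∀ (ξ : ℝ) (b : ℂ), evansKdV X u c (Complex.I * b * ξ) ξ = (ξ : ℂ) ^ k * h (ξ, b)) :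
    h (0, (a : ℂ)) = 0 := by
  obtain ⟨A, hA, hz⟩ := ha
  have h1 : Tendsto (fun ξ : ℝ => (ξ, A ξ)) (𝓝[≠] 0) (𝓝 (0, (a : ℂ))) :=
    (tendsto_id.mono_left nhdsWithin_le_nhds).prodMk_nhds hA
  refine tendsto_nhds_unique (hc.tendsto.comp h1) (tendsto_const_nhds.congr' ?_)
  filter_upwards [hz, self_mem_nhdsWithin] with ξ h2 h3
  have h4 : (ξ : ℂ) ^ k ≠ 0 := pow_ne_zero _ (by exact_mod_cast h3)
  rw [heq, mul_eq_zero, or_iff_right h4] at h2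
  exact h2.symm

lemma evansExt_zero (ξ : ℝ) (z : ℂ) : evansExt X U c ((0, ξ), z) = evansKdV X (U 0) (c 0) z ξ := by
  simp [evansExt]

/-- Value and first derivatives at the origin vanish for `δ > 0` by the double zero, and for `δ = 0`
by continuity; successive divisions then extract the quadratic factors. -/
theorem IsWaveFamily.exists_quadratic_form (hw : IsWaveFamily X δ₀ U c) :
    ∃ δ₁, 0 < δ₁ ∧ δ₁ ≤ δ₀ ∧ ∃ (a b : ℝ × ℝ → ℂ) (d : (ℝ × ℝ) × ℂ → ℂ),
      ContDiffOn ℝ ∞ a (Ico 0 δ₁ ×ˢ univ) ∧ ContDiffOn ℝ ∞ b (Ico 0 δ₁ ×ˢ univ) ∧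
      ContDiffOn ℝ ∞ d ((Ico 0 δ₁ ×ˢ univ) ×ˢ univ) ∧
      (∀ p ∈ Ico 0 δ₁ ×ˢ (univ : Set ℝ), Differentiable ℂ fun z => d (p, z)) ∧
      ∀ δ ∈ Ico 0 δ₁, ∀ (ξ : ℝ) (z : ℂ), evansExt X U c ((δ, ξ), z)
        = ξ ^ 2 * a (δ, ξ) + ξ * z * b (δ, ξ) + z ^ 2 * d ((δ, ξ), z) := by
  obtain ⟨δ₁, hδ₁, hle, hne⟩ := hw.exists_nonconstant
  set I := Ico 0 δ₁ with hI
  have hsub : I ⊆ Ico 0 δ₀ := Ico_subset_Ico_right hle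
  have hIc : Convex ℝ I := convex_Ico 0 δ₁
  have hIu : UniqueDiffOn ℝ I := uniqueDiffOn_Ico 0 δ₁
  have hSc : Convex ℝ (I ×ˢ (univ : Set ℝ)) := hIc.prod convex_univ
  have hSu : UniqueDiffOn ℝ (I ×ˢ (univ : Set ℝ)) := hIu.prod uniqueDiffOn_univ
  have hE : ContDiffOn ℝ ∞ (evansExt X U c) ((I ×ˢ univ) ×ˢ univ) :=
    (contDiffOn_evansExt hw).mono (prod_mono (prod_mono hsub le_rfl) le_rfl)
  obtain ⟨g, hg, hgd, hEg⟩ := exists_contDiffOn_complex hSc hSu hE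
    fun p hp => hw.differentiable_evansExt ⟨hsub hp.1, hp.2⟩
  obtain ⟨d, hds, hdd, hgd'⟩ := exists_contDiffOn_complex hSc hSu hg hgd
  have hat0 : ∀ f : (ℝ × ℝ) × ℂ → ℂ, ContDiffOn ℝ ∞ f ((I ×ˢ univ) ×ˢ univ) →
      ContDiffOn ℝ ∞ (fun p => f (p, 0)) (I ×ˢ univ) := fun f hf =>
    hf.comp (f := fun p : ℝ × ℝ => (p, (0 : ℂ))) (by fun_prop) fun p hp => ⟨hp, mem_univ _⟩
  obtain ⟨a', ha', haeq⟩ := exists_contDiffOn_snd convex_univ uniqueDiffOn_univ (mem_univ 0)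
    hIc hIu (hat0 _ hE)
  obtain ⟨a, ha, haeq'⟩ := exists_contDiffOn_snd convex_univ uniqueDiffOn_univ (mem_univ 0)
    hIc hIu ha'
  obtain ⟨b, hb, hbeq⟩ := exists_contDiffOn_snd convex_univ uniqueDiffOn_univ (mem_univ 0)
    hIc hIu (hat0 _ hg)
  have hslice : ∀ f : ℝ × ℝ → ℂ, ContDiffOn ℝ ∞ f (I ×ˢ univ) →
      (∀ δ ∈ Ioo 0 δ₁, f (δ, 0) = 0) → ∀ δ ∈ I, f (δ, 0) = 0 := fun f hf h δ hδ => by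
    rcases hδ.1.lt_or_eq with h0 | h0
    · exact h δ ⟨h0, hδ.2⟩
    · rw [← h0]
      exact eq_zero_of_forall_Ioo (f := fun δ => f (δ, 0)) hδ₁
        (hf.continuousOn.comp (f := fun δ : ℝ => (δ, (0 : ℝ))) (by fun_prop)
          fun δ hδ => ⟨hδ, mem_univ _⟩) h
  have hdz : ∀ δ ∈ Ioo 0 δ₁, evansExt X U c ((δ, 0), 0) = 0 ∧ ∀ (σ : ℝ) (z : ℂ),
      HasDerivAt (fun t : ℝ => evansExt X U c ((δ, t * σ), t * z)) 0 0 := fun δ hδ =>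
    hw.evansExt_double_zero (hsub ⟨hδ.1.le, hδ.2⟩) hδ.1 (hne δ ⟨hδ.1.le, hδ.2⟩)
  have hE0 : ∀ δ ∈ I, evansExt X U c ((δ, 0), 0) = 0 :=
    hslice _ (hat0 _ hE) fun δ hδ => (hdz δ hδ).1
  have ha0 : ∀ δ ∈ I, a' (δ, 0) = 0 := hslice _ ha' fun δ hδ => by
    have hδI : δ ∈ I := ⟨hδ.1.le, hδ.2⟩
    have h1 := (hdz δ hδ).2 1 0
    simp only [mul_one, mul_zero] at h1
    have hc : ContinuousOn (fun ξ : ℝ => a' (δ, ξ)) univ :=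
      ha'.continuousOn.comp (f := fun ξ : ℝ => (δ, ξ)) (by fun_prop) fun ξ _ => ⟨hδI, mem_univ _⟩
    have h2 := hasDerivWithinAt_of_eq_smul (mem_univ 0) (f := fun t : ℝ =>
      evansExt X U c ((δ, t), 0)) (g := fun ξ => a' (δ, ξ))
      (fun ξ _ => by rw [haeq δ hδI ξ (mem_univ _), hE0 δ hδI, zero_add]) (hc 0 (mem_univ 0))
    exact (hasDerivWithinAt_univ.1 h2).unique h1
  have hb0 : ∀ δ ∈ I, g ((δ, 0), 0) = 0 := hslice (fun p => g (p, 0)) (hat0 _ hg) fun δ hδ => by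
    have hδI : δ ∈ I := ⟨hδ.1.le, hδ.2⟩
    have h1 := (hdz δ hδ).2 0 1
    simp only [mul_one, mul_zero] at h1
    have hc : Continuous fun t : ℝ => g ((δ, 0), t) :=
      hg.continuousOn.comp_continuous (f := fun t : ℝ => ((δ, (0 : ℝ)), (t : ℂ))) (by fun_prop)
        fun t => ⟨⟨hδI, mem_univ _⟩, mem_univ _⟩
    have h2 := hasDerivWithinAt_of_eq_smul (mem_univ 0) (f := fun t : ℝ =>
      evansExt X U c ((δ, 0), t)) (g := fun t : ℝ => g ((δ, 0), t))
      (fun t _ => by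
        rw [hEg (δ, 0) ⟨hδI, mem_univ _⟩, hE0 δ hδI, zero_add, Complex.real_smul])
      hc.continuousWithinAt
    have h3 := (hasDerivWithinAt_univ.1 h2).unique h1
    simpa using h3
  refine ⟨δ₁, hδ₁, hle, a, b, d, ha, hb, hds, hdd, fun δ hδ ξ z => ?_⟩
  have hp : (δ, ξ) ∈ I ×ˢ (univ : Set ℝ) := ⟨hδ, mem_univ _⟩
  rw [hEg _ hp, hgd' _ hp, haeq δ hδ ξ (mem_univ _), haeq' δ hδ ξ (mem_univ _),
    hbeq δ hδ ξ (mem_univ _), hE0 δ hδ, ha0 δ hδ, hb0 δ hδ]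
  simp only [Complex.real_smul]
  ring

/-- At `δ = 0` the quadratic part vanishes on the three distinct lines `lam = iα_j ξ`, hence
identically, and one more factor can be divided out of each coefficient. The increments of the
coefficients from `δ = 0` are divided by `δ`. -/
theorem IsWaveFamily.exists_normalForm (hw : IsWaveFamily X δ₀ U c) {α : Fin 3 → ℝ}
    (hα : StrictMono α) (hαc : ∀ j, IsKdVCharacteristic X (U 0) (c 0) (α j)) :
    ∃ δ₁, 0 < δ₁ ∧ δ₁ ≤ δ₀ ∧ Nonempty (NormalForm δ₁ (evansExt X U c)) := by
  obtain ⟨δ₁, hδ₁, hle, a, b, d, ha, hb, hds, hdd, heq⟩ := hw.exists_quadratic_form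
  refine ⟨δ₁, hδ₁, hle, ?_⟩
  set I := Ico 0 δ₁ with hI
  have h0I : (0 : ℝ) ∈ I := ⟨le_rfl, hδ₁⟩
  have hIc : Convex ℝ I := convex_Ico 0 δ₁
  have hIu : UniqueDiffOn ℝ I := uniqueDiffOn_Ico 0 δ₁
  have hinj : Function.Injective fun j => Complex.I * (α j : ℂ) := fun i j hij =>
    hα.injective (Complex.ofReal_injective (mul_left_cancel₀ Complex.I_ne_zero hij))
  have hzero : ∀ f : ℝ × ℝ → ℂ, ContDiffOn ℝ ∞ f (I ×ˢ univ) → ContDiff ℝ ∞ fun ξ => f (0, ξ) :=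
    fun f hf => contDiffOn_univ.1 (hf.comp (f := fun ξ : ℝ => ((0 : ℝ), ξ)) (by fun_prop)
      fun ξ _ => ⟨h0I, mem_univ _⟩)
  have hd0 : ContDiff ℝ ∞ fun y : ℝ × ℂ => d ((0, y.1), y.2) :=
    contDiffOn_univ.1 (hds.comp (f := fun y : ℝ × ℂ => (((0 : ℝ), y.1), y.2)) (by fun_prop)
      fun ξ _ => ⟨⟨h0I, mem_univ _⟩, mem_univ _⟩)
  have hvan := quadratic_eq_zero (c₀ := a (0, 0)) (c₁ := b (0, 0)) (c₂ := d ((0, 0), 0)) hinj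
    fun j => by
      have h1 : ContDiff ℝ ∞ fun y : ℝ × ℂ => a (0, y.1) + b (0, y.1) * (Complex.I * y.2)
          + d ((0, y.1), Complex.I * y.2 * y.1) * (Complex.I * y.2) ^ 2 := by
        have h2 : ContDiff ℝ ∞ fun y : ℝ × ℂ => Complex.I * y.2 := contDiff_const.mul contDiff_snd
        have h3 : ContDiff ℝ ∞ fun y : ℝ × ℂ => d ((0, y.1), Complex.I * y.2 * y.1) :=
          hd0.comp (f := fun y : ℝ × ℂ => (y.1, Complex.I * y.2 * y.1)) (contDiff_fst.prodMk
            (h2.mul (Complex.ofRealCLM.contDiff.comp contDiff_fst)))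
        exact (((hzero a ha).comp contDiff_fst).add (((hzero b hb).comp contDiff_fst).mul h2)).add
          (h3.mul (h2.pow 2))
      have h4 := (hαc j).eq_zero (k := 2) h1.continuous.continuousAt fun ξ B => by
        rw [← evansExt_zero, heq 0 h0I]
        ring
      simpa using h4
  obtain ⟨hva, hvb, hvd⟩ := hvan
  obtain ⟨q₀, hq₀, hq₀e⟩ := exists_contDiffOn_fst hIc hIu h0I convex_univ uniqueDiffOn_univ ha
  obtain ⟨q₁, hq₁, hq₁e⟩ := exists_contDiffOn_fst hIc hIu h0I convex_univ uniqueDiffOn_univ hb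
  have hds' : ContDiffOn ℝ ∞ (fun y : ℝ × (ℝ × ℂ) => d ((y.1, y.2.1), y.2.2)) (I ×ˢ univ) :=
    hds.comp (f := fun y : ℝ × (ℝ × ℂ) => ((y.1, y.2.1), y.2.2)) (by fun_prop)
      fun y hy => ⟨⟨hy.1, mem_univ _⟩, mem_univ _⟩
  obtain ⟨r, hr, hre⟩ := exists_contDiffOn_fst hIc hIu h0I convex_univ uniqueDiffOn_univ hds'
  have hq₂ : ContDiffOn ℝ ∞ (fun y : (ℝ × ℝ) × ℂ => r (y.1.1, (y.1.2, y.2)))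
      ((I ×ˢ univ) ×ˢ univ) :=
    hr.comp (f := fun y : (ℝ × ℝ) × ℂ => (y.1.1, (y.1.2, y.2))) (by fun_prop)
      fun y hy => ⟨hy.1.1, mem_univ _⟩
  have hq₂d : ∀ p ∈ I ×ˢ (univ : Set ℝ), Differentiable ℂ fun z => r (p.1, (p.2, z)) := by
    refine fun p hp => differentiable_of_forall_Ioo hδ₁ hq₂ (fun δ hδ ξ => ?_) hp
    have hδI : δ ∈ I := ⟨hδ.1.le, hδ.2⟩
    have hδ0 : (δ : ℂ) ≠ 0 := by exact_mod_cast hδ.1.ne'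
    have h1 : (fun z => r (δ, (ξ, z))) = fun z => (δ : ℂ)⁻¹ * (d ((δ, ξ), z) - d ((0, ξ), z)) := by
      funext z
      have h2 := hre δ hδI (ξ, z) (mem_univ _)
      simp only [Complex.real_smul] at h2
      rw [h2]
      field_simp
      ring
    change Differentiable ℂ fun z => r (δ, (ξ, z))
    rw [h1]
    exact ((hdd (δ, ξ) ⟨hδI, mem_univ _⟩).sub (hdd (0, ξ) ⟨h0I, mem_univ _⟩)).const_mul _
  obtain ⟨p₃, hp₃, hp₃d, hp₃e⟩ := exists_contDiffOn_complex (S := (univ : Set ℝ)) convex_univ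
    uniqueDiffOn_univ (f := fun y : ℝ × ℂ => d ((0, y.1), y.2)) hd0.contDiffOn
    fun ξ _ => hdd (0, ξ) ⟨h0I, mem_univ _⟩
  have hdiv : ∀ f : ℝ → ℂ, ContDiff ℝ ∞ f → f 0 = 0 →
      ∃ g : ℝ → ℂ, ContDiff ℝ ∞ g ∧ ∀ ξ, f ξ = ξ * g ξ := fun f hf h0 => by
    obtain ⟨g, hg, hfg⟩ := exists_contDiffOn_fst (S := (univ : Set ℝ)) convex_univ
      uniqueDiffOn_univ (mem_univ (0 : ℝ)) convex_univ uniqueDiffOn_univ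
      (f := fun y : ℝ × ℝ => f y.1) (hf.comp contDiff_fst).contDiffOn
    have hg' : ContDiffOn ℝ ∞ (fun ξ => g (ξ, 0)) univ :=
      hg.comp (f := fun ξ : ℝ => (ξ, (0 : ℝ))) (by fun_prop) fun _ _ => ⟨mem_univ _, mem_univ _⟩
    exact ⟨fun ξ => g (ξ, 0), contDiffOn_univ.1 hg', fun ξ => by
      have := hfg ξ (mem_univ _) 0 (mem_univ _)
      simpa [h0] using this⟩
  obtain ⟨p₀, hp₀, hp₀e⟩ := hdiv _ (hzero a ha) hva
  obtain ⟨p₁, hp₁, hp₁e⟩ := hdiv _ (hzero b hb) hvb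
  obtain ⟨p₂, hp₂, hp₂e⟩ := hdiv (fun ξ => d ((0, ξ), 0))
    (hd0.comp (f := fun ξ : ℝ => (ξ, (0 : ℂ))) (by fun_prop)) hvd
  refine ⟨⟨hδ₁, p₀, p₁, p₂, p₃, q₀, q₁, fun y => r (y.1.1, (y.1.2, y.2)), hp₀, hp₁, hp₂,
    contDiffOn_univ.1 (by simpa using hp₃), fun ξ => hp₃d ξ (mem_univ _), hq₀, hq₁, hq₂, hq₂d,
    fun δ hδ ξ z => ?_⟩⟩
  have h1 := hre δ hδ (ξ, z) (mem_univ _)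
  have h2 := hp₃e ξ (mem_univ _) z
  simp only [Complex.real_smul] at h1 h2
  rw [heq δ hδ, h1, h2, hq₀e δ hδ ξ (mem_univ _), hq₁e δ hδ ξ (mem_univ _), hp₀e, hp₁e, hp₂e]
  simp only [Complex.real_smul]
  ring

end EvansNormalForm

end

end KdVKS

namespace KdVKS

noncomputable section

set_option linter.unusedSectionVars false

open Set Filter Topology

/-! ### Taylor coefficients of the Evans function -/

/-- A cubic with leading coefficient `-1` cannot be `o(w³)`: the lower coefficients vanish one after
the other, leaving `-1 = 0`. -/
lemma false_of_tendsto_cubic_div {ι : Type} {l : Filter ι} [l.NeBot] {w : ι → ℂ} {c₀ c₁ c₂ : ℂ}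
    (hw : Tendsto w l (𝓝 0)) (hw0 : ∀ᶠ x in l, w x ≠ 0)
    (h : Tendsto (fun x => (c₀ + c₁ * w x + c₂ * w x ^ 2 - w x ^ 3) / w x ^ 3) l (𝓝 0)) :
    False := by
  set g := fun x => (c₀ + c₁ * w x + c₂ * w x ^ 2 - w x ^ 3) / w x ^ 3 with hg
  have hg' : ∀ᶠ x in l, w x ^ 3 * (g x + 1) = c₀ + c₁ * w x + c₂ * w x ^ 2 := by
    filter_upwards [hw0] with x hx
    simp only [hg]
    field_simp
    ring
  have h1 : Tendsto (fun x => g x + 1) l (𝓝 1) := by simpa using h.add_const 1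
  have e0 : c₀ = 0 := by
    have h2 : Tendsto (fun x => w x ^ 3 * (g x + 1) - c₁ * w x - c₂ * w x ^ 2) l (𝓝 0) := by
      simpa using (((hw.pow 3).mul h1).sub (hw.const_mul c₁)).sub ((hw.pow 2).const_mul c₂)
    refine tendsto_nhds_unique (tendsto_const_nhds.congr' ?_) h2
    filter_upwards [hg'] with x hx
    rw [hx]
    ring
  have e1 : c₁ = 0 := by
    have h2 : Tendsto (fun x => w x ^ 2 * (g x + 1) - c₂ * w x) l (𝓝 0) := by
      simpa using ((hw.pow 2).mul h1).sub (hw.const_mul c₂)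
    refine tendsto_nhds_unique (tendsto_const_nhds.congr' ?_) h2
    filter_upwards [hg', hw0] with x hx hx0
    refine mul_left_cancel₀ hx0 ?_
    linear_combination -hx - e0
  have e2 : c₂ = 0 := by
    have h2 : Tendsto (fun x => w x * (g x + 1)) l (𝓝 0) := by simpa using hw.mul h1
    refine tendsto_nhds_unique (tendsto_const_nhds.congr' ?_) h2
    filter_upwards [hg', hw0] with x hx hx0
    refine mul_left_cancel₀ (pow_ne_zero 2 hx0) ?_
    linear_combination -hx - e0 - w x * e1
  have h3 : Tendsto (fun _ : ι => (0 : ℂ)) l (𝓝 1) := by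
    refine h1.congr' ?_
    filter_upwards [hg', hw0] with x hx hx0
    refine mul_left_cancel₀ (pow_ne_zero 3 hx0) ?_
    linear_combination hx + e0 + w x * e1 + w x ^ 2 * e2
  exact zero_ne_one (tendsto_nhds_unique tendsto_const_nhds h3)

lemma exists_det_sub_smul_eq (R : Matrix (Fin 3) (Fin 3) ℂ) : ∃ c₀ c₁ c₂ : ℂ, ∀ w : ℂ,
    (R - (1 + w) • (1 : Matrix (Fin 3) (Fin 3) ℂ)).det
      = c₀ + c₁ * w + c₂ * w ^ 2 - w ^ 3 := by
  set N := R - 1 with hN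
  refine ⟨N.det, -(N 0 0 * N 1 1 - N 0 1 * N 1 0 + N 0 0 * N 2 2 - N 0 2 * N 2 0
    + N 1 1 * N 2 2 - N 1 2 * N 2 1), N 0 0 + N 1 1 + N 2 2, fun w => ?_⟩
  have h1 : R - (1 + w) • (1 : Matrix (Fin 3) (Fin 3) ℂ) = N - w • 1 := by
    rw [add_smul, one_smul, hN]; abel
  rw [h1]
  simp [Matrix.det_fin_three]
  ring

namespace NormalForm

variable {X δ₀ δ₁ : ℝ} {U : ℝ → ℝ → ℝ} {c : ℝ → ℝ}

lemma eq_zero_delta {E : (ℝ × ℝ) × ℂ → ℂ} (N : NormalForm δ₁ E) (ξ : ℝ) (z : ℂ) :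
    E ((0, ξ), z) = ξ ^ 3 * N.p₀ ξ + ξ ^ 2 * z * N.p₁ ξ + ξ * z ^ 2 * N.p₂ ξ
      + z ^ 3 * N.p₃ (ξ, z) := by
  rw [N.eq 0 ⟨le_rfl, N.pos⟩]
  simp

variable (N : NormalForm δ₁ (evansExt X U c))

lemma continuousOn_eval (p : ℝ × ℝ → ℂ) (hp : ContDiffOn ℝ ∞ p (Ico 0 δ₁ ×ˢ univ)) (ξ : ℝ) :
    ContinuousOn (fun δ => p (δ, ξ)) (Ico 0 δ₁) :=
  hp.continuousOn.comp (f := fun δ : ℝ => (δ, ξ)) (by fun_prop) fun _ hδ => ⟨hδ, mem_univ _⟩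

lemma p₃_eq : N.p₃ (0, 0) = leadingCoeff X (U 0) (c 0) := by
  have h1 : (fun lam : ℂ => evansKdV X (U 0) (c 0) lam 0) = fun z => z ^ 3 • N.p₃ (0, z) := by
    funext z
    rw [← evansExt_zero, N.eq_zero_delta]
    simp
  rw [leadingCoeff, h1, iteratedDeriv_pow_smul (N.holo_p₃ 0).contDiff]
  simp [Nat.factorial]

theorem cubic {α : Fin 3 → ℝ} (hα : StrictMono α)
    (hαc : ∀ j, IsKdVCharacteristic X (U 0) (c 0) (α j)) (σ z : ℂ) :
    σ ^ 3 * N.p₀ 0 + σ ^ 2 * z * N.p₁ 0 + σ * z ^ 2 * N.p₂ 0 + z ^ 3 * N.p₃ (0, 0)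
      = N.p₃ (0, 0) * ∏ j, (z - Complex.I * α j * σ) := by
  refine cubic_eq (w := fun j => Complex.I * (α j : ℂ)) (fun i j hij =>
    hα.injective (Complex.ofReal_injective (mul_left_cancel₀ Complex.I_ne_zero hij)))
    (fun j => ?_) σ z
  have h1 : ContDiff ℝ ∞ fun y : ℝ × ℂ => N.p₀ y.1 + N.p₁ y.1 * (Complex.I * y.2)
      + N.p₂ y.1 * (Complex.I * y.2) ^ 2
      + N.p₃ (y.1, Complex.I * y.2 * y.1) * (Complex.I * y.2) ^ 3 := by
    have h2 : ContDiff ℝ ∞ fun y : ℝ × ℂ => Complex.I * y.2 := contDiff_const.mul contDiff_snd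
    have h3 : ContDiff ℝ ∞ fun y : ℝ × ℂ => N.p₃ (y.1, Complex.I * y.2 * y.1) :=
      N.smooth_p₃.comp (f := fun y : ℝ × ℂ => (y.1, Complex.I * y.2 * y.1)) (contDiff_fst.prodMk
        (h2.mul (Complex.ofRealCLM.contDiff.comp contDiff_fst)))
    exact (((N.smooth_p₀.comp contDiff_fst).add ((N.smooth_p₁.comp contDiff_fst).mul h2)).add
      ((N.smooth_p₂.comp contDiff_fst).mul (h2.pow 2))).add (h3.mul (h2.pow 3))
  have h4 := (hαc j).eq_zero (k := 3) h1.continuous.continuousAt fun ξ B => by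
    rw [← evansExt_zero, N.eq_zero_delta]
    ring
  simpa using h4

/-- If `Γ₀` vanished, so would the whole cubic part, and `E_kdv(0, ξ)` would be `o(ξ³)`. But this
function is a cubic in `e^{iξX} - 1`, which is asymptotic to `iXξ`, with leading coefficient `-1`.
-/
theorem p₃_ne_zero (hX : 0 < X) {α : Fin 3 → ℝ} (hα : StrictMono α)
    (hαc : ∀ j, IsKdVCharacteristic X (U 0) (c 0) (α j)) : N.p₃ (0, 0) ≠ 0 := by
  intro h0
  have hp : N.p₀ 0 = 0 := by
    have := N.cubic hα hαc 1 0
    simpa [h0] using this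
  obtain ⟨c₀, c₁, c₂, hdet⟩ := exists_det_sub_smul_eq (principalSolution (kdvMatrix (U 0) (c 0) 0) X)
  set w : ℝ → ℂ := fun ξ => Complex.exp (Complex.I * ξ * X) - 1 with hw
  have hwd : HasDerivAt w (Complex.I * X) 0 := by
    have h1 : HasDerivAt (fun ξ : ℝ => Complex.I * ξ * X) (Complex.I * X) 0 := by
      simpa using ((Complex.ofRealCLM.hasDerivAt (x := (0 : ℝ))).const_mul Complex.I).mul_const
        (X : ℂ)
    exact (h1.cexp.sub_const 1).congr_deriv (by simp)
  have hw0 : w 0 = 0 := by simp [hw]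
  have hIX : Complex.I * (X : ℂ) ≠ 0 := mul_ne_zero Complex.I_ne_zero (by exact_mod_cast hX.ne')
  have hwne : ∀ᶠ ξ in 𝓝[≠] (0 : ℝ), w ξ ≠ 0 := by
    have := hwd.eventually_ne (c := 0) hIX
    exact this
  have hwt : Tendsto w (𝓝[≠] 0) (𝓝 0) := by
    have := hwd.continuousAt.tendsto
    rw [hw0] at this
    exact this.mono_left nhdsWithin_le_nhds
  have hslope : Tendsto (fun ξ : ℝ => (ξ : ℂ) / w ξ) (𝓝[≠] 0) (𝓝 (Complex.I * X)⁻¹) := by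
    have h1 := (hasDerivAt_iff_tendsto_slope.1 hwd).inv₀ hIX
    refine h1.congr' ?_
    filter_upwards [self_mem_nhdsWithin] with ξ hξ
    simp [slope, hw0, div_eq_mul_inv, mul_comm]
  refine false_of_tendsto_cubic_div (c₀ := c₀) (c₁ := c₁) (c₂ := c₂) hwt hwne ?_
  have hp0 : Tendsto N.p₀ (𝓝[≠] 0) (𝓝 0) := by
    have := N.smooth_p₀.continuous.tendsto 0
    rw [hp] at this
    exact this.mono_left nhdsWithin_le_nhds
  have h2 : Tendsto (fun ξ : ℝ => ((ξ : ℂ) / w ξ) ^ 3 * N.p₀ ξ) (𝓝[≠] 0) (𝓝 0) := by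
    simpa using (hslope.pow 3).mul hp0
  refine h2.congr fun ξ => ?_
  have h3 : evansKdV X (U 0) (c 0) 0 ξ = (ξ : ℂ) ^ 3 * N.p₀ ξ := by
    rw [← evansExt_zero, N.eq_zero_delta]
    simp
  rw [evansKdV, show Complex.exp (Complex.I * ξ * X) = 1 + w ξ by simp [hw], hdet] at h3
  rw [h3, div_pow, div_mul_eq_mul_div]

/-- The difference quotient defining `E₁` is the `q`-part of the normal form, continuous up to `δ =
0`; the limit is its value there. -/
theorem evansOne_eq (z : ℂ) (ξ : ℝ) : evansOne X U c z ξ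
    = ξ ^ 2 * N.q₀ (0, ξ) + ξ * z * N.q₁ (0, ξ) + z ^ 2 * N.q₂ ((0, ξ), z) := by
  have hq₂ : ContinuousOn (fun δ => N.q₂ ((δ, ξ), z)) (Ico 0 δ₁) :=
    N.smooth_q₂.continuousOn.comp (f := fun δ : ℝ => ((δ, ξ), z)) (by fun_prop)
      fun _ hδ => ⟨⟨hδ, mem_univ _⟩, mem_univ _⟩
  have hc : ContinuousOn (fun δ => (ξ : ℂ) ^ 2 * N.q₀ (δ, ξ) + ξ * z * N.q₁ (δ, ξ)
      + z ^ 2 * N.q₂ ((δ, ξ), z)) (Ico 0 δ₁) :=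
    ((continuousOn_const.mul (continuousOn_eval _ N.smooth_q₀ ξ)).add
      (continuousOn_const.mul (continuousOn_eval _ N.smooth_q₁ ξ))).add
      (continuousOn_const.mul hq₂)
  have h1 := (hc 0 ⟨le_rfl, N.pos⟩).mono_left (f := _) (by
    rw [nhdsWithin_Ico_eq_nhdsGE N.pos]
    exact nhdsWithin_mono _ Ioi_subset_Ici_self :  𝓝[>] (0 : ℝ) ≤ _)
  refine Tendsto.limUnder_eq (h1.congr' ?_)
  filter_upwards [Ioo_mem_nhdsGT N.pos] with δ hδ
  have hδ0 : (δ : ℂ) ≠ 0 := by exact_mod_cast hδ.1.ne'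
  have h2 := N.eq δ ⟨hδ.1.le, hδ.2⟩ ξ z
  have h3 := N.eq_zero_delta ξ z
  rw [evansExt_zero] at h3
  simp only [evansExt, hδ.1, if_true] at h2
  rw [h2, h3]
  field_simp
  ring

lemma quad20_eq : quad20 X U c = N.q₂ ((0, 0), 0) := by
  have h1 : (fun lam => evansOne X U c lam 0) = fun z => z ^ 2 • N.q₂ ((0, 0), z) := by
    funext z
    simp [N.evansOne_eq]
  rw [quad20, h1, iteratedDeriv_pow_smul
    (N.holo_q₂ (0, 0) ⟨⟨le_rfl, N.pos⟩, mem_univ _⟩).contDiff]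
  simp [Nat.factorial]

lemma contDiff_zero (hδ₁ : 0 < δ₁) (p : ℝ × ℝ → ℂ) (hp : ContDiffOn ℝ ∞ p (Ico 0 δ₁ ×ˢ univ)) :
    ContDiff ℝ ∞ fun ξ => p (0, ξ) :=
  contDiffOn_univ.1 (hp.comp (f := fun ξ : ℝ => ((0 : ℝ), ξ)) (by fun_prop)
    fun _ _ => ⟨⟨le_rfl, hδ₁⟩, mem_univ _⟩)

lemma quad02_eq : quad02 X U c = N.q₀ (0, 0) := by
  have h1 : (fun ξ => evansOne X U c 0 ξ) = fun ξ : ℝ => ξ ^ 2 • N.q₀ (0, ξ) := by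
    funext z
    simp [N.evansOne_eq]
  rw [quad02, h1, iteratedDeriv_pow_smul (contDiff_zero N.pos _ N.smooth_q₀)]
  simp [Nat.factorial]

lemma quad11_eq : quad11 X U c = N.q₁ (0, 0) := by
  have h1 : (fun ξ : ℝ => deriv (fun lam : ℂ => evansOne X U c lam ξ) 0)
      = fun ξ : ℝ => ξ ^ 1 • N.q₁ (0, ξ) := by
    funext ξ
    have hq : Differentiable ℂ fun z => N.q₂ ((0, ξ), z) :=
      N.holo_q₂ (0, ξ) ⟨⟨le_rfl, N.pos⟩, mem_univ _⟩
    have h2 : (fun lam : ℂ => evansOne X U c lam ξ) = fun z : ℂ => ((ξ : ℂ) ^ 2 * N.q₀ (0, ξ)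
        + z * (ξ * N.q₁ (0, ξ))) + z ^ 2 * N.q₂ ((0, ξ), z) := by
      funext z
      rw [N.evansOne_eq]
      ring
    have h3 : HasDerivAt (fun z : ℂ => ((ξ : ℂ) ^ 2 * N.q₀ (0, ξ)
        + z * (ξ * N.q₁ (0, ξ))) + z ^ 2 * N.q₂ ((0, ξ), z)) _ 0 :=
      (((hasDerivAt_id (0 : ℂ)).mul_const _).const_add _).add
        ((hasDerivAt_pow 2 (0 : ℂ)).mul (hq 0).hasDerivAt)
    rw [h2, h3.deriv]
    simp
  rw [quad11, ← iteratedDeriv_one, h1, iteratedDeriv_pow_smul (contDiff_zero N.pos _ N.smooth_q₁)]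
  simp

/-- Real `lam` with `ξ = 0` is fixed by the conjugation symmetry; after division by `t³` let `t →
0`. -/
theorem conj_p₃ (hw : IsWaveFamily X δ₀ U c) :
    (starRingEnd ℂ) (N.p₃ (0, 0)) = N.p₃ (0, 0) := by
  have hc : Continuous fun t : ℝ => (starRingEnd ℂ) (N.p₃ (0, t)) - N.p₃ (0, t) := by
    have : Continuous fun t : ℝ => N.p₃ (0, t) :=
      N.smooth_p₃.continuous.comp (f := fun t : ℝ => ((0 : ℝ), (t : ℂ))) (by fun_prop)
    exact (Complex.continuous_conj.comp this).sub this
  have h1 := eq_zero_of_forall_Ioo one_pos hc.continuousOn fun t ht => by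
    have h2 := hw.evansExt_conj ⟨le_rfl, hw.delta_pos⟩ 0 (t : ℂ)
    rw [Complex.conj_ofReal, neg_zero, N.eq_zero_delta] at h2
    have ht0 : (t : ℂ) ^ 3 ≠ 0 := pow_ne_zero _ (by exact_mod_cast ht.1.ne')
    simp at h2
    rw [← h2.resolve_right (by exact_mod_cast ht.1.ne'), sub_self]
  simpa using sub_eq_zero.1 h1

/-- On the diagonal `δ = lam = t`, `ξ = 0`, subtracting the symmetry at `δ = 0` from the one at `δ =
t` isolates `t³ q₂`. -/
theorem conj_q₂ (hw : IsWaveFamily X δ₀ U c) (hle : δ₁ ≤ δ₀) :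
    (starRingEnd ℂ) (N.q₂ ((0, 0), 0)) = N.q₂ ((0, 0), 0) := by
  have hc : ContinuousOn (fun t : ℝ => (starRingEnd ℂ) (N.q₂ ((t, 0), t)) - N.q₂ ((t, 0), t))
      (Ico 0 δ₁) := by
    have : ContinuousOn (fun t : ℝ => N.q₂ ((t, 0), t)) (Ico 0 δ₁) :=
      N.smooth_q₂.continuousOn.comp (f := fun t : ℝ => ((t, (0 : ℝ)), (t : ℂ))) (by fun_prop)
        fun t ht => ⟨⟨ht, mem_univ _⟩, mem_univ _⟩
    exact (Complex.continuous_conj.comp_continuousOn this).sub this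
  have h1 := eq_zero_of_forall_Ioo N.pos hc fun t ht => by
    have htI : t ∈ Ico 0 δ₁ := ⟨ht.1.le, ht.2⟩
    have ht0 : (t : ℂ) ≠ 0 := by exact_mod_cast ht.1.ne'
    have h2 := hw.evansExt_conj ⟨htI.1, htI.2.trans_le hle⟩ 0 (t : ℂ)
    have h3 := hw.evansExt_conj ⟨le_rfl, hw.delta_pos⟩ 0 (t : ℂ)
    rw [Complex.conj_ofReal, neg_zero, N.eq t htI] at h2
    rw [Complex.conj_ofReal, neg_zero, N.eq_zero_delta] at h3
    simp only [Complex.ofReal_zero, ne_eq, OfNat.ofNat_ne_zero, not_false_eq_true, zero_pow,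
      zero_mul, zero_add, map_add, map_mul, map_pow, Complex.conj_ofReal] at h2 h3
    have h4 : (t : ℂ) ^ 3 * ((starRingEnd ℂ) (N.q₂ ((t, 0), t)) - N.q₂ ((t, 0), t)) = 0 := by
      linear_combination h3 - h2
    exact (mul_eq_zero.1 h4).resolve_left (pow_ne_zero _ ht0)
  simpa using sub_eq_zero.1 h1

/-- By the two symmetries the quotient is real, so the real part in `gammaCoeff` loses nothing. -/
theorem q₂_eq (hw : IsWaveFamily X δ₀ U c) (hle : δ₁ ≤ δ₀) (hΓ : N.p₃ (0, 0) ≠ 0) :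
    N.q₂ ((0, 0), 0) = N.p₃ (0, 0) * gammaCoeff X U c := by
  rw [gammaCoeff, N.quad20_eq, ← N.p₃_eq]
  have h1 : (starRingEnd ℂ) (N.q₂ ((0, 0), 0) / N.p₃ (0, 0)) = N.q₂ ((0, 0), 0) / N.p₃ (0, 0) := by
    rw [map_div₀, N.conj_p₃ hw, N.conj_q₂ hw hle]
  rw [Complex.conj_eq_iff_re.1 h1]
  field_simp

end NormalForm

end

end KdVKS

namespace KdVKS

noncomputable section

set_option linter.unusedSectionVars false

open Set Filter Topology Metric

/-! ### The rescaled Evans functions -/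

/-- The parameter rectangle `[0, η] × [-ε, ε]`. -/
def rect (η ε : ℝ) : Set (ℝ × ℝ) := Icc 0 η ×ˢ Icc (-ε) ε

lemma convex_rect (η ε : ℝ) : Convex ℝ (rect η ε) := (convex_Icc _ _).prod (convex_Icc _ _)

lemma uniqueDiffOn_rect {η ε : ℝ} (hη : 0 < η) (hε : 0 < ε) : UniqueDiffOn ℝ (rect η ε) :=
  (uniqueDiffOn_Icc hη).prod (uniqueDiffOn_Icc (by linarith))

lemma rect_mono {η ε η' ε' : ℝ} (hη : η ≤ η') (hε : ε ≤ ε') : rect η ε ⊆ rect η' ε' :=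
  prod_mono (Icc_subset_Icc_right hη) (Icc_subset_Icc (neg_le_neg hε) hε)

lemma rect_subset_strip {η δ₁ : ℝ} (h : η < δ₁) (ε : ℝ) : rect η ε ⊆ Ico 0 δ₁ ×ˢ univ :=
  fun _ hp => ⟨⟨hp.1.1, hp.1.2.trans_lt h⟩, mem_univ _⟩

lemma zero_mem_rect {η ε : ℝ} (hη : 0 ≤ η) (hε : 0 ≤ ε) : (0, 0) ∈ rect η ε :=
  ⟨⟨le_rfl, hη⟩, ⟨neg_nonpos.2 hε, hε⟩⟩

lemma exists_rect_of_eventually {δ₁ : ℝ} (hδ₁ : 0 < δ₁) {Q : ℝ × ℝ → Prop}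
    (h : ∀ᶠ p in 𝓝 ((0, 0) : ℝ × ℝ), p ∈ Ico 0 δ₁ ×ˢ (univ : Set ℝ) → Q p) :
    ∃ ρ, 0 < ρ ∧ ρ < δ₁ ∧ ∀ p ∈ rect ρ ρ, Q p := by
  obtain ⟨r, hr, hb⟩ := Metric.eventually_nhds_iff.1 h
  have h1 : 0 < min r δ₁ := lt_min hr hδ₁
  have h2 : min r δ₁ / 2 < δ₁ := (half_lt_self h1).trans_le (min_le_right _ _)
  refine ⟨min r δ₁ / 2, half_pos h1, h2, fun p hp => hb ?_ (rect_subset_strip h2 _ hp)⟩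
  have h3 : min r δ₁ / 2 < r := (half_lt_self h1).trans_le (min_le_left _ _)
  rw [Prod.dist_eq, max_lt_iff, Real.dist_eq, Real.dist_eq]
  simp only [sub_zero]
  refine ⟨?_, (abs_le.2 hp.2).trans_lt h3⟩
  rw [abs_of_nonneg hp.1.1]
  exact hp.1.2.trans_lt h3

lemma exists_rect_ne_zero {δ₁ : ℝ} (hδ₁ : 0 < δ₁) {f : (ℝ × ℝ) × ℂ → ℂ}
    (hf : ContinuousOn f ((Ico 0 δ₁ ×ˢ univ) ×ˢ univ)) {K : Set ℂ} (hK : IsCompact K)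
    (h0 : ∀ z ∈ K, f ((0, 0), z) ≠ 0) :
    ∃ ρ, 0 < ρ ∧ ρ < δ₁ ∧ ∀ p ∈ rect ρ ρ, ∀ z ∈ K, f (p, z) ≠ 0 := by
  refine exists_rect_of_eventually hδ₁ ?_
  have h1 : ∀ᶠ p in 𝓝 ((0, 0) : ℝ × ℝ), ∀ z ∈ K,
      p ∈ Ico 0 δ₁ ×ˢ (univ : Set ℝ) → f (p, z) ≠ 0 := by
    refine hK.eventually_forall_of_forall_eventually fun z hz => ?_
    have h2 := (hf ((0, 0), z) ⟨⟨⟨le_rfl, hδ₁⟩, mem_univ _⟩, mem_univ _⟩).eventually_ne (h0 z hz)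
    rw [eventually_nhdsWithin_iff] at h2
    filter_upwards [h2] with y hy hp
    exact hy ⟨hp, mem_univ _⟩
  filter_upwards [h1] with p hp hps z hz
  exact hp z hz hps

namespace NormalForm

variable {δ₁ : ℝ} {E : (ℝ × ℝ) × ℂ → ℂ} (N : NormalForm δ₁ E)

/-- The coefficient of `σ²` in the rescaled Evans function. -/
def scaled₀ (p : ℝ × ℝ) : ℂ := p.2 * N.p₀ (p.1 * p.2) + N.q₀ (p.1, p.1 * p.2)

/-- The coefficient of `σ z` in the rescaled Evans function. -/
def scaled₁ (p : ℝ × ℝ) : ℂ := p.2 * N.p₁ (p.1 * p.2) + N.q₁ (p.1, p.1 * p.2)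

/-- The coefficient of `z²` in the rescaled Evans function. -/
def scaled₂ (y : (ℝ × ℝ) × ℂ) : ℂ :=
  y.1.2 * N.p₂ (y.1.1 * y.1.2) + y.2 * N.p₃ (y.1.1 * y.1.2, y.1.1 * y.2)
    + N.q₂ ((y.1.1, y.1.1 * y.1.2), y.1.1 * y.2)

/-- The rescaled Evans function `δ⁻³ E ((δ, δ σ), δ z)`. -/
def scaled (y : (ℝ × ℝ) × ℂ) : ℂ :=
  y.1.2 ^ 2 * N.scaled₀ y.1 + y.1.2 * y.2 * N.scaled₁ y.1 + y.2 ^ 2 * N.scaled₂ y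

/-- The rescaled Evans function `δ⁻³ σ⁻² E ((δ, δ σ), δ σ w)`. -/
def blowup (y : (ℝ × ℝ) × ℂ) : ℂ :=
  N.scaled₀ y.1 + y.2 * N.scaled₁ y.1 + y.2 ^ 2 * N.scaled₂ (y.1, y.1.2 * y.2)

lemma eq_scaled {δ : ℝ} (hδ : δ ∈ Ico 0 δ₁) (σ : ℝ) (z : ℂ) :
    E ((δ, δ * σ), δ * z) = δ ^ 3 * N.scaled ((δ, σ), z) := by
  rw [N.eq δ hδ]
  simp only [scaled, scaled₀, scaled₁, scaled₂]
  push_cast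
  ring

lemma scaled_eq_blowup (δ σ : ℝ) (w : ℂ) :
    N.scaled ((δ, σ), σ * w) = σ ^ 2 * N.blowup ((δ, σ), w) := by
  simp only [scaled, blowup]
  ring

lemma contDiffOn_scaled_aux {p : ℝ → ℂ} {q : ℝ × ℝ → ℂ} (hp : ContDiff ℝ ∞ p)
    (hq : ContDiffOn ℝ ∞ q (Ico 0 δ₁ ×ˢ univ)) :
    ContDiffOn ℝ ∞ (fun x : ℝ × ℝ => x.2 * p (x.1 * x.2) + q (x.1, x.1 * x.2))
      (Ico 0 δ₁ ×ˢ univ) := by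
  have hm : ContDiff ℝ ∞ fun x : ℝ × ℝ => x.1 * x.2 := contDiff_fst.mul contDiff_snd
  have h2 : ContDiff ℝ ∞ fun x : ℝ × ℝ => ((x.2 : ℝ) : ℂ) :=
    Complex.ofRealCLM.contDiff.comp contDiff_snd
  have hq' : ContDiffOn ℝ ∞ (fun x : ℝ × ℝ => q (x.1, x.1 * x.2)) (Ico 0 δ₁ ×ˢ univ) :=
    hq.comp (f := fun x : ℝ × ℝ => (x.1, x.1 * x.2)) (contDiff_fst.prodMk hm).contDiffOn
      fun x hx => ⟨hx.1, mem_univ _⟩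
  exact (h2.mul (hp.comp hm)).contDiffOn.add hq'

lemma contDiffOn_scaled₀ : ContDiffOn ℝ ∞ N.scaled₀ (Ico 0 δ₁ ×ˢ univ) :=
  contDiffOn_scaled_aux N.smooth_p₀ N.smooth_q₀

lemma contDiffOn_scaled₁ : ContDiffOn ℝ ∞ N.scaled₁ (Ico 0 δ₁ ×ˢ univ) :=
  contDiffOn_scaled_aux N.smooth_p₁ N.smooth_q₁

lemma contDiffOn_scaled₂ : ContDiffOn ℝ ∞ N.scaled₂ ((Ico 0 δ₁ ×ˢ univ) ×ˢ univ) := by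
  have h11 : ContDiff ℝ ∞ fun y : (ℝ × ℝ) × ℂ => y.1.1 := contDiff_fst.comp contDiff_fst
  have h12 : ContDiff ℝ ∞ fun y : (ℝ × ℝ) × ℂ => y.1.2 := contDiff_snd.comp contDiff_fst
  have hm : ContDiff ℝ ∞ fun y : (ℝ × ℝ) × ℂ => y.1.1 * y.1.2 := h11.mul h12
  have hz : ContDiff ℝ ∞ fun y : (ℝ × ℝ) × ℂ => (y.1.1 : ℂ) * y.2 :=
    (Complex.ofRealCLM.contDiff.comp h11).mul contDiff_snd
  have hq : ContDiffOn ℝ ∞ (fun y : (ℝ × ℝ) × ℂ => N.q₂ ((y.1.1, y.1.1 * y.1.2), y.1.1 * y.2))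
      ((Ico 0 δ₁ ×ˢ univ) ×ˢ univ) :=
    N.smooth_q₂.comp (f := fun y : (ℝ × ℝ) × ℂ => ((y.1.1, y.1.1 * y.1.2), (y.1.1 : ℂ) * y.2))
      ((h11.prodMk hm).prodMk hz).contDiffOn fun y hy => ⟨⟨hy.1.1, mem_univ _⟩, mem_univ _⟩
  have hp₃ : ContDiff ℝ ∞ fun y : (ℝ × ℝ) × ℂ => N.p₃ (y.1.1 * y.1.2, y.1.1 * y.2) :=
    N.smooth_p₃.comp (f := fun y : (ℝ × ℝ) × ℂ => (y.1.1 * y.1.2, (y.1.1 : ℂ) * y.2))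
      (hm.prodMk hz)
  exact (((Complex.ofRealCLM.contDiff.comp h12).mul (N.smooth_p₂.comp hm)).add
    (contDiff_snd.mul hp₃)).contDiffOn.add hq

lemma differentiable_scaled₂ {p : ℝ × ℝ} (hp : p ∈ Ico 0 δ₁ ×ˢ (univ : Set ℝ)) :
    Differentiable ℂ fun z => N.scaled₂ (p, z) := by
  have h1 : Differentiable ℂ fun z => N.p₃ (p.1 * p.2, p.1 * z) :=
    (N.holo_p₃ (p.1 * p.2)).comp (differentiable_id.const_mul (p.1 : ℂ))
  have h2 : Differentiable ℂ fun z => N.q₂ ((p.1, p.1 * p.2), p.1 * z) :=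
    (N.holo_q₂ (p.1, p.1 * p.2) ⟨hp.1, mem_univ _⟩).comp (differentiable_id.const_mul (p.1 : ℂ))
  simp only [scaled₂]
  fun_prop

lemma contDiffOn_scaled : ContDiffOn ℝ ∞ N.scaled ((Ico 0 δ₁ ×ˢ univ) ×ˢ univ) := by
  have h12 : ContDiff ℝ ∞ fun y : (ℝ × ℝ) × ℂ => ((y.1.2 : ℝ) : ℂ) :=
    Complex.ofRealCLM.contDiff.comp (contDiff_snd.comp contDiff_fst)
  have h0 : ContDiffOn ℝ ∞ (fun y : (ℝ × ℝ) × ℂ => N.scaled₀ y.1) ((Ico 0 δ₁ ×ˢ univ) ×ˢ univ) :=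
    N.contDiffOn_scaled₀.comp contDiffOn_fst fun y hy => hy.1
  have h1 : ContDiffOn ℝ ∞ (fun y : (ℝ × ℝ) × ℂ => N.scaled₁ y.1) ((Ico 0 δ₁ ×ˢ univ) ×ˢ univ) :=
    N.contDiffOn_scaled₁.comp contDiffOn_fst fun y hy => hy.1
  exact (((h12.pow 2).contDiffOn.mul h0).add ((h12.mul contDiff_snd).contDiffOn.mul h1)).add
    ((contDiff_snd.pow 2).contDiffOn.mul N.contDiffOn_scaled₂)

lemma contDiffOn_blowup : ContDiffOn ℝ ∞ N.blowup ((Ico 0 δ₁ ×ˢ univ) ×ˢ univ) := by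
  have h12 : ContDiff ℝ ∞ fun y : (ℝ × ℝ) × ℂ => ((y.1.2 : ℝ) : ℂ) :=
    Complex.ofRealCLM.contDiff.comp (contDiff_snd.comp contDiff_fst)
  have h0 : ContDiffOn ℝ ∞ (fun y : (ℝ × ℝ) × ℂ => N.scaled₀ y.1) ((Ico 0 δ₁ ×ˢ univ) ×ˢ univ) :=
    N.contDiffOn_scaled₀.comp contDiffOn_fst fun y hy => hy.1
  have h1 : ContDiffOn ℝ ∞ (fun y : (ℝ × ℝ) × ℂ => N.scaled₁ y.1) ((Ico 0 δ₁ ×ˢ univ) ×ˢ univ) :=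
    N.contDiffOn_scaled₁.comp contDiffOn_fst fun y hy => hy.1
  have h2 : ContDiffOn ℝ ∞ (fun y : (ℝ × ℝ) × ℂ => N.scaled₂ (y.1, y.1.2 * y.2))
      ((Ico 0 δ₁ ×ˢ univ) ×ˢ univ) :=
    N.contDiffOn_scaled₂.comp (f := fun y : (ℝ × ℝ) × ℂ => (y.1, (y.1.2 : ℂ) * y.2))
      (contDiff_fst.prodMk (h12.mul contDiff_snd)).contDiffOn fun y hy => ⟨hy.1, mem_univ _⟩
  exact (h0.add (contDiff_snd.contDiffOn.mul h1)).add ((contDiff_snd.pow 2).contDiffOn.mul h2)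

lemma differentiable_scaled {p : ℝ × ℝ} (hp : p ∈ Ico 0 δ₁ ×ˢ (univ : Set ℝ)) :
    Differentiable ℂ fun z => N.scaled (p, z) := by
  have h := N.differentiable_scaled₂ hp
  simp only [scaled]
  fun_prop

lemma differentiable_blowup {p : ℝ × ℝ} (hp : p ∈ Ico 0 δ₁ ×ˢ (univ : Set ℝ)) :
    Differentiable ℂ fun z => N.blowup (p, z) := by
  have h : Differentiable ℂ fun z => N.scaled₂ (p, p.2 * z) :=
    (N.differentiable_scaled₂ hp).comp (differentiable_id.const_mul (p.2 : ℂ))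
  simp only [blowup]
  fun_prop

/-- The homogeneous parts of lowest order, factorized. -/
structure IsFactored (α : Fin 3 → ℝ) (γ : ℝ) (β : Fin 2 → ℝ) : Prop where
  ne_zero : N.p₃ (0, 0) ≠ 0
  gamma_ne : γ ≠ 0
  beta_ne : β 0 ≠ β 1
  cubic : ∀ σ z : ℂ, σ ^ 3 * N.p₀ 0 + σ ^ 2 * z * N.p₁ 0 + σ * z ^ 2 * N.p₂ 0
    + z ^ 3 * N.p₃ (0, 0) = N.p₃ (0, 0) * ∏ j, (z - Complex.I * α j * σ)
  quadratic : ∀ z : ℂ, N.q₀ (0, 0) + z * N.q₁ (0, 0) + z ^ 2 * N.q₂ ((0, 0), 0)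
    = N.p₃ (0, 0) * (γ * ∏ k, (z - Complex.I * β k))
  q₂_eq : N.q₂ ((0, 0), 0) = N.p₃ (0, 0) * γ

variable {N} {α : Fin 3 → ℝ} {γ : ℝ} {β : Fin 2 → ℝ}

lemma IsFactored.swap (h : N.IsFactored α γ β) : N.IsFactored α γ ![β 1, β 0] where
  ne_zero := h.ne_zero
  gamma_ne := h.gamma_ne
  beta_ne := by simpa using h.beta_ne.symm
  cubic := h.cubic
  quadratic z := by
    rw [h.quadratic z, Fin.prod_univ_two, Fin.prod_univ_two]
    simp only [Matrix.cons_val_zero, Matrix.cons_val_one]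
    ring
  q₂_eq := h.q₂_eq

/-- In the main theorem the betas are quantified after the constants. As zeros of one fixed
quadratic they are determined up to order, so two choices have to be considered. -/
lemma IsFactored.eq_or_eq_swap (h : N.IsFactored α γ β) {β' : Fin 2 → ℝ}
    (h' : N.IsFactored α γ β') : β' = β ∨ β' = ![β 1, β 0] := by
  have hγ : (γ : ℂ) ≠ 0 := by exact_mod_cast h.gamma_ne
  have hroot : ∀ k, β k = β' 0 ∨ β k = β' 1 := fun k => by
    have h1 := (h'.quadratic (Complex.I * β k)).symm.trans (h.quadratic (Complex.I * β k))
    rw [Finset.prod_eq_zero (f := fun j => Complex.I * (β k : ℂ) - Complex.I * β j)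
      (Finset.mem_univ k) (sub_self _), mul_zero, mul_zero, mul_eq_zero, or_iff_right h.ne_zero,
      mul_eq_zero, or_iff_right hγ, Fin.prod_univ_two, mul_eq_zero] at h1
    refine h1.imp (fun e => ?_) fun e => ?_ <;>
    · rw [sub_eq_zero] at e
      exact_mod_cast mul_left_cancel₀ Complex.I_ne_zero e
  rcases hroot 0 with h0 | h0 <;> rcases hroot 1 with h1 | h1
  · exact absurd (h0.trans h1.symm) h.beta_ne
  · left
    ext k
    fin_cases k
    · exact h0.symm
    · exact h1.symm
  · right
    ext k
    fin_cases k
    · exact h1.symm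
    · exact h0.symm
  · exact absurd (h0.trans h1.symm) h.beta_ne

lemma IsFactored.scaled_zero (h : N.IsFactored α γ β) (z : ℂ) :
    N.scaled ((0, 0), z) = N.p₃ (0, 0) * (z ^ 2 * (z + γ)) := by
  simp only [scaled, scaled₂]
  simp
  rw [h.q₂_eq]
  ring

/-- At `δ = 0` the arguments of all coefficient functions collapse to the origin, so the formula is
exact for every `σ`. The term linear in `σ` is the source of the drift. -/
lemma IsFactored.blowup_zero (h : N.IsFactored α γ β) (σ : ℝ) (w : ℂ) :
    N.blowup ((0, σ), w) = N.p₃ (0, 0)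
      * (σ * ∏ j, (w - Complex.I * α j) + γ * ∏ k, (w - Complex.I * β k)) := by
  have h1 := h.cubic 1 w
  have h2 := h.quadratic w
  simp only [mul_one] at h1
  simp only [blowup, scaled₀, scaled₁, scaled₂]
  simp only [zero_mul, Complex.ofReal_zero]
  linear_combination σ * h1 + h2

/-- `-γ` is a simple zero of `z² (z + γ)`, and the radius `|γ| / 2` keeps the double zero `0`
outside the disc. -/
theorem IsFactored.exists_scaled_root (h : N.IsFactored α γ β) :
    ∃ ρ, 0 < ρ ∧ ρ < δ₁ ∧ ∃ ζ : ℝ × ℝ → ℂ, ContDiffOn ℝ ∞ ζ (rect ρ ρ) ∧ ζ (0, 0) = -γ ∧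
      ∀ p ∈ rect ρ ρ, ζ p ∈ ball (-γ : ℂ) (|γ| / 2) ∧ N.scaled (p, ζ p) = 0 := by
  have hγ : 0 < |γ| := abs_pos.2 h.gamma_ne
  have hγn : ‖(γ : ℂ)‖ = |γ| := by simp
  have hne : ∀ z ∈ closedBall (-γ : ℂ) (|γ| / 2), N.p₃ (0, 0) * z ^ 2 ≠ 0 := fun z hz => by
    refine mul_ne_zero h.ne_zero (pow_ne_zero 2 fun h0 => ?_)
    rw [h0, mem_closedBall, dist_eq_norm, zero_sub, neg_neg, hγn] at hz
    linarith
  obtain ⟨ρ, hρ, hρ₁, hsph⟩ := exists_rect_ne_zero N.pos N.contDiffOn_scaled.continuousOn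
    (isCompact_sphere (-γ : ℂ) (|γ| / 2)) fun z hz => by
      rw [h.scaled_zero, ← mul_assoc]
      refine mul_ne_zero (hne z (sphere_subset_closedBall hz)) fun h0 => ?_
      rw [mem_sphere, dist_eq_norm, sub_neg_eq_add, h0, norm_zero] at hz
      linarith
  have hsub := rect_subset_strip hρ₁ ρ
  have hz0 : HasZeros (fun z => N.scaled ((0, 0), z)) (-γ : ℂ) (|γ| / 2) {(-γ : ℂ)} :=
    ⟨fun z => N.p₃ (0, 0) * z ^ 2, by fun_prop, hne, by simpa using hγ, fun z => by
      simp only [h.scaled_zero]; simp; ring⟩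
  obtain ⟨ζ, hζ, hζp⟩ := exists_contDiffOn_zero (convex_rect ρ ρ) (uniqueDiffOn_rect hρ hρ)
    (N.contDiffOn_scaled.mono (prod_mono hsub le_rfl))
    (fun p hp => N.differentiable_scaled (hsub hp)) (half_pos hγ) hsph
    (zero_mem_rect hρ.le hρ.le) hz0
  refine ⟨ρ, hρ, hρ₁, ζ, hζ, ?_, fun p hp => ⟨(hζp p hp).1, (hζp p hp).2.1⟩⟩
  refine ((hζp _ (zero_mem_rect hρ.le hρ.le)).2.2 _ (mem_closedBall_self (by positivity)) ?_).symm
  rw [h.scaled_zero]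
  simp

/-- At `δ = σ = 0` the zeros are `iβ₀` and `iβ₁`. The radius, a third of their distance, excludes
the second zero and keeps the discs about the two zeros disjoint. -/
theorem IsFactored.exists_blowup_root (h : N.IsFactored α γ β) :
    ∃ ρ, 0 < ρ ∧ ρ < δ₁ ∧ ∃ ζ : ℝ × ℝ → ℂ, ContDiffOn ℝ ∞ ζ (rect ρ ρ) ∧
      ζ (0, 0) = Complex.I * β 0 ∧
      ∀ p ∈ rect ρ ρ, ζ p ∈ ball (Complex.I * β 0) (|β 0 - β 1| / 3) ∧ N.blowup (p, ζ p) = 0 ∧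
        ∀ z ∈ closedBall (Complex.I * β 0) (|β 0 - β 1| / 3), N.blowup (p, z) = 0 → z = ζ p := by
  have hβ : 0 < |β 0 - β 1| := abs_pos.2 (sub_ne_zero.2 h.beta_ne)
  have hr : 0 < |β 0 - β 1| / 3 := by positivity
  have hb0 : ∀ w, N.blowup ((0, 0), w)
      = (w - Complex.I * β 0) * (N.p₃ (0, 0) * γ * (w - Complex.I * β 1)) := fun w => by
    rw [h.blowup_zero, Fin.prod_univ_two]
    push_cast
    ring
  have hne : ∀ z ∈ closedBall (Complex.I * β 0) (|β 0 - β 1| / 3),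
      N.p₃ (0, 0) * γ * (z - Complex.I * β 1) ≠ 0 := fun z hz => by
    refine mul_ne_zero (mul_ne_zero h.ne_zero (by exact_mod_cast h.gamma_ne)) fun h0 => ?_
    rw [sub_eq_zero.1 h0, mem_closedBall, dist_eq_norm, ← mul_sub, norm_mul, Complex.norm_I,
      one_mul, ← Complex.ofReal_sub, Complex.norm_real, Real.norm_eq_abs, abs_sub_comm] at hz
    linarith
  obtain ⟨ρ, hρ, hρ₁, hsph⟩ := exists_rect_ne_zero N.pos N.contDiffOn_blowup.continuousOn
    (isCompact_sphere (Complex.I * β 0) (|β 0 - β 1| / 3)) fun z hz => by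
      rw [hb0]
      refine mul_ne_zero (fun h0 => ?_) (hne z (sphere_subset_closedBall hz))
      rw [mem_sphere, dist_eq_norm, h0, norm_zero] at hz
      linarith
  have hsub := rect_subset_strip hρ₁ ρ
  have hz0 : HasZeros (fun z => N.blowup ((0, 0), z)) (Complex.I * β 0) (|β 0 - β 1| / 3)
      {Complex.I * β 0} :=
    ⟨fun z => N.p₃ (0, 0) * γ * (z - Complex.I * β 1), by fun_prop, hne, by simpa using hβ,
      fun z => by simp only [hb0]; simp⟩
  obtain ⟨ζ, hζ, hζp⟩ := exists_contDiffOn_zero (convex_rect ρ ρ) (uniqueDiffOn_rect hρ hρ)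
    (N.contDiffOn_blowup.mono (prod_mono hsub le_rfl))
    (fun p hp => N.differentiable_blowup (hsub hp)) hr hsph
    (zero_mem_rect hρ.le hρ.le) hz0
  refine ⟨ρ, hρ, hρ₁, ζ, hζ, ?_, hζp⟩
  refine ((hζp _ (zero_mem_rect hρ.le hρ.le)).2.2 _ (mem_closedBall_self (by positivity)) ?_).symm
  rw [hb0, sub_self, zero_mul]

end NormalForm

end

end KdVKS

namespace KdVKS

noncomputable section

set_option linter.unusedSectionVars false

open Set Filter Topology Metric

/-! ### Expansion of the roots -/

/-- Oddness gives `u = σ v` with `v` even in `σ`, so `v(δ, σ) - v(δ, 0)` is divisible by `σ²`, while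
`v(δ, 0) - m` is divisible by `δ`. Parity improves the error from `|σ| (δ + |σ|)` to `|σ| (δ + σ²)`;
multiplied by `δ|σ|` this becomes `ξ² + ξ⁴/δ³`. -/
theorem exists_bound_of_odd {ρ : ℝ} (hρ : 0 < ρ) {u : ℝ × ℝ → ℝ}
    (hu : ContDiffOn ℝ ∞ u (rect ρ ρ))
    (hodd : ∀ δ ∈ Icc 0 ρ, ∀ σ ∈ Ioc 0 ρ, u (δ, -σ) = -u (δ, σ)) {m : ℝ}
    (hm : Tendsto (fun σ => u (0, σ) / σ) (𝓝[>] 0) (𝓝 m)) :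
    ∃ C, 0 ≤ C ∧ ∀ p ∈ rect ρ ρ, |u p - p.2 * m| ≤ C * |p.2| * (p.1 + p.2 ^ 2) := by
  have hJ : UniqueDiffOn ℝ (Icc (-ρ) ρ) := uniqueDiffOn_Icc (by linarith)
  have hJc : Convex ℝ (Icc (-ρ) ρ) := convex_Icc _ _
  have hI : UniqueDiffOn ℝ (Icc 0 ρ) := uniqueDiffOn_Icc hρ
  have hIc : Convex ℝ (Icc 0 ρ) := convex_Icc _ _
  have h0J : (0 : ℝ) ∈ Icc (-ρ) ρ := ⟨by linarith, hρ.le⟩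
  have h0I : (0 : ℝ) ∈ Icc 0 ρ := ⟨le_rfl, hρ.le⟩
  have hslice : ∀ f : ℝ × ℝ → ℝ, ContDiffOn ℝ ∞ f (rect ρ ρ) → ∀ δ ∈ Icc 0 ρ,
      ContinuousOn (fun σ => f (δ, σ)) (Ico 0 ρ) ∧ ContinuousOn (fun σ => f (δ, -σ)) (Ico 0 ρ) := by
    refine fun f hf δ hδ => ⟨?_, ?_⟩
    · exact hf.continuousOn.comp (f := fun σ : ℝ => (δ, σ)) (by fun_prop)
        fun σ hσ => ⟨hδ, by linarith [hσ.1], hσ.2.le⟩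
    · exact hf.continuousOn.comp (f := fun σ : ℝ => (δ, -σ)) (by fun_prop)
        fun σ hσ => ⟨hδ, by linarith [hσ.2], by linarith [hσ.1]⟩
  have hodd0 : ∀ f : ℝ × ℝ → ℝ, ContDiffOn ℝ ∞ f (rect ρ ρ) →
      (∀ δ ∈ Icc 0 ρ, ∀ σ ∈ Ioc 0 ρ, f (δ, -σ) = -f (δ, σ)) → ∀ δ ∈ Icc 0 ρ, f (δ, 0) = 0 := by
    intro f hf hfo δ hδ
    have h1 := eq_zero_of_forall_Ioo (f := fun σ => f (δ, -σ) + f (δ, σ)) hρ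
      ((hslice f hf δ hδ).2.add (hslice f hf δ hδ).1) fun σ hσ => by
        rw [hfo δ hδ σ ⟨hσ.1, hσ.2.le⟩]; ring
    simp only [neg_zero] at h1
    linarith
  have hneg : ∀ σ ∈ Ioc 0 ρ, -σ ∈ Icc (-ρ) ρ := fun σ hσ =>
    ⟨by linarith [hσ.2], by linarith [hσ.1]⟩
  have hpos : ∀ σ ∈ Ioc 0 ρ, σ ∈ Icc (-ρ) ρ := fun σ hσ => ⟨by linarith [hσ.1], hσ.2⟩
  obtain ⟨v, hv, huv⟩ := exists_contDiffOn_snd hJc hJ h0J hIc hI hu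
  have huv' : ∀ δ ∈ Icc 0 ρ, ∀ σ ∈ Icc (-ρ) ρ, u (δ, σ) = σ * v (δ, σ) := fun δ hδ σ hσ => by
    rw [huv δ hδ σ hσ, hodd0 u hu hodd δ hδ, zero_add, smul_eq_mul]
  have hveven : ∀ δ ∈ Icc 0 ρ, ∀ σ ∈ Ioc 0 ρ, v (δ, -σ) = v (δ, σ) := fun δ hδ σ hσ => by
    have h1 := hodd δ hδ σ hσ
    rw [huv' δ hδ _ (hneg σ hσ), huv' δ hδ _ (hpos σ hσ)] at h1
    exact mul_left_cancel₀ hσ.1.ne' (by linarith)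
  obtain ⟨w, hw, hvw⟩ := exists_contDiffOn_snd hJc hJ h0J hIc hI hv
  have hwodd : ∀ δ ∈ Icc 0 ρ, ∀ σ ∈ Ioc 0 ρ, w (δ, -σ) = -w (δ, σ) := fun δ hδ σ hσ => by
    have h1 := hveven δ hδ σ hσ
    rw [hvw δ hδ _ (hneg σ hσ), hvw δ hδ _ (hpos σ hσ), smul_eq_mul, smul_eq_mul] at h1
    exact mul_left_cancel₀ hσ.1.ne' (by linarith)
  obtain ⟨x, hx, hwx⟩ := exists_contDiffOn_snd hJc hJ h0J hIc hI hw
  obtain ⟨y, hy, hvy⟩ := exists_contDiffOn_fst hIc hI h0I hJc hJ hv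
  have hcomp : IsCompact (rect ρ ρ) := isCompact_Icc.prod isCompact_Icc
  obtain ⟨Cx, hCx⟩ := hcomp.exists_bound_of_continuousOn hx.continuousOn
  obtain ⟨Cy, hCy⟩ := hcomp.exists_bound_of_continuousOn hy.continuousOn
  have hv0 : v (0, 0) = m := by
    have h1 : Tendsto (fun σ => v (0, σ)) (𝓝[>] 0) (𝓝 (v (0, 0))) :=
      ((hslice v hv 0 h0I).1 0 ⟨le_rfl, hρ⟩).mono_left (by
        rw [nhdsWithin_Ico_eq_nhdsGE hρ]
        exact nhdsWithin_mono _ Ioi_subset_Ici_self)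
    refine tendsto_nhds_unique h1 (hm.congr' ?_)
    filter_upwards [Ioo_mem_nhdsGT hρ] with σ hσ
    rw [huv' 0 h0I σ ⟨by linarith [hσ.1], hσ.2.le⟩, mul_div_cancel_left₀ _ hσ.1.ne']
  have hCx0 : 0 ≤ Cx := (norm_nonneg _).trans (hCx (0, 0) ⟨h0I, h0J⟩)
  have hCy0 : 0 ≤ Cy := (norm_nonneg _).trans (hCy (0, 0) ⟨h0I, h0J⟩)
  refine ⟨max Cx Cy, le_max_of_le_left hCx0, ?_⟩
  rintro ⟨δ, σ⟩ ⟨hδ, hσ⟩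
  have h1 : v (δ, σ) - m = δ * y (δ, 0) + σ ^ 2 * x (δ, σ) := by
    rw [hvw δ hδ σ hσ, hwx δ hδ σ hσ, hodd0 w hw hwodd δ hδ, hvy δ hδ 0 h0J, hv0]
    simp only [smul_eq_mul]
    ring
  have hδ0 : (0 : ℝ) ≤ δ := hδ.1
  have h2 : |v (δ, σ) - m| ≤ max Cx Cy * (δ + σ ^ 2) := by
    rw [h1]
    refine (abs_add_le _ _).trans ?_
    rw [abs_mul, abs_mul, abs_of_nonneg hδ0, abs_of_nonneg (sq_nonneg σ), mul_add]
    have e1 : |y (δ, 0)| ≤ max Cx Cy := (hCy (δ, 0) ⟨hδ, h0J⟩).trans (le_max_right _ _)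
    have e2 : |x (δ, σ)| ≤ max Cx Cy := (hCx (δ, σ) ⟨hδ, hσ⟩).trans (le_max_left _ _)
    have e3 := mul_le_mul_of_nonneg_left e1 hδ0
    have e4 := mul_le_mul_of_nonneg_left e2 (sq_nonneg σ)
    linarith
  change |u (δ, σ) - σ * m| ≤ max Cx Cy * |σ| * (δ + σ ^ 2)
  rw [huv' δ hδ σ hσ, ← mul_sub, abs_mul]
  calc |σ| * |v (δ, σ) - m| ≤ |σ| * (max Cx Cy * (δ + σ ^ 2)) := by gcongr
    _ = _ := by ring

namespace NormalForm

variable {δ₁ : ℝ} {E : (ℝ × ℝ) × ℂ → ℂ} {N : NormalForm δ₁ E} {α : Fin 3 → ℝ} {γ : ℝ}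
  {β : Fin 2 → ℝ}

/-- With `lam = δσw` the conjugation symmetry reads `(σ, w) ↦ (-σ, -w̄)`. It follows for `δ > 0`
after cancelling `δ³σ²`, and for `δ = 0` by continuity. -/
theorem blowup_conj (hE : ∀ δ ∈ Ico 0 δ₁, ∀ (ξ : ℝ) (z : ℂ),
      E ((δ, -ξ), (starRingEnd ℂ) z) = (starRingEnd ℂ) (E ((δ, ξ), z)))
    {δ σ : ℝ} (hδ : δ ∈ Ico 0 δ₁) (hσ : σ ≠ 0) (w : ℂ) :
    N.blowup ((δ, -σ), -(starRingEnd ℂ) w) = (starRingEnd ℂ) (N.blowup ((δ, σ), w)) := by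
  have key : ∀ δ ∈ Ioo 0 δ₁, N.blowup ((δ, -σ), -(starRingEnd ℂ) w)
      - (starRingEnd ℂ) (N.blowup ((δ, σ), w)) = 0 := fun δ hδ => by
    have hδI : δ ∈ Ico 0 δ₁ := ⟨hδ.1.le, hδ.2⟩
    have hne : (δ : ℂ) ^ 3 * (σ : ℂ) ^ 2 ≠ 0 := mul_ne_zero
      (pow_ne_zero _ (by exact_mod_cast hδ.1.ne')) (pow_ne_zero _ (by exact_mod_cast hσ))
    have h1 := N.eq_scaled hδI σ (σ * w)
    have h2 := N.eq_scaled hδI (-σ) (((-σ : ℝ) : ℂ) * -(starRingEnd ℂ) w)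
    rw [scaled_eq_blowup] at h1 h2
    have h3 := hE δ hδI (δ * σ) (δ * (σ * w))
    rw [h1] at h3
    have h4 : ((δ, -(δ * σ)), (starRingEnd ℂ) ((δ : ℂ) * (σ * w)))
        = ((δ, δ * -σ), (δ : ℂ) * (((-σ : ℝ) : ℂ) * -(starRingEnd ℂ) w)) := by
      simp
    rw [h4, h2] at h3
    simp only [map_mul, map_pow, Complex.conj_ofReal] at h3
    push_cast at h3
    refine (mul_eq_zero.1 (?_ : (δ : ℂ) ^ 3 * (σ : ℂ) ^ 2 * _ = 0)).resolve_left hne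
    linear_combination h3
  rcases hδ.1.lt_or_eq with h | h
  · exact sub_eq_zero.1 (key δ ⟨h, hδ.2⟩)
  · rw [← h]
    refine sub_eq_zero.1 (eq_zero_of_forall_Ioo (f := fun δ =>
      N.blowup ((δ, -σ), -(starRingEnd ℂ) w) - (starRingEnd ℂ) (N.blowup ((δ, σ), w)))
      N.pos ?_ key)
    have hc : ∀ (τ : ℝ) (v : ℂ), ContinuousOn (fun δ : ℝ => N.blowup ((δ, τ), v)) (Ico 0 δ₁) :=
      fun τ v => N.contDiffOn_blowup.continuousOn.comp (f := fun δ : ℝ => ((δ, τ), v))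
        (by fun_prop) fun δ hδ => ⟨⟨hδ, mem_univ _⟩, mem_univ _⟩
    exact (hc _ _).sub (Complex.continuous_conj.comp_continuousOn (hc _ _))

/-- The zero in the disc is unique and the disc is invariant under `w ↦ -w̄`, so `ζ(δ, -σ)` is minus
the conjugate of `ζ(δ, σ)` and the real part is odd in `σ`. Its slope comes from the exact equation
at `δ = 0`, rewritten as `(ζ - iβ₀)/σ = -∏ (ζ - iα_j) / (γ (ζ - iβ₁))`. -/
theorem IsFactored.exists_blowup_root_expansion (h : N.IsFactored α γ β)
    (hE : ∀ δ ∈ Ico 0 δ₁, ∀ (ξ : ℝ) (z : ℂ),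
      E ((δ, -ξ), (starRingEnd ℂ) z) = (starRingEnd ℂ) (E ((δ, ξ), z))) :
    ∃ ρ, 0 < ρ ∧ ρ < δ₁ ∧ ∃ ζ : ℝ × ℝ → ℂ, ContDiffOn ℝ ∞ ζ (rect ρ ρ) ∧
      (∀ p ∈ rect ρ ρ, ζ p ∈ ball (Complex.I * β 0) (|β 0 - β 1| / 3) ∧ N.blowup (p, ζ p) = 0) ∧
      ∃ C, 0 ≤ C ∧ ∀ p ∈ rect ρ ρ,
        |(ζ p).re - p.2 * (driftCoeff α (β 0) (β 1) / γ)| ≤ C * |p.2| * (p.1 + p.2 ^ 2) := by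
  obtain ⟨ρ, hρ, hρ₁, ζ, hζ, hζ0, hζp⟩ := h.exists_blowup_root
  refine ⟨ρ, hρ, hρ₁, ζ, hζ, fun p hp => ⟨(hζp p hp).1, (hζp p hp).2.1⟩, ?_⟩
  have hre : ContDiffOn ℝ ∞ (fun p => (ζ p).re) (rect ρ ρ) :=
    Complex.reCLM.contDiff.comp_contDiffOn hζ
  refine exists_bound_of_odd hρ hre (fun δ hδ σ hσ => ?_) ?_
  · have hp : (δ, σ) ∈ rect ρ ρ := ⟨hδ, by linarith [hσ.1], hσ.2⟩
    have hp' : (δ, -σ) ∈ rect ρ ρ := ⟨hδ, by linarith [hσ.2], by linarith [hσ.1]⟩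
    have h1 : -(starRingEnd ℂ) (ζ (δ, σ)) = ζ (δ, -σ) := by
      refine (hζp _ hp').2.2 _ ?_ ?_
      · have h2 := ball_subset_closedBall (hζp _ hp).1
        rw [mem_closedBall, dist_eq_norm] at h2 ⊢
        refine le_trans (le_of_eq ?_) h2
        rw [← Complex.norm_conj, ← norm_neg]
        congr 1
        simp
        ring
      · rw [blowup_conj hE ⟨hδ.1, hδ.2.trans_lt hρ₁⟩ hσ.1.ne', (hζp _ hp).2.1, map_zero]
    simp only [← h1]
    simp
  · have hβ : (β 0 : ℂ) - β 1 ≠ 0 := by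
      rw [← Complex.ofReal_sub]
      exact_mod_cast sub_ne_zero.2 h.beta_ne
    have hγ : (γ : ℂ) ≠ 0 := by exact_mod_cast h.gamma_ne
    have hc : Tendsto (fun σ => ζ (0, σ)) (𝓝[>] 0) (𝓝 (Complex.I * β 0)) := by
      have h1 : ContinuousOn (fun σ => ζ (0, σ)) (Ico 0 ρ) :=
        hζ.continuousOn.comp (f := fun σ : ℝ => ((0 : ℝ), σ)) (by fun_prop)
          fun σ hσ => ⟨⟨le_rfl, hρ.le⟩, by linarith [hσ.1], hσ.2.le⟩
      rw [← hζ0]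
      exact (h1 0 ⟨le_rfl, hρ⟩).mono_left (by
        rw [nhdsWithin_Ico_eq_nhdsGE hρ]
        exact nhdsWithin_mono _ Ioi_subset_Ici_self)
    have hden : (γ : ℂ) * (Complex.I * β 0 - Complex.I * β 1) ≠ 0 := by
      rw [← mul_sub]
      exact mul_ne_zero hγ (mul_ne_zero Complex.I_ne_zero hβ)
    have hlim : Tendsto (fun σ => (-(∏ j, (ζ (0, σ) - Complex.I * α j))
        / (γ * (ζ (0, σ) - Complex.I * β 1))).re) (𝓝[>] 0)
        (𝓝 (-(∏ j, (Complex.I * β 0 - Complex.I * α j))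
          / (γ * (Complex.I * β 0 - Complex.I * β 1))).re) := by
      refine (Complex.continuous_re.tendsto _).comp (Tendsto.div ?_ ?_ hden)
      · exact (tendsto_finsetProd _ fun j _ => hc.sub_const _).neg
      · exact (hc.sub_const _).const_mul _
    -- The powers of `i` combine to `-i³/i = 1`, so the limit is real.
    have hval : (-(∏ j, (Complex.I * β 0 - Complex.I * α j))
          / (γ * (Complex.I * β 0 - Complex.I * β 1))).re = driftCoeff α (β 0) (β 1) / γ := by
      have : -(∏ j, (Complex.I * β 0 - Complex.I * α j))
          / (γ * (Complex.I * β 0 - Complex.I * β 1))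
          = ((driftCoeff α (β 0) (β 1) / γ : ℝ) : ℂ) := by
        rw [driftCoeff, Fin.prod_univ_three, Fin.prod_univ_three]
        push_cast
        rw [div_div, div_eq_div_iff hden (mul_ne_zero hβ hγ)]
        linear_combination -(γ * (β 0 - β 1) * ((β 0 : ℂ) - α 0) * (β 0 - α 1) * (β 0 - α 2)
          * Complex.I) * Complex.I_sq
      rw [this, Complex.ofReal_re]
    rw [hval] at hlim
    refine hlim.congr' ?_
    filter_upwards [Ioo_mem_nhdsGT hρ] with σ hσ
    have hp : ((0 : ℝ), σ) ∈ rect ρ ρ := ⟨⟨le_rfl, hρ.le⟩, by linarith [hσ.1], hσ.2.le⟩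
    have hσ0 : (σ : ℂ) ≠ 0 := by exact_mod_cast hσ.1.ne'
    have h1 := (hζp _ hp).2.1
    rw [h.blowup_zero, mul_eq_zero, or_iff_right h.ne_zero, Fin.prod_univ_two] at h1
    have h2 : ζ (0, σ) - Complex.I * β 1 ≠ 0 := fun h0 => by
      have h3 := (hζp _ hp).1
      rw [sub_eq_zero.1 h0, mem_ball, dist_eq_norm, ← mul_sub, norm_mul, Complex.norm_I, one_mul,
        ← Complex.ofReal_sub, Complex.norm_real, Real.norm_eq_abs, abs_sub_comm] at h3
      linarith [abs_nonneg (β 0 - β 1)]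
    have h4 : -(∏ j, (ζ (0, σ) - Complex.I * α j)) / (γ * (ζ (0, σ) - Complex.I * β 1))
        = (ζ (0, σ) - Complex.I * β 0) / σ := by
      rw [div_eq_div_iff (mul_ne_zero hγ h2) hσ0]
      linear_combination -h1
    rw [h4, Complex.div_ofReal_re]
    simp

end NormalForm

end

end KdVKS

namespace KdVKS

noncomputable section

set_option linter.unusedSectionVars false

open Set Filter Topology Metric

/-! ### The three small roots -/

lemma HasZeros.const_mul {f : ℂ → ℂ} {c : ℂ} {r : ℝ} {s : Multiset ℂ} (h : HasZeros f c r s)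
    {k : ℂ} (hk : k ≠ 0) : HasZeros (fun z => k * f z) c r s := by
  obtain ⟨g, hg, hgne, hs, hfg⟩ := h
  exact ⟨fun z => k * g z, hg.const_mul k, fun z hz => mul_ne_zero hk (hgne z hz), hs,
    fun z => by simp only [hfg]; ring⟩

/-- The cofactors agree off `a`, hence everywhere by continuity. -/
lemma HasZeros.of_cons {f h : ℂ → ℂ} {c a : ℂ} {r : ℝ} {s : Multiset ℂ}
    (hf : HasZeros f c r (a ::ₘ s)) (hh : Continuous h) (hfh : ∀ z, f z = (z - a) * h z) :
    HasZeros h c r s := by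
  obtain ⟨f₁, hf₁, hz, hff₁⟩ := hf.cons_inv
  have : f₁ = h := Continuous.ext_on (dense_compl_singleton a) hf₁.continuous hh fun z hz => by
    have hza : z - a ≠ 0 := sub_ne_zero.2 hz
    exact mul_left_cancel₀ hza ((hff₁ z).symm.trans (hfh z))
  rwa [← this]

lemma eq_of_card_three {s : Multiset ℂ} (hs : Multiset.card s = 3) {a b c : ℂ} (ha : a ∈ s)
    (hb : b ∈ s) (hc : c ∈ s) (hab : a ≠ b) (hac : a ≠ c) (hbc : b ≠ c) : s = {a, b, c} := by
  have hnd : ({a, b, c} : Multiset ℂ).Nodup := by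
    simp [hab, hac, hbc]
  refine (Multiset.eq_of_le_of_card_le ((Multiset.le_iff_subset hnd).2 ?_) (by simp [hs])).symm
  intro x hx
  simp only [Multiset.insert_eq_cons, Multiset.mem_cons, Multiset.mem_singleton] at hx
  rcases hx with rfl | rfl | rfl <;> assumption

lemma exists_pos_le_all (l : List ℝ) (hl : ∀ x ∈ l, 0 < x) : ∃ ρ, 0 < ρ ∧ ∀ x ∈ l, ρ ≤ x := by
  induction l with
  | nil => exact ⟨1, one_pos, by simp⟩
  | cons a l ih =>
    obtain ⟨ρ, hρ, h⟩ := ih fun x hx => hl x (List.mem_cons_of_mem _ hx)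
    refine ⟨min a ρ, lt_min (hl a List.mem_cons_self) hρ, fun x hx => ?_⟩
    rcases List.mem_cons.1 hx with rfl | hx
    · exact min_le_left _ _
    · exact (min_le_right _ _).trans (h x hx)

namespace NormalForm

variable {δ₁ : ℝ} {E : (ℝ × ℝ) × ℂ → ℂ} (N : NormalForm δ₁ E)

/-- At the origin of parameters the function is `z³ p₃(0, z)` with `p₃(0, 0) ≠ 0`, so a small disc
contains exactly a triple zero; the count persists as long as the circle stays free of zeros. -/
theorem exists_three_zeros (hEs : ContDiffOn ℝ ∞ E ((Ico 0 δ₁ ×ˢ univ) ×ˢ univ))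
    (hEd : ∀ p ∈ Ico 0 δ₁ ×ˢ (univ : Set ℝ), Differentiable ℂ fun z => E (p, z))
    (hΓ : N.p₃ (0, 0) ≠ 0) : ∃ M ρ, 0 < M ∧ 0 < ρ ∧ ρ < δ₁ ∧ ∀ p ∈ rect ρ ρ,
      ∃ s, Multiset.card s = 3 ∧ HasZeros (fun z => E (p, z)) 0 M s := by
  have hE0 : ∀ z, E ((0, 0), z) = z ^ 3 * N.p₃ (0, z) := fun z => by
    rw [N.eq_zero_delta]
    simp
  have hev : ∀ᶠ z in 𝓝 (0 : ℂ), N.p₃ (0, z) ≠ 0 :=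
    (N.holo_p₃ 0).continuous.continuousAt.eventually_ne hΓ
  obtain ⟨r, hr, hb⟩ := Metric.eventually_nhds_iff.1 hev
  have hM : 0 < r / 2 := half_pos hr
  have hne : ∀ z ∈ closedBall (0 : ℂ) (r / 2), N.p₃ (0, z) ≠ 0 := fun z hz =>
    hb ((mem_closedBall.1 hz).trans_lt (half_lt_self hr))
  obtain ⟨ρ, hρ, hρ₁, hsph⟩ := exists_rect_ne_zero N.pos hEs.continuousOn
    (isCompact_sphere (0 : ℂ) (r / 2)) fun z hz => by
      rw [hE0]
      refine mul_ne_zero (pow_ne_zero _ fun h0 => ?_) (hne z (sphere_subset_closedBall hz))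
      rw [h0, mem_sphere, dist_self] at hz
      linarith
  have hsub := rect_subset_strip hρ₁ ρ
  have hz0 : HasZeros (fun z => E ((0, 0), z)) 0 (r / 2) {0, 0, 0} :=
    ⟨fun z => N.p₃ (0, z), N.holo_p₃ 0, hne, by simpa using hr, fun z => by
      simp only [hE0, Multiset.insert_eq_cons, Multiset.map_cons, Multiset.map_singleton,
        Multiset.prod_cons, Multiset.prod_singleton]
      ring⟩
  refine ⟨r / 2, ρ, hM, hρ, hρ₁, fun p hp => ?_⟩
  obtain ⟨s, hs⟩ := exists_hasZeros (hEd p (hsub hp)) hM.le (hsph p hp)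
  exact ⟨s, card_zeros_eq (convex_rect ρ ρ) (uniqueDiffOn_rect hρ hρ)
    (hEs.mono (prod_mono hsub le_rfl)) (fun p hp => hEd p (hsub hp)) hM hsph hp
    (zero_mem_rect hρ.le hρ.le) hs hz0, hs⟩

/-- For `σ ≠ 0` three distinct zeros are exhibited and there are three in all. For `σ = 0` two of
them merge at `0`, so the factor `w²` is divided out explicitly and `δz` has to be the remaining
zero. -/
theorem eq_roots {δ σ M : ℝ} (hδ : δ ∈ Ico 0 δ₁) (hδ0 : 0 < δ) {s : Multiset ℂ}
    (hcard : Multiset.card s = 3) (hs : HasZeros (fun z => E ((δ, δ * σ), z)) 0 M s)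
    {y₀ y₁ z : ℂ} (h₀ : N.blowup ((δ, σ), y₀) = 0) (h₁ : N.blowup ((δ, σ), y₁) = 0)
    (hz : N.scaled ((δ, σ), z) = 0) (hy : y₀ ≠ y₁) (hy₀ : ‖σ * y₀‖ < ‖z‖) (hy₁ : ‖σ * y₁‖ < ‖z‖)
    (hzM : ‖δ * z‖ ≤ M) : s = {δ * (σ * y₀), δ * (σ * y₁), δ * z} := by
  have hδc : (δ : ℂ) ≠ 0 := by exact_mod_cast hδ0.ne'
  have hz0 : z ≠ 0 := fun h => by
    rw [h, norm_zero] at hy₀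
    exact absurd hy₀ (norm_nonneg ((σ : ℂ) * y₀)).not_gt
  have hM : ∀ y : ℂ, ‖σ * y‖ < ‖z‖ → (δ : ℂ) * (σ * y) ∈ closedBall (0 : ℂ) M := fun y hy => by
    rw [mem_closedBall_zero_iff]
    refine le_trans ?_ hzM
    rw [norm_mul, norm_mul (δ : ℂ) z]
    exact mul_le_mul_of_nonneg_left hy.le (norm_nonneg (δ : ℂ))
  have hzM' : (δ : ℂ) * z ∈ closedBall (0 : ℂ) M := mem_closedBall_zero_iff.2 hzM
  by_cases hσ : σ = 0
  · subst hσ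
    set k : ℂ → ℂ := fun w => w * N.p₃ (0, w) + δ * N.q₂ ((δ, 0), w) with hk
    have hkc : Continuous k :=
      (continuous_id.mul (N.holo_p₃ 0).continuous).add
        (continuous_const.mul (N.holo_q₂ (δ, 0) ⟨hδ, mem_univ _⟩).continuous)
    have hEk : ∀ w, E ((δ, δ * 0), w) = (w - 0) * ((w - 0) * k w) := fun w => by
      rw [mul_zero, N.eq δ hδ, hk]
      simp
      ring
    have h0M : (0 : ℂ) ∈ closedBall (0 : ℂ) M :=
      mem_closedBall_self ((norm_nonneg _).trans hzM)
    obtain ⟨s₁, rfl⟩ := Multiset.exists_cons_of_mem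
      (hs.mem_of_eq_zero h0M (by rw [hEk]; simp))
    have hs₁ := hs.of_cons (h := fun w => (w - 0) * k w) (by fun_prop) hEk
    obtain ⟨s₂, rfl⟩ := Multiset.exists_cons_of_mem (hs₁.mem_of_eq_zero h0M (by simp))
    have hs₂ := hs₁.of_cons hkc fun w => rfl
    have hkz : k (δ * z) = 0 := by
      have h1 := N.eq_scaled hδ 0 z
      rw [hz, hEk, mul_zero] at h1
      simpa [hδc, hz0] using h1
    have hmem := hs₂.mem_of_eq_zero hzM' hkz
    simp only [Multiset.card_cons] at hcard
    obtain ⟨b, rfl⟩ := Multiset.card_eq_one.1 (by omega : Multiset.card s₂ = 1)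
    rw [Multiset.mem_singleton] at hmem
    simp [hmem]
  · have hσc : (σ : ℂ) ≠ 0 := by exact_mod_cast hσ
    have hzero : ∀ y, N.blowup ((δ, σ), y) = 0 → E ((δ, δ * σ), δ * (σ * y)) = 0 := fun y hy => by
      rw [N.eq_scaled hδ, scaled_eq_blowup, hy, mul_zero, mul_zero]
    have hzz : E ((δ, δ * σ), δ * z) = 0 := by rw [N.eq_scaled hδ, hz, mul_zero]
    have hne : ∀ y : ℂ, ‖σ * y‖ < ‖z‖ → (δ : ℂ) * (σ * y) ≠ δ * z := fun y hy h => by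
      rw [mul_left_cancel₀ hδc h] at hy
      exact lt_irrefl _ hy
    exact eq_of_card_three hcard (hs.mem_of_eq_zero (hM _ hy₀) (hzero _ h₀))
      (hs.mem_of_eq_zero (hM _ hy₁) (hzero _ h₁)) (hs.mem_of_eq_zero hzM' hzz)
      (fun h => hy (mul_left_cancel₀ hσc (mul_left_cancel₀ hδc h))) (hne _ hy₀) (hne _ hy₁)

end NormalForm

end

end KdVKS

namespace KdVKS

noncomputable section

set_option linter.unusedSectionVars false

open Set Filter Topology Metric

/-! ### Smooth roots, their expansion, and dissipativity -/

/-- The properties of the roots `lam_j(ξ, δ) = Λ j (δ, ξ / δ)` for given real, distinct betas. -/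
def HasSmoothRoots (X : ℝ) (U : ℝ → ℝ → ℝ) (c : ℝ → ℝ) (α : Fin 3 → ℝ) (ε₀ η₀ M₀ : ℝ)
    (β : Fin 2 → ℝ) : Prop :=
  ∃ Λ : Fin 3 → ℝ × ℝ → ℂ,
    (∀ j, ContDiffOn ℝ ∞ (Λ j) (Icc 0 η₀ ×ˢ Icc (-ε₀) ε₀)) ∧
    (∀ δ ξ : ℝ, 0 < δ → δ ≤ η₀ → |ξ| ≤ ε₀ * δ →
      AreTheRoots (fun lam => evans X δ (U δ) (c δ) lam ξ) M₀ (fun j => Λ j (δ, ξ / δ))) ∧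
    (∀ κ : ℝ, 0 < κ → ∃ ρ : ℝ, 0 < ρ ∧
      ∀ δ ξ : ℝ, 0 < δ → δ ≤ η₀ → |ξ| ≤ ε₀ * δ → δ ≤ ρ → |ξ| ≤ ρ * δ →
        |(Λ 2 (δ, ξ / δ)).re + gammaCoeff X U c * δ| ≤ κ * δ) ∧
    (∃ C : ℝ, ∀ δ ξ : ℝ, 0 < δ → δ ≤ η₀ → |ξ| ≤ ε₀ * δ →
      |(Λ 0 (δ, ξ / δ)).re - ξ ^ 2 / (gammaCoeff X U c * δ)
          * driftCoeff α (β 0) (β 1)| ≤ C * (ξ ^ 2 + ξ ^ 4 / δ ^ 3) ∧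
      |(Λ 1 (δ, ξ / δ)).re - ξ ^ 2 / (gammaCoeff X U c * δ)
          * driftCoeff α (β 1) (β 0)| ≤ C * (ξ ^ 2 + ξ ^ 4 / δ ^ 3)) ∧
    (α 0 < β 0 → β 0 < α 1 → α 1 < β 1 → β 1 < α 2 → 0 < gammaCoeff X U c →
      ∃ θ : ℝ, 0 < θ ∧ ∀ δ ξ : ℝ, 0 < δ → δ ≤ η₀ → |ξ| ≤ ε₀ * δ →
        (Λ 0 (δ, ξ / δ)).re ≤ -(θ / δ) * ξ ^ 2 ∧
        (Λ 1 (δ, ξ / δ)).re ≤ -(θ / δ) * ξ ^ 2 ∧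
        ∀ lam : ℂ, ‖lam‖ ≤ M₀ → IsBlochEigenvalue X δ (U δ) (c δ) ξ lam →
          lam.re ≤ -(θ / δ) * ξ ^ 2)

lemma norm_lt_of_mem_ball {b d : ℝ} {y : ℂ} (h : y ∈ ball (Complex.I * b) (d / 3)) (hd : 0 ≤ d) :
    ‖y‖ < |b| + d + 1 := by
  rw [mem_ball, dist_eq_norm] at h
  have h1 : ‖y‖ ≤ ‖y - Complex.I * b‖ + ‖Complex.I * (b : ℂ)‖ := by
    simpa using norm_add_le (y - Complex.I * b) (Complex.I * b)
  rw [norm_mul, Complex.norm_I, one_mul, Complex.norm_real, Real.norm_eq_abs] at h1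
  linarith

/-- By interlacing, `∏ (b - α_j)` has two negative factors at `b₀` and one at `b₁`, and the
denominator changes sign accordingly. -/
lemma driftCoeff_neg {α : Fin 3 → ℝ} {b₀ b₁ : ℝ} (h0 : α 0 < b₀) (h1 : b₀ < α 1) (h2 : α 1 < b₁)
    (h3 : b₁ < α 2) : driftCoeff α b₀ b₁ < 0 ∧ driftCoeff α b₁ b₀ < 0 := by
  simp only [driftCoeff, Fin.prod_univ_three]
  constructor
  · refine div_neg_of_pos_of_neg ?_ (by linarith)
    exact mul_pos_of_neg_of_neg (mul_neg_of_pos_of_neg (by linarith) (by linarith)) (by linarith)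
  · refine div_neg_of_neg_of_pos ?_ (by linarith)
    exact mul_neg_of_pos_of_neg (mul_pos (by linarith) (by linarith)) (by linarith)

lemma re_mul_expansion {δ σ u m C : ℝ} (hδ : 0 ≤ δ)
    (h : |u - σ * m| ≤ C * |σ| * (δ + σ ^ 2)) :
    |δ * (σ * u) - δ * σ ^ 2 * m| ≤ C * (δ * σ ^ 2) * (δ + σ ^ 2) := by
  have h1 : δ * (σ * u) - δ * σ ^ 2 * m = δ * σ * (u - σ * m) := by ring
  rw [h1, abs_mul, abs_mul, abs_of_nonneg hδ]
  calc δ * |σ| * |u - σ * m| ≤ δ * |σ| * (C * |σ| * (δ + σ ^ 2)) := by gcongr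
    _ = C * (δ * |σ| ^ 2) * (δ + σ ^ 2) := by ring
    _ = _ := by rw [sq_abs]

lemma le_neg_mul_of_abs_sub_le {R q m K κ t : ℝ} (hq : 0 ≤ q) (h : |R - q * m| ≤ K * q)
    (hK : K ≤ κ / 2) (hm : κ ≤ -m) (ht : t ≤ κ / 2) : R ≤ -t * q := by
  have h1 := (abs_le.1 h).2
  have h2 : (K + m + t) * q ≤ 0 := mul_nonpos_of_nonpos_of_nonneg (by linarith) hq
  linarith

/-- With `σ = ξ/δ` the roots are `δσy₀`, `δσy₁` and `δz`, where `y₀`, `y₁` solve the blown up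
equation near `iβ₀`, `iβ₁` and `z` the rescaled one near `-γ`. Exchanging the betas yields `y₁` from
the same statement as `y₀`. -/
theorem IsWaveFamily.hasSmoothRoots {X δ₀ δ₁ : ℝ} {U : ℝ → ℝ → ℝ} {c : ℝ → ℝ}
    (hw : IsWaveFamily X δ₀ U c) (hle : δ₁ ≤ δ₀) {N : NormalForm δ₁ (evansExt X U c)}
    {α : Fin 3 → ℝ} {β : Fin 2 → ℝ} (h : N.IsFactored α (gammaCoeff X U c) β) {M r : ℝ}
    (hM : 0 < M) (hr : 0 < r)
    (hcount : ∀ p ∈ rect r r, ∃ s, Multiset.card s = 3 ∧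
      HasZeros (fun z => evansExt X U c (p, z)) 0 M s) :
    ∃ ρ, 0 < ρ ∧ ∀ η ε, 0 < η → η ≤ ρ → 0 < ε → ε ≤ ρ → HasSmoothRoots X U c α ε η M β := by
  set γ := gammaCoeff X U c with hγdef
  have hconj : ∀ δ ∈ Ico 0 δ₁, ∀ (ξ : ℝ) (z : ℂ), evansExt X U c ((δ, -ξ), (starRingEnd ℂ) z)
      = (starRingEnd ℂ) (evansExt X U c ((δ, ξ), z)) := fun δ hδ ξ z =>
    hw.evansExt_conj ⟨hδ.1, hδ.2.trans_le hle⟩ ξ z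
  obtain ⟨ρ₀, hρ₀, hρ₀₁, y₀, hy₀s, hy₀, C₀, hC₀, hy₀e⟩ := h.exists_blowup_root_expansion hconj
  obtain ⟨ρ₁, hρ₁, -, y₁, hy₁s, hy₁, C₁, hC₁, hy₁e⟩ := h.swap.exists_blowup_root_expansion hconj
  obtain ⟨ρ₂, hρ₂, -, z, hzs, hz0, hz⟩ := h.exists_scaled_root
  simp only [Matrix.cons_val_zero, Matrix.cons_val_one] at hy₁ hy₁e
  have hγ : 0 < |γ| := abs_pos.2 h.gamma_ne
  have hβ : 0 < |β 0 - β 1| := abs_pos.2 (sub_ne_zero.2 h.beta_ne)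
  set m₀ := driftCoeff α (β 0) (β 1) / γ with hm₀
  set m₁ := driftCoeff α (β 1) (β 0) / γ with hm₁
  set Y := |β 0| + |β 1| + |β 0 - β 1| + 1 with hY
  have hYpos : 0 < Y := by positivity
  -- `κ` bounds the strength of both drifts from below when they are negative; otherwise its value
  -- is irrelevant.
  obtain ⟨κ, hκ, hκm⟩ : ∃ κ, 0 < κ ∧ (m₀ < 0 → m₁ < 0 → κ ≤ -m₀ ∧ κ ≤ -m₁) := by
    by_cases hm : m₀ < 0 ∧ m₁ < 0
    · exact ⟨min (-m₀) (-m₁), lt_min (by linarith [hm.1]) (by linarith [hm.2]),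
        fun _ _ => ⟨min_le_left _ _, min_le_right _ _⟩⟩
    · exact ⟨1, one_pos, fun h0 h1 => absurd ⟨h0, h1⟩ hm⟩
  -- The bound `M / (2|γ|)` keeps `δz` in the disc of radius `M`, `|γ| / (2Y)` makes `σy₀` and `σy₁`
  -- smaller than `z`, and the last one holds the remainder below half of the drift.
  obtain ⟨ρ, hρ, hρle⟩ := exists_pos_le_all
    [ρ₀, ρ₁, ρ₂, r, 1, M / (2 * |γ|), |γ| / (2 * Y), κ / (4 * (C₀ + C₁ + 1))] (by
      simp only [List.mem_cons, List.not_mem_nil, or_false, forall_eq_or_imp, forall_eq]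
      exact ⟨hρ₀, hρ₁, hρ₂, hr, one_pos, by positivity, by positivity, by positivity⟩)
  simp only [List.mem_cons, List.not_mem_nil, or_false, forall_eq_or_imp, forall_eq] at hρle
  obtain ⟨hle₀, hle₁, hle₂, hler, hleone, hleM, hleY, hleκ⟩ := hρle
  rw [le_div_iff₀ (by positivity)] at hleM hleY hleκ
  refine ⟨ρ, hρ, fun η ε hη hηρ hε hερ => ?_⟩
  have hrect : ∀ δ ξ : ℝ, 0 < δ → δ ≤ η → |ξ| ≤ ε * δ → (δ, ξ / δ) ∈ rect ρ ρ := by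
    intro δ ξ hδ hδη hξ
    refine ⟨⟨hδ.le, hδη.trans hηρ⟩, abs_le.1 ?_⟩
    rw [abs_div, abs_of_pos hδ, div_le_iff₀ hδ]
    exact hξ.trans (by gcongr)
  have hkey : ∀ δ ξ : ℝ, 0 < δ → δ ≤ η → |ξ| ≤ ε * δ →
      HasZeros (fun w => evansExt X U c ((δ, ξ), w)) 0 M
        {δ * ((ξ / δ : ℝ) * y₀ (δ, ξ / δ)), δ * ((ξ / δ : ℝ) * y₁ (δ, ξ / δ)),
          δ * z (δ, ξ / δ)} := by
    intro δ ξ hδ hδη hξ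
    have hp := hrect δ ξ hδ hδη hξ
    have hξδ : δ * (ξ / δ) = ξ := mul_div_cancel₀ ξ hδ.ne'
    have hδρ : δ ≤ ρ := hδη.trans hηρ
    have hpr : (δ, ξ) ∈ rect r r := by
      refine ⟨⟨hδ.le, hδρ.trans hler⟩, abs_le.1 (hξ.trans ?_)⟩
      calc ε * δ ≤ 1 * ρ := mul_le_mul (hερ.trans hleone) hδρ hδ.le zero_le_one
        _ ≤ r := by rw [one_mul]; exact hler
    obtain ⟨s, hcard, hs⟩ := hcount _ hpr
    set σ := ξ / δ with hσ
    have hσρ : |σ| ≤ ρ := abs_le.2 hp.2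
    have h0 := hy₀ _ (rect_mono hle₀ hle₀ hp)
    have h1 := hy₁ _ (rect_mono hle₁ hle₁ hp)
    have h2 := hz _ (rect_mono hle₂ hle₂ hp)
    have hzlow : |γ| / 2 < ‖z (δ, σ)‖ := by
      have h3 := h2.1
      rw [mem_ball, dist_eq_norm, sub_neg_eq_add] at h3
      have h4 : ‖(γ : ℂ)‖ ≤ ‖z (δ, σ) + γ‖ + ‖z (δ, σ)‖ := by
        simpa using norm_sub_le (z (δ, σ) + γ) (z (δ, σ))
      rw [Complex.norm_real, Real.norm_eq_abs] at h4
      linarith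
    have hzup : ‖z (δ, σ)‖ ≤ 2 * |γ| := by
      have h3 := h2.1
      rw [mem_ball, dist_eq_norm, sub_neg_eq_add] at h3
      have h4 : ‖z (δ, σ)‖ ≤ ‖z (δ, σ) + γ‖ + ‖(γ : ℂ)‖ := by
        simpa using norm_sub_le (z (δ, σ) + γ) (γ : ℂ)
      rw [Complex.norm_real, Real.norm_eq_abs] at h4
      linarith
    have hsmall : ∀ y : ℂ, ‖y‖ ≤ Y → ‖(σ : ℂ) * y‖ < ‖z (δ, σ)‖ := fun y hy => by
      refine lt_of_le_of_lt ?_ hzlow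
      rw [norm_mul, Complex.norm_real, Real.norm_eq_abs]
      have : |σ| * ‖y‖ ≤ ρ * Y := mul_le_mul hσρ hy (norm_nonneg _) hρ.le
      linarith
    have hn0 : ‖y₀ (δ, σ)‖ ≤ Y := by
      have := norm_lt_of_mem_ball h0.1 (abs_nonneg _)
      linarith [abs_nonneg (β 1)]
    have hn1 : ‖y₁ (δ, σ)‖ ≤ Y := by
      have := norm_lt_of_mem_ball h1.1 (abs_nonneg _)
      rw [abs_sub_comm] at this
      linarith [abs_nonneg (β 0)]
    have hyne : y₀ (δ, σ) ≠ y₁ (δ, σ) := fun heq => by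
      have h3 := h0.1
      have h4 := h1.1
      rw [heq, mem_ball, dist_comm] at h3
      rw [mem_ball] at h4
      have h5 := dist_triangle (Complex.I * (β 0 : ℂ)) (y₁ (δ, σ)) (Complex.I * (β 1 : ℂ))
      rw [dist_eq_norm (Complex.I * (β 0 : ℂ)) (Complex.I * (β 1 : ℂ)), ← mul_sub, norm_mul,
        Complex.norm_I, one_mul, ← Complex.ofReal_sub, Complex.norm_real, Real.norm_eq_abs] at h5
      rw [abs_sub_comm (β 1)] at h4
      linarith
    have hδ₁ : δ ∈ Ico 0 δ₁ := ⟨hδ.le, (hδρ.trans hle₀).trans_lt hρ₀₁⟩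
    have hzM : ‖(δ : ℂ) * z (δ, σ)‖ ≤ M := by
      rw [norm_mul, Complex.norm_real, Real.norm_eq_abs, abs_of_pos hδ]
      exact (mul_le_mul hδρ hzup (norm_nonneg _) hρ.le).trans hleM
    have hs' : HasZeros (fun w => evansExt X U c ((δ, δ * σ), w)) 0 M s := by
      rw [hξδ]; exact hs
    rw [← N.eq_roots hδ₁ hδ hcard hs' h0.2 h1.2 h2.2 hyne (hsmall _ hn0) (hsmall _ hn1) hzM]
    exact hs
  have hexp : ∀ (y : ℝ × ℝ → ℂ) (m C δ ξ : ℝ), 0 < δ →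
      |(y (δ, ξ / δ)).re - ξ / δ * m| ≤ C * |ξ / δ| * (δ + (ξ / δ) ^ 2) →
      |((δ : ℂ) * ((ξ / δ : ℝ) * y (δ, ξ / δ))).re - ξ ^ 2 / δ * m|
        ≤ C * (ξ ^ 2 / δ) * (δ + (ξ / δ) ^ 2) := by
    intro y m C δ ξ hδ hb
    have h1 := re_mul_expansion hδ.le hb
    rw [Complex.re_ofReal_mul, Complex.re_ofReal_mul]
    have h2 : δ * (ξ / δ) ^ 2 = ξ ^ 2 / δ := by field_simp
    rw [h2] at h1
    exact h1
  have hbound₀ : ∀ δ ξ : ℝ, 0 < δ → δ ≤ η → |ξ| ≤ ε * δ →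
      |((δ : ℂ) * ((ξ / δ : ℝ) * y₀ (δ, ξ / δ))).re - ξ ^ 2 / δ * m₀|
        ≤ (C₀ + C₁) * (ξ ^ 2 / δ) * (δ + (ξ / δ) ^ 2) := fun δ ξ hδ hδη hξ => by
    refine (hexp y₀ m₀ C₀ δ ξ hδ (hy₀e _
      (rect_mono hle₀ hle₀ (hrect δ ξ hδ hδη hξ)))).trans ?_
    gcongr
    linarith
  have hbound₁ : ∀ δ ξ : ℝ, 0 < δ → δ ≤ η → |ξ| ≤ ε * δ →
      |((δ : ℂ) * ((ξ / δ : ℝ) * y₁ (δ, ξ / δ))).re - ξ ^ 2 / δ * m₁|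
        ≤ (C₀ + C₁) * (ξ ^ 2 / δ) * (δ + (ξ / δ) ^ 2) := fun δ ξ hδ hδη hξ => by
    refine (hexp y₁ m₁ C₁ δ ξ hδ (hy₁e _
      (rect_mono hle₁ hle₁ (hrect δ ξ hδ hδη hξ)))).trans ?_
    gcongr
    linarith
  have hsubr : ∀ ρ', ρ ≤ ρ' → Icc 0 η ×ˢ Icc (-ε) ε ⊆ rect ρ' ρ' := fun ρ' hρ' =>
    rect_mono (hηρ.trans hρ') (hερ.trans hρ')
  have hfst : ContDiff ℝ ∞ fun p : ℝ × ℝ => ((p.1 : ℝ) : ℂ) :=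
    Complex.ofRealCLM.contDiff.comp contDiff_fst
  have hsnd : ContDiff ℝ ∞ fun p : ℝ × ℝ => ((p.2 : ℝ) : ℂ) :=
    Complex.ofRealCLM.contDiff.comp contDiff_snd
  refine ⟨![fun p => p.1 * (p.2 * y₀ p), fun p => p.1 * (p.2 * y₁ p), fun p => p.1 * z p],
    fun j => ?_, fun δ ξ hδ hδη hξ => ?_, fun κ' hκ' => ?_, ⟨C₀ + C₁, fun δ ξ hδ hδη hξ => ?_⟩,
    fun ha hb hc hd hγpos => ?_⟩
  · fin_cases j
    · exact hfst.contDiffOn.mul (hsnd.contDiffOn.mul (hy₀s.mono (hsubr _ hle₀)))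
    · exact hfst.contDiffOn.mul (hsnd.contDiffOn.mul (hy₁s.mono (hsubr _ hle₁)))
    · exact hfst.contDiffOn.mul (hzs.mono (hsubr _ hle₂))
  · have hδ₀ : δ ∈ Ico 0 δ₀ :=
      ⟨hδ.le, ((hδη.trans (hηρ.trans hle₀)).trans_lt hρ₀₁).trans_le hle⟩
    refine areTheRoots_of_hasZeros (hw.differentiable_evans hδ₀ ξ) ?_
    have h1 := (hkey δ ξ hδ hδη hξ).const_mul (k := -Complex.exp (Complex.I * ξ * X))
      (neg_ne_zero.2 (Complex.exp_ne_zero _))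
    simp only [← evans_eq_evansExt hδ] at h1
    exact h1
  · have hzc := hzs.continuousOn (0, 0) (zero_mem_rect hρ₂.le hρ₂.le)
    obtain ⟨t, ht, htz⟩ := Metric.continuousWithinAt_iff.1 hzc κ' hκ'
    refine ⟨t / 2, half_pos ht, fun δ ξ hδ hδη hξ hδt hξt => ?_⟩
    have hp := hrect δ ξ hδ hδη hξ
    have hdist : dist (δ, ξ / δ) ((0, 0) : ℝ × ℝ) < t := by
      rw [Prod.dist_eq, max_lt_iff, Real.dist_eq, Real.dist_eq]
      simp only [sub_zero]
      rw [abs_div, abs_of_pos hδ, div_lt_iff₀ hδ]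
      exact ⟨by linarith, hξt.trans_lt (mul_lt_mul_of_pos_right (half_lt_self ht) hδ)⟩
    have h1 := htz (rect_mono hle₂ hle₂ hp) hdist
    rw [hz0, dist_eq_norm, sub_neg_eq_add] at h1
    have h2 : ((δ : ℂ) * z (δ, ξ / δ)).re + γ * δ = δ * (z (δ, ξ / δ) + γ).re := by
      rw [Complex.re_ofReal_mul, Complex.add_re, Complex.ofReal_re]
      ring
    change |((δ : ℂ) * z (δ, ξ / δ)).re + γ * δ| ≤ κ' * δ
    rw [h2, abs_mul, abs_of_pos hδ, mul_comm]
    exact mul_le_mul_of_nonneg_right ((Complex.abs_re_le_norm _).trans h1.le) hδ.le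
  · have e : ∀ b : ℝ, ξ ^ 2 / (γ * δ) * b = ξ ^ 2 / δ * (b / γ) := fun b => by
      have := h.gamma_ne
      field_simp
    have e' : (C₀ + C₁) * (ξ ^ 2 + ξ ^ 4 / δ ^ 3)
        = (C₀ + C₁) * (ξ ^ 2 / δ) * (δ + (ξ / δ) ^ 2) := by
      field_simp
    rw [e, e, e']
    exact ⟨hbound₀ δ ξ hδ hδη hξ, hbound₁ δ ξ hδ hδη hξ⟩
  · obtain ⟨hd₀, hd₁⟩ := driftCoeff_neg ha hb hc hd
    obtain ⟨hκ₀, hκ₁⟩ := hκm (div_neg_of_neg_of_pos hd₀ hγpos) (div_neg_of_neg_of_pos hd₁ hγpos)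
    -- `κ/2` is what the remainder leaves of the drift. `γ/2` serves the third root: `Re z ≤ -γ/2`,
    -- and `ξ²/δ ≤ δ` because `|ξ/δ| ≤ 1`.
    refine ⟨min (κ / 2) (γ / 2), lt_min (half_pos hκ) (half_pos hγpos),
      fun δ ξ hδ hδη hξ => ?_⟩
    have hp := hrect δ ξ hδ hδη hξ
    have hδρ : δ ≤ ρ := hδη.trans hηρ
    have hσ1 : (ξ / δ) ^ 2 ≤ ρ := by
      have h1 : |ξ / δ| ≤ ρ := abs_le.2 hp.2
      rw [← sq_abs]
      calc |ξ / δ| ^ 2 ≤ |ξ / δ| * 1 := by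
            rw [sq]; exact mul_le_mul_of_nonneg_left (h1.trans hleone) (abs_nonneg _)
        _ ≤ ρ := by rw [mul_one]; exact h1
    have hq : 0 ≤ ξ ^ 2 / δ := by positivity
    have hθ : ∀ m : ℝ, κ ≤ -m → ∀ R : ℝ,
        |R - ξ ^ 2 / δ * m| ≤ (C₀ + C₁) * (ξ ^ 2 / δ) * (δ + (ξ / δ) ^ 2) →
        R ≤ -(min (κ / 2) (γ / 2) / δ) * ξ ^ 2 := fun m hm R hR => by
      have h2 : (C₀ + C₁) * (δ + (ξ / δ) ^ 2) ≤ κ / 2 := by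
        have : (C₀ + C₁) * (δ + (ξ / δ) ^ 2) ≤ (C₀ + C₁) * (2 * ρ) := by
          gcongr
          linarith
        linarith
      have h3 : -(min (κ / 2) (γ / 2) / δ) * ξ ^ 2 = -(min (κ / 2) (γ / 2)) * (ξ ^ 2 / δ) := by
        ring
      rw [h3]
      refine le_neg_mul_of_abs_sub_le hq (hR.trans (le_of_eq ?_)) h2 hm (min_le_left _ _)
      ring
    have hr₀ := hθ m₀ hκ₀ _ (hbound₀ δ ξ hδ hδη hξ)
    have hr₁ := hθ m₁ hκ₁ _ (hbound₁ δ ξ hδ hδη hξ)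
    refine ⟨hr₀, hr₁, fun lam hlam hbloch => ?_⟩
    have hδ₀ : δ ∈ Ico 0 δ₀ :=
      ⟨hδ.le, ((hδη.trans (hηρ.trans hle₀)).trans_lt hρ₀₁).trans_le hle⟩
    have hev := hw.evans_eq_zero_of_isBlochEigenvalue hδ₀ hδ hbloch
    rw [evans_eq_evansExt hδ, mul_eq_zero,
      or_iff_right (neg_ne_zero.2 (Complex.exp_ne_zero _))] at hev
    have hmem := (hkey δ ξ hδ hδη hξ).mem_of_eq_zero (mem_closedBall_zero_iff.2 hlam) hev
    simp only [Multiset.insert_eq_cons, Multiset.mem_cons, Multiset.mem_singleton] at hmem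
    rcases hmem with rfl | rfl | rfl
    · exact hr₀
    · exact hr₁
    · have h2 := (hz _ (rect_mono hle₂ hle₂ hp)).1
      rw [mem_ball, dist_eq_norm, sub_neg_eq_add] at h2
      have h3 := (abs_le.1 ((Complex.abs_re_le_norm _).trans h2.le)).2
      rw [Complex.add_re, Complex.ofReal_re, abs_of_pos hγpos] at h3
      rw [Complex.re_ofReal_mul]
      have h4 : -(min (κ / 2) (γ / 2) / δ) * ξ ^ 2
          = -(min (κ / 2) (γ / 2)) * (δ * (ξ / δ) ^ 2) := by
        field_simp
      rw [h4]
      have h5 : δ * (ξ / δ) ^ 2 ≤ δ * 1 := by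
        gcongr
        exact hσ1.trans hleone
      have h6 := min_le_right (κ / 2) (γ / 2)
      have h7 : 0 < min (κ / 2) (γ / 2) := lt_min (half_pos hκ) (half_pos hγpos)
      have h8 : min (κ / 2) (γ / 2) * (δ * (ξ / δ) ^ 2) ≤ γ / 2 * (δ * 1) :=
        mul_le_mul h6 h5 (by positivity) (by positivity)
      have h9 : δ * (z (δ, ξ / δ)).re ≤ δ * (-(γ / 2)) :=
        mul_le_mul_of_nonneg_left (by linarith) hδ.le
      linarith

end

end KdVKS

/-! ### Assembly of the main theorem with constants independent of the betas. -/

theorem mainTheorem2 (X δ₀ : ℝ) (U : ℝ → ℝ → ℝ) (c : ℝ → ℝ)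
    (hwave : KdVKS.IsWaveFamily X δ₀ U c)
    (α : Fin 3 → ℝ) (hα : StrictMono α)
    (hαchar : ∀ j, KdVKS.IsKdVCharacteristic X (U 0) (c 0) (α j)) :
    ∃ ε₀ η₀ M₀ : ℝ, 0 < ε₀ ∧ 0 < η₀ ∧ 0 < M₀ ∧ η₀ < δ₀ ∧
      -- exactly three roots, counted with multiplicity
      (∀ δ ξ : ℝ, 0 < δ → δ ≤ η₀ → |ξ| ≤ ε₀ * δ →
        ∃ r : Fin 3 → ℂ,
          KdVKS.AreTheRoots (fun lam => KdVKS.evans X δ (U δ) (c δ) lam ξ) M₀ r) ∧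
      -- (S1), i.e. the two betas are real and distinct, and γ ≠ 0
      (∀ β : Fin 2 → ℝ, KdVKS.AreBetas X U c (fun k => (β k : ℂ)) → β 0 ≠ β 1 →
        KdVKS.gammaCoeff X U c ≠ 0 →
        -- the roots are lam_j(ξ, δ) = Λ j (δ, ξ / δ) with Λ j smooth
        ∃ Λ : Fin 3 → ℝ × ℝ → ℂ,
          (∀ j, ContDiffOn ℝ ∞ (Λ j) (Set.Icc 0 η₀ ×ˢ Set.Icc (-ε₀) ε₀)) ∧
          (∀ δ ξ : ℝ, 0 < δ → δ ≤ η₀ → |ξ| ≤ ε₀ * δ →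
            KdVKS.AreTheRoots (fun lam => KdVKS.evans X δ (U δ) (c δ) lam ξ) M₀
              (fun j => Λ j (δ, ξ / δ))) ∧
          -- Re lam_3 = -γ δ + o(δ) as (δ, ξ / δ) → 0
          (∀ κ : ℝ, 0 < κ → ∃ ρ : ℝ, 0 < ρ ∧
            ∀ δ ξ : ℝ, 0 < δ → δ ≤ η₀ → |ξ| ≤ ε₀ * δ → δ ≤ ρ → |ξ| ≤ ρ * δ →
              |(Λ 2 (δ, ξ / δ)).re + KdVKS.gammaCoeff X U c * δ| ≤ κ * δ) ∧
          -- expansions of Re lam_1 and Re lam_2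
          (∃ C : ℝ, ∀ δ ξ : ℝ, 0 < δ → δ ≤ η₀ → |ξ| ≤ ε₀ * δ →
            |(Λ 0 (δ, ξ / δ)).re - ξ ^ 2 / (KdVKS.gammaCoeff X U c * δ)
                * KdVKS.driftCoeff α (β 0) (β 1)| ≤ C * (ξ ^ 2 + ξ ^ 4 / δ ^ 3) ∧
            |(Λ 1 (δ, ξ / δ)).re - ξ ^ 2 / (KdVKS.gammaCoeff X U c * δ)
                * KdVKS.driftCoeff α (β 1) (β 0)| ≤ C * (ξ ^ 2 + ξ ^ 4 / δ ^ 3)) ∧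
          -- consequence of (S2) and (S3)
          (α 0 < β 0 → β 0 < α 1 → α 1 < β 1 → β 1 < α 2 → 0 < KdVKS.gammaCoeff X U c →
            ∃ θ : ℝ, 0 < θ ∧ ∀ δ ξ : ℝ, 0 < δ → δ ≤ η₀ → |ξ| ≤ ε₀ * δ →
              (Λ 0 (δ, ξ / δ)).re ≤ -(θ / δ) * ξ ^ 2 ∧
              (Λ 1 (δ, ξ / δ)).re ≤ -(θ / δ) * ξ ^ 2 ∧
              -- (D2) near the origin: all Bloch eigenvalues of modulus at most M₀
              ∀ lam : ℂ, ‖lam‖ ≤ M₀ → KdVKS.IsBlochEigenvalue X δ (U δ) (c δ) ξ lam →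
                lam.re ≤ -(θ / δ) * ξ ^ 2)) := by
  classical
  obtain ⟨δ₁, hδ₁, hle, ⟨N⟩⟩ := hwave.exists_normalForm hα hαchar
  have hΓ := N.p₃_ne_zero hwave.period_pos hα hαchar
  have hsub : Set.Ico 0 δ₁ ⊆ Set.Ico 0 δ₀ := Set.Ico_subset_Ico_right hle
  obtain ⟨M, r, hM, hr, hr₁, hcount⟩ := N.exists_three_zeros
    ((KdVKS.contDiffOn_evansExt hwave).mono (Set.prod_mono (Set.prod_mono hsub le_rfl) le_rfl))
    (fun p hp => hwave.differentiable_evansExt ⟨hsub hp.1, hp.2⟩) hΓ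
  have hfact : ∀ β : Fin 2 → ℝ, KdVKS.AreBetas X U c (fun k => (β k : ℂ)) → β 0 ≠ β 1 →
      KdVKS.gammaCoeff X U c ≠ 0 → N.IsFactored α (KdVKS.gammaCoeff X U c) β :=
    fun β hβ hne hγ => ⟨hΓ, hγ, hne, N.cubic hα hαchar, fun z => by
      -- By homogeneity the quadratic identity is needed at `ξ = 1` only.
      have h1 := hβ z 1
      rw [N.quad20_eq, N.quad11_eq, N.quad02_eq] at h1
      simp only [Complex.ofReal_one, mul_one, one_pow] at h1
      rw [← mul_assoc, ← N.q₂_eq hwave hle hΓ, ← h1]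
      ring, N.q₂_eq hwave hle hΓ⟩
  -- One `ρ` must serve all admissible betas: the minimum over the two orderings of a single pair
  -- does, and without an admissible pair any `ρ` will do.
  have hunif : ∃ ρ, 0 < ρ ∧ ∀ η ε, 0 < η → η ≤ ρ → 0 < ε → ε ≤ ρ → ∀ β : Fin 2 → ℝ,
      KdVKS.AreBetas X U c (fun k => (β k : ℂ)) → β 0 ≠ β 1 → KdVKS.gammaCoeff X U c ≠ 0 →
        KdVKS.HasSmoothRoots X U c α ε η M β := by
    by_cases hex : ∃ β : Fin 2 → ℝ, KdVKS.AreBetas X U c (fun k => (β k : ℂ)) ∧ β 0 ≠ β 1 ∧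
        KdVKS.gammaCoeff X U c ≠ 0
    · obtain ⟨b, hb, hbne, hγ⟩ := hex
      have hfb := hfact b hb hbne hγ
      obtain ⟨ρ₁, hρ₁, h₁⟩ := hwave.hasSmoothRoots hle hfb hM hr hcount
      obtain ⟨ρ₂, hρ₂, h₂⟩ := hwave.hasSmoothRoots hle hfb.swap hM hr hcount
      refine ⟨min ρ₁ ρ₂, lt_min hρ₁ hρ₂, fun η ε hη hηρ hε hερ β hβ hβne _ => ?_⟩
      rcases hfb.eq_or_eq_swap (hfact β hβ hβne hγ) with rfl | rfl
      · exact h₁ η ε hη (hηρ.trans (min_le_left _ _)) hε (hερ.trans (min_le_left _ _))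
      · exact h₂ η ε hη (hηρ.trans (min_le_right _ _)) hε (hερ.trans (min_le_right _ _))
    · exact ⟨1, one_pos, fun η ε _ _ _ _ β hβ hβne hγ => absurd ⟨β, hβ, hβne, hγ⟩ hex⟩
  obtain ⟨ρ, hρ, hroots⟩ := hunif
  obtain ⟨τ, hτ, hτle⟩ := KdVKS.exists_pos_le_all [ρ, r, 1] (by simp [hρ, hr])
  simp only [List.mem_cons, List.not_mem_nil, or_false, forall_eq_or_imp, forall_eq] at hτle
  obtain ⟨hτρ, hτr, hτ1⟩ := hτle
  refine ⟨τ, τ, M, hτ, hτ, hM, (hτr.trans_lt hr₁).trans_le hle, fun δ ξ hδ hδτ hξ => ?_,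
    hroots τ τ hτ hτρ hτ hτρ⟩
  have hp : (δ, ξ) ∈ KdVKS.rect r r := by
    refine ⟨⟨hδ.le, hδτ.trans hτr⟩, abs_le.1 (hξ.trans ?_)⟩
    calc τ * δ ≤ 1 * τ := mul_le_mul hτ1 hδτ hδ.le zero_le_one
      _ ≤ r := by rw [one_mul]; exact hτr
  obtain ⟨s, hcard, hs⟩ := hcount _ hp
  obtain ⟨a₀, a₁, a₂, rfl⟩ := Multiset.card_eq_three.1 hcard
  have hδ₀ : δ ∈ Set.Ico 0 δ₀ := ⟨hδ.le, (hδτ.trans_lt (hτr.trans_lt hr₁)).trans_le hle⟩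
  refine ⟨![a₀, a₁, a₂], KdVKS.areTheRoots_of_hasZeros (hwave.differentiable_evans hδ₀ ξ) ?_⟩
  have h1 := hs.const_mul (k := -Complex.exp (Complex.I * ξ * X))
    (neg_ne_zero.2 (Complex.exp_ne_zero _))
  simp only [← KdVKS.evans_eq_evansExt hδ] at h1
  exact h1
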